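/- Let $\mathbb K$ be a commutative ring containing $\mathbb Q$, with a $\mathbb Z$-grading concentrated in even degrees. Let $V$ be a free graded $\mathbb K$-module with homogeneous basis $1,(x_i)_{i\in I}$, where $|1|=0$ and $|x_i|\ge 0$ for all $i$. Let $\Sigma V^i=V^{i+1}$, and let $\tau,\boldsymbol t=(t_i)_{i\in I}$ be the dual topological basis of $\Sigma V^*:=\mathrm{Hom}_{\mathbb K}(\Sigma V,\mathbb K)$ (so $|\tau|=1$, $|t_i|=1-|x_i|$). Write $\widehat T[\Sigma V^*]=\mathbb K\langle\langle\tau,\boldsymbol t\rangle\rangle$ for the completed tensor algebra, and $[a,b]=ab-(-1)^{|a||b|}ba$. An $A_\infty$-structure on $V$ is a continuous derivation $m$ of $\widehat T[\Sigma V^*]$ of degree one, vanishing at zero, with $m^2=0$. It is unital with unit $1$ if $$m=A(\boldsymbol t)\partial_\tau+\sum_{i}B_i(\boldsymbol t)\partial_{t_i}+\mathrm{ad}\,\tau-\tau^2\partial_\tau$$ for some $A,B_i\in\mathbb K\langle\langle\boldsymbol t\rangle\rangle$; it is minimal if its linear part is zero; and it is a $C_\infty$-structure if $m$ preserves the completed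 free Lie algebra $\widehat L[\Sigma V^*]\subset\widehat T[\Sigma V^*]$. For a completed tensor algebra $T$ put $DR^0(T)=T/[T,T]$, where $[T,T]$ consists of all convergent (possibly infinite) linear combinations of commutators. The cyclic Hochschild complex is $CC(V)=\Sigma\{q\in DR^0(\widehat T[\Sigma V^*]) : q \text{ vanishes at zero}\}$, with the differential $L_m$ induced by $m$, and $HC^\bullet(V)$ is its cohomology. The ring $\mathbb K$ is regarded as an $A_\infty$-algebra with $m(\tau)=\tau^2$ on $\mathbb K\langle\langle\tau\rangle\rangle$. Let $\Sigma\bar V^*$ be the submodule of $\Sigma V^*$ topologically generated by the $t_i$. Let $m$ be a minimal unital $A_\infty$-structure on $V$ with unit $1$. Then the natural map $DR^0(\widehat T[\Sigma\bar V^*])\to DR^0(\widehat T[\Sigma V^*])$ is injective, and the normalised cochains $$\overline{CC}(V):=\Sigma\{q\in DR^0(\widehat T[\Sigma\bar V^*]) : q\text{ vanishes at zero}\}\subset CC(V)$$ form a subcomplex of $CC(V)$. Let $\overline{HC}^\bullet(V)$ be its cohomology. There is a long exact sequence $$\cdots\xrightarrow{\ \partial\ }\overline{HC}^n(V)\xrightarrow{\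 \iota\ }HC^n(V)\xrightarrow{\ \pi\ }HC^n(\mathbb K)\xrightarrow{\ \partial\ }\overline{HC}^{n+1}(V)\xrightarrow{\ \iota\ }\cdots\qquad(n\in\mathbb Z),$$ where $\iota$ is induced by the inclusion of the normalised cochains, $\pi$ is induced by the map $\tau\mapsto\tau$, $t_i\mapsto 0$ dual to the inclusion $\mathbb K\subset V$, and $\partial$ is the connecting map, satisfying $\partial[\pi x]=[L_m x]$ for every $x\in CC^n(V)$ such that $L_m x$ is normalised. If moreover $m$ is a $C_\infty$-structure, then $\partial=0$. -/

import Mathlib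

namespace HomotopyAlg

/-! Throughout, `K` is a commutative `ℚ`-algebra with a `ℤ`-grading `𝒜` that is concentrated in even
degrees.  A free graded `K`-module `V` with homogeneous basis `(x_j)`, `j : J`, is recorded by the
degrees `deg j` of its basis vectors.  The dual topological basis `t_j` of `Σ V^*` then has degree
`1 - deg j`, and the completed tensor algebra of `Σ V^*` is the algebra `K⟨⟨t_j⟩⟩` of noncommutative
power series, i.e. arbitrary families of coefficients indexed by words. -/

universe u v

/-- Noncommutative power series `K⟨⟨t_j : j ∈ J⟩⟩`: a series is its family of coefficients. -/
abbrev NCSeries (K : Type u) (J : Type v) : Type (max u v) := List J → K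

section Basics

variable {K : Type u} [CommRing K] {J : Type v}

/-- Concatenation product of noncommutative power series. -/
def mul (f g : NCSeries K J) : NCSeries K J :=
  fun w => ∑ k ∈ Finset.range (w.length + 1), f (w.take k) * g (w.drop k)

open Classical in
/-- The power series consisting of the single letter `t_j`. -/
noncomputable def letter (K : Type u) [CommRing K] {J : Type v} (j : J) : NCSeries K J :=
  fun w => if w = [j] then 1 else 0

/-- The degree of the word `t_{j₁} ⋯ t_{jₙ}`. -/
def wordDeg (deg : J → ℤ) (w : List J) : ℤ := (w.map fun j => 1 - deg j).sum

/-- The series agreeing on every finite set of words with some element of `S`: the closure of `S`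
in the profinite topology (the product topology, `K` being discrete). -/
def profiniteClosure (S : Submodule K (NCSeries K J)) : Submodule K (NCSeries K J) where
  carrier := {f | ∀ F : Finset (List J), ∃ g ∈ S, ∀ w ∈ F, g w = f w}
  zero_mem' := fun _ => ⟨0, S.zero_mem, fun _ _ => rfl⟩
  add_mem' := by
    intro a b ha hb F
    obtain ⟨g, hg, hga⟩ := ha F
    obtain ⟨h, hh, hhb⟩ := hb F
    exact ⟨g + h, S.add_mem hg hh, fun w hw => by simp [hga w hw, hhb w hw]⟩
  smul_mem' := by
    intro c a ha F
    obtain ⟨g, hg, hga⟩ := ha F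
    exact ⟨c • g, S.smul_mem c hg, fun w hw => by simp [hga w hw]⟩

/-- The closed submodule generated by `X`: all convergent, possibly infinite, linear combinations
of elements of `X`. -/
def closedSpan (X : Set (NCSeries K J)) : Submodule K (NCSeries K J) :=
  profiniteClosure (Submodule.span K X)

/-- The graded commutator `[f, g] = f g - (-1)^{p q} g f` of series of degrees `p` and `q`. -/
def bracket (p q : ℤ) (f g : NCSeries K J) : NCSeries K J :=
  mul f g - ((p * q).negOnePow : ℤ) • mul g f

/-- A linear endomorphism is continuous for the profinite topology. -/
def IsContinuous (φ : NCSeries K J →ₗ[K] NCSeries K J) : Prop :=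
  ∀ w, ∃ F : Finset (List J), ∀ f, (∀ u ∈ F, f u = 0) → φ f w = 0

/-- Lie monomials in the letters `t_j`, together with their degree. -/
inductive IsLieMonomial (K : Type u) [CommRing K] {J : Type v} (deg : J → ℤ) :
    ℤ → NCSeries K J → Prop
  | letter (j : J) : IsLieMonomial K deg (1 - deg j) (letter K j)
  | bracket {p q : ℤ} {f g : NCSeries K J} : IsLieMonomial K deg p f → IsLieMonomial K deg q g →
      IsLieMonomial K deg (p + q) (bracket p q f g)

/-- The completed free Lie algebra `L̂(Σ V^*)` inside `T̂(Σ V^*)`. -/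
def lieHat (K : Type u) [CommRing K] {J : Type v} (deg : J → ℤ) : Submodule K (NCSeries K J) :=
  closedSpan {f | ∃ p, IsLieMonomial K deg p f}

end Basics

section Graded

variable {K : Type u} [CommRing K] [Algebra ℚ K] (𝒜 : ℤ → Submodule ℚ K) {J : Type v} (deg : J → ℤ)

/-- The series of degree `n`: the coefficient of a word `w` has degree `n - |w|`. -/
def homog (n : ℤ) : Submodule ℚ (NCSeries K J) where
  carrier := {f | ∀ w, f w ∈ 𝒜 (n - wordDeg deg w)}
  zero_mem' := fun _ => Submodule.zero_mem _
  add_mem' := fun ha hb w => Submodule.add_mem _ (ha w) (hb w)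
  smul_mem' := fun c _ ha w => Submodule.smul_mem _ c (ha w)

/-- The module of commutators `[T̂, T̂]`: all convergent linear combinations of commutators. -/
def commutators : Submodule K (NCSeries K J) :=
  closedSpan {h | ∃ p q : ℤ, ∃ f ∈ homog 𝒜 deg p, ∃ g ∈ homog 𝒜 deg q, h = bracket p q f g}

/-- The noncommutative `0`-forms `DR⁰(T̂(Σ V^*)) = T̂ / [T̂, T̂]`. -/
abbrev DRZero : Type (max u v) := NCSeries K J ⧸ commutators 𝒜 deg

/-- The class of a series in `DR⁰`. -/
def cls : NCSeries K J →ₗ[ℚ] DRZero 𝒜 deg := (commutators 𝒜 deg).mkQ.restrictScalars ℚ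

/-- The degree `n` part of the cyclic cochains: (the suspension of) the `0`-forms vanishing at zero.
By the suspension these are the `0`-forms of degree `n + 1`. -/
def cyclicCochains (n : ℤ) : Submodule ℚ (DRZero 𝒜 deg) :=
  Submodule.map (cls 𝒜 deg)
    (homog 𝒜 deg (n + 1) ⊓ LinearMap.ker (LinearMap.proj (R := ℚ) (φ := fun _ => K) ([] : List J)))

/-- An `A∞`-structure on `V`: a continuous derivation `m` of `T̂(Σ V^*)` of degree one which vanishes
at zero and satisfies `m² = 0`. -/
structure AInfStructure where
  m : NCSeries K J →ₗ[K] NCSeries K J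
  continuous : IsContinuous m
  degree_one : ∀ n, ∀ f ∈ homog 𝒜 deg n, m f ∈ homog 𝒜 deg (n + 1)
  leibniz : ∀ n, ∀ f ∈ homog 𝒜 deg n, ∀ g,
    m (mul f g) = mul (m f) g + (n.negOnePow : ℤ) • mul f (m g)
  vanishes_at_zero : ∀ j, m (letter K j) [] = 0
  sq_zero : ∀ f, m (m f) = 0

variable {𝒜 deg}

namespace AInfStructure

/-- The structure is minimal: the linear part of `m` is zero. -/
def IsMinimal (S : AInfStructure 𝒜 deg) : Prop := ∀ j k, S.m (letter K j) [k] = 0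

/-- The structure is a `C∞`-structure: `m` restricts to the completed free Lie algebra. -/
def IsCInf (S : AInfStructure 𝒜 deg) : Prop := ∀ f ∈ lieHat K deg, S.m f ∈ lieHat K deg

theorem commutators_le (S : AInfStructure 𝒜 deg) :
    commutators 𝒜 deg ≤ (commutators 𝒜 deg).comap S.m := by
  classical
  intro f hf F
  choose G hG using S.continuous
  obtain ⟨g, hg, hgf⟩ := hf (F.biUnion G)
  have key : ∀ h ∈ Submodule.span K {h : NCSeries K J | ∃ p q : ℤ, ∃ f ∈ homog 𝒜 deg p,
      ∃ g ∈ homog 𝒜 deg q, h = bracket p q f g}, S.m h ∈ Submodule.span K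
      {h : NCSeries K J | ∃ p q : ℤ, ∃ f ∈ homog 𝒜 deg p,
        ∃ g ∈ homog 𝒜 deg q, h = bracket p q f g} := by
    intro h hh
    induction hh using Submodule.span_induction with
    | zero => simp
    | add x y _ _ hx hy => rw [map_add]; exact Submodule.add_mem _ hx hy
    | smul a x _ hx => rw [map_smul]; exact Submodule.smul_mem _ a hx
    | mem x hx =>
      obtain ⟨p, q, a, ha, b, hb, rfl⟩ := hx
      have e : S.m (bracket p q a b) = bracket (p + 1) q (S.m a) b
          + (p.negOnePow : ℤ) • bracket p (q + 1) a (S.m b) := by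
        unfold bracket
        rw [map_sub, map_zsmul, S.leibniz p a ha b, S.leibniz q b hb a]
        have h1 : ((p * (q + 1)).negOnePow : ℤ) = (p * q).negOnePow * p.negOnePow := by
          rw [mul_add, mul_one, Int.negOnePow_add]; simp
        have h2 : (((p + 1) * q).negOnePow : ℤ) = (p * q).negOnePow * q.negOnePow := by
          rw [add_mul, one_mul, Int.negOnePow_add]; simp
        have h3 : (p.negOnePow : ℤ) * p.negOnePow = 1 := by
          rw [← Units.val_mul, ← Int.negOnePow_add, ← two_mul, Int.negOnePow_two_mul]; rfl
        rw [h1, h2, smul_sub, smul_add, smul_smul, smul_smul,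
          show (p.negOnePow : ℤ) * ((p * q).negOnePow * p.negOnePow)
            = (p * q).negOnePow * (p.negOnePow * p.negOnePow) by ring, h3, mul_one]
        abel
      rw [e]
      refine Submodule.add_mem _ (Submodule.subset_span ?_) (zsmul_mem (Submodule.subset_span ?_) _)
      · exact ⟨_, _, _, S.degree_one _ _ ha, _, hb, rfl⟩
      · exact ⟨_, _, _, ha, _, S.degree_one _ _ hb, rfl⟩
  refine ⟨S.m g, key g hg, fun w hw => ?_⟩
  have := hG w (g - f) (fun u hu => by
    simp [hgf u (Finset.mem_biUnion.2 ⟨w, hw, hu⟩)])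
  rw [map_sub] at this
  exact sub_eq_zero.1 this

/-- The Lie operator `L_m` on `DR⁰`, induced by `m`. -/
def lieOp (S : AInfStructure 𝒜 deg) : DRZero 𝒜 deg →ₗ[ℚ] DRZero 𝒜 deg :=
  (Submodule.mapQ _ _ S.m S.commutators_le).restrictScalars ℚ

theorem lieOp_lieOp (S : AInfStructure 𝒜 deg) (x : DRZero 𝒜 deg) : S.lieOp (S.lieOp x) = 0 := by
  obtain ⟨f, rfl⟩ := Submodule.Quotient.mk_surjective _ x
  change Submodule.Quotient.mk (S.m (S.m f)) = 0
  rw [S.sq_zero, Submodule.Quotient.mk_zero]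

/-- `m f` has vanishing constant term for every series `f`. -/
theorem m_apply_nil [GradedAlgebra 𝒜] (S : AInfStructure 𝒜 deg) (f : NCSeries K J) :
    S.m f [] = 0 := by
  classical
  let mono : List J → NCSeries K J := fun u w => if w = u then 1 else 0
  have h1 : (1 : K) ∈ 𝒜 0 := SetLike.GradedOne.one_mem
  have hnil : S.m (mono []) [] = 0 := by
    have h0 : mono [] ∈ homog 𝒜 deg 0 := by
      intro w
      by_cases h : w = []
      · subst h; simpa [mono, wordDeg] using h1
      · simp [mono, h]
    have h2 : mul (mono []) (mono []) = mono [] := by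
      ext w
      cases w with
      | nil => simp [mul, mono]
      | cons a w =>
        simp only [mul, mono]
        rw [Finset.sum_eq_zero]
        · simp
        · intro k _
          cases k <;> simp
    have h3 := congrFun (S.leibniz 0 _ h0 (mono [])) []
    rw [h2] at h3
    simpa [mul, mono] using h3
  have hmono : ∀ u, S.m (mono u) [] = 0 := by
    intro u
    cases u with
    | nil => exact hnil
    | cons j u =>
      have h0 : letter K j ∈ homog 𝒜 deg (1 - deg j) := by
        intro w
        by_cases h : w = [j]
        · subst h; simpa [letter, wordDeg] using h1
        · simp [letter, h]
      have h2 : mul (letter K j) (mono u) = mono (j :: u) := by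
        ext w
        cases w with
        | nil => simp [mul, mono, letter]
        | cons a w =>
          simp only [mul, mono, letter]
          rw [Finset.sum_eq_single 1]
          · by_cases ha : a = j <;> simp [ha]
          · intro k hkr hk
            rcases k with _ | _ | k
            · simp
            · exact absurd rfl hk
            · cases w with
              | nil => simp at hkr
              | cons b w => simp
          · simp
      have h3 := congrFun (S.leibniz _ _ h0 (mono u)) []
      rw [h2] at h3
      have h4 := S.vanishes_at_zero j
      simpa [mul, letter, h4] using h3
  obtain ⟨F, hF⟩ := S.continuous []
  have h5 := hF (f - ∑ u ∈ F, f u • mono u) (by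
    intro v hv
    simp [Finset.sum_apply, mono, hv])
  rw [map_sub, map_sum] at h5
  simpa [hmono, Finset.sum_apply] using h5

/-- `L_m` preserves the cyclic cochains and has degree one on them. -/
theorem lieOp_mem [GradedAlgebra 𝒜] (S : AInfStructure 𝒜 deg) (n : ℤ) (x : DRZero 𝒜 deg)
    (hx : x ∈ cyclicCochains 𝒜 deg n) : S.lieOp x ∈ cyclicCochains 𝒜 deg (n + 1) := by
  obtain ⟨f, ⟨hf, _⟩, rfl⟩ := hx
  exact ⟨S.m f, ⟨S.degree_one _ _ hf, S.m_apply_nil f⟩, rfl⟩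

end AInfStructure

end Graded

section Cohomology

/-! Cohomology of a graded submodule `C` of a module `X` carrying a differential `d`. -/

variable {X Y : Type*} [AddCommGroup X] [Module ℚ X] [AddCommGroup Y] [Module ℚ Y]

/-- Cocycles of degree `n`. -/
def cocycles (d : X →ₗ[ℚ] X) (C : ℤ → Submodule ℚ X) (n : ℤ) : Submodule ℚ X :=
  C n ⊓ LinearMap.ker d

/-- Coboundaries of degree `n`. -/
def coboundaries (d : X →ₗ[ℚ] X) (C : ℤ → Submodule ℚ X) (n : ℤ) : Submodule ℚ X :=
  (C (n - 1)).map d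

/-- `Hⁿ`: cocycles modulo coboundaries. -/
abbrev Cohomology (d : X →ₗ[ℚ] X) (C : ℤ → Submodule ℚ X) (n : ℤ) : Type _ :=
  cocycles d C n ⧸ (coboundaries d C n).comap (cocycles d C n).subtype

/-- The cohomology class of a cocycle. -/
def Cohomology.mk {d : X →ₗ[ℚ] X} {C : ℤ → Submodule ℚ X} {n : ℤ} (x : X)
    (hx : x ∈ cocycles d C n) : Cohomology d C n := Submodule.Quotient.mk ⟨x, hx⟩

/-- `F` is the map induced in cohomology by `φ`: `φ` takes cocycles to cocycles
and `F [x] = [φ x]`. -/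
def IsInducedBy {d : X →ₗ[ℚ] X} {C : ℤ → Submodule ℚ X} {d' : Y →ₗ[ℚ] Y} {C' : ℤ → Submodule ℚ Y}
    {n : ℤ} (F : Cohomology d C n →ₗ[ℚ] Cohomology d' C' n) (φ : X →ₗ[ℚ] Y) : Prop :=
  ∀ (x : X) (hx : x ∈ cocycles d C n), ∃ hy : φ x ∈ cocycles d' C' n,
    F (Cohomology.mk x hx) = Cohomology.mk (φ x) hy

end Cohomology

section Unital

/-! A free graded module `V` with homogeneous basis `1, (x_i)_{i ∈ I}`, where `1` has degree zero:
the index set is `Option I`, with `none` the index of `1`.  The dual basis of `Σ V^*` is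
`τ, (t_i)_{i ∈ I}`. -/

variable {K : Type u} [CommRing K] {I : Type v}

/-- The degrees of the basis `1, (x_i)`. -/
def unitalDeg (deg : I → ℤ) (j : Option I) : ℤ := j.elim 0 deg

/-- The inclusion `K⟨⟨t⟩⟩ ⊆ K⟨⟨τ, t⟩⟩`, i.e. `T̂(Σ V̄^*) ⊆ T̂(Σ V^*)`. -/
def incl : NCSeries K I →ₗ[K] NCSeries K (Option I) where
  toFun f w := if w.all Option.isSome then f w.reduceOption else 0
  map_add' f g := by
    ext w
    by_cases h : w.all Option.isSome
    · simp only [Pi.add_apply, if_pos h]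
    · simp only [Pi.add_apply, if_neg h, add_zero]
  map_smul' c f := by
    ext w
    by_cases h : w.all Option.isSome
    · simp only [Pi.smul_apply, RingHom.id_apply, if_pos h]
    · simp only [Pi.smul_apply, RingHom.id_apply, if_neg h, smul_zero]

/-- The letter `τ`. -/
noncomputable def tau (K : Type u) [CommRing K] (I : Type v) : NCSeries K (Option I) :=
  letter K none

variable [Algebra ℚ K] {𝒜 : ℤ → Submodule ℚ K} {deg : I → ℤ}

/-- `1` is a unit: `m = A(t) ∂_τ + ∑ B_i(t) ∂_{t_i} + ad τ - τ² ∂_τ` for power series `A(t), B_i(t)`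
in the variables `t` only.  A continuous derivation is determined by its values on the letters. -/
def AInfStructure.IsUnital (S : AInfStructure 𝒜 (unitalDeg deg)) : Prop :=
  (∃ A : NCSeries K I,
    S.m (tau K I) = incl A + bracket 1 1 (tau K I) (tau K I) - mul (tau K I) (tau K I)) ∧
  ∀ i, ∃ B : NCSeries K I,
    S.m (letter K (some i)) = incl B + bracket 1 (1 - deg i) (tau K I) (letter K (some i))

/-- The normalised cyclic cochains of degree `n`: the image in `DR⁰(T̂(Σ V^*))` of (the suspension
of) the `0`-forms of `T̂(Σ V̄^*)` vanishing at zero. -/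
def normalisedCochains (𝒜 : ℤ → Submodule ℚ K) (deg : I → ℤ) (n : ℤ) :
    Submodule ℚ (DRZero 𝒜 (unitalDeg deg)) :=
  Submodule.map (cls 𝒜 (unitalDeg deg) ∘ₗ incl.restrictScalars ℚ)
    (homog 𝒜 deg (n + 1) ⊓ LinearMap.ker (LinearMap.proj (R := ℚ) (φ := fun _ => K) ([] : List I)))

end Unital

section GroundRing

/-! The ground ring as an `A∞`-algebra, with basis `1` of degree zero; `T̂(Σ K^*) = K⟨⟨τ⟩⟩`. -/

variable {K : Type u} [CommRing K]

/-- The derivation of `K⟨⟨τ⟩⟩` with `τ ↦ τ²`, that is `τⁿ ↦ τⁿ⁺¹` for odd `n` and `τⁿ ↦ 0` for even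
`n`, as `τ` is odd. -/
def groundMap : NCSeries K Unit →ₗ[K] NCSeries K Unit where
  toFun f w := if w ≠ [] ∧ Even w.length then f w.tail else 0
  map_add' f g := by ext w; by_cases h : w ≠ [] ∧ Even w.length <;> simp [h]
  map_smul' c f := by ext w; by_cases h : w ≠ [] ∧ Even w.length <;> simp [h]

theorem groundMap_tau :
    groundMap (letter K ()) = mul (letter K ()) (letter K ()) := by
  ext w
  rcases w with _ | ⟨a, _ | ⟨b, _ | ⟨c, w⟩⟩⟩
  · simp [groundMap, mul, letter]
  · simp [groundMap, mul, letter, Finset.sum_range_succ]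
  · simp [groundMap, mul, letter, Finset.sum_range_succ]
  · simp only [groundMap, mul, letter, LinearMap.coe_mk, AddHom.coe_mk]
    rw [Finset.sum_eq_zero]
    · simp
    · intro k _
      rcases k with _ | _ | k <;> simp

variable [Algebra ℚ K] {𝒜 : ℤ → Submodule ℚ K}

theorem groundMap_leibniz (hodd : ∀ n, Odd n → 𝒜 n = ⊥) (n : ℤ) (f : NCSeries K Unit)
    (hf : f ∈ homog 𝒜 (fun _ : Unit => 0) n) (g : NCSeries K Unit) :
    groundMap (mul f g) = mul (groundMap f) g + (n.negOnePow : ℤ) • mul f (groundMap g) := by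
  have hsign : ∀ w, (n.negOnePow : ℤ) • f w = (((w.length : ℤ).negOnePow : ℤˣ) : ℤ) • f w := by
    intro w
    have h := hf w
    have hw : wordDeg (fun _ : Unit => 0) w = w.length := by simp [wordDeg]
    rw [hw] at h
    by_cases hp : Even (n - w.length)
    · rw [(Int.negOnePow_eq_iff _ _).2 hp]
    · rw [hodd _ (Int.not_even_iff_odd.1 hp), Submodule.mem_bot] at h
      simp [h]
  ext w
  rcases w with _ | ⟨a, w⟩
  · simp [groundMap, mul]
  simp only [groundMap, mul, LinearMap.coe_mk, AddHom.coe_mk, Pi.add_apply, Pi.smul_apply,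
    Finset.smul_sum, List.length_cons]
  rw [Finset.sum_range_succ' _ (w.length + 1), Finset.sum_range_succ _ (w.length + 1)]
  have hd : ∀ k ∈ Finset.range (w.length + 1),
      w.take k = (a :: w).take k ∧ w.drop k = ((a :: w).drop k).tail := by
    intro k hk
    have hk' : k ≤ w.length := Nat.lt_succ_iff.1 (Finset.mem_range.1 hk)
    constructor
    · refine List.ext_getElem (by simp; omega) (fun _ _ _ => Subsingleton.elim _ _)
    · simp
  simp only [List.take_zero, ne_eq, not_true_eq_false, false_and, if_false, zero_mul, add_zero]
  have e0 : ((n.negOnePow : ℤ) • (f ((a :: w).take (w.length + 1)) *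
      if ¬ (a :: w).drop (w.length + 1) = [] ∧ Even ((a :: w).drop (w.length + 1)).length
        then g ((a :: w).drop (w.length + 1)).tail else 0)) = 0 := by
    simp
  rw [e0, add_zero, ← Finset.sum_add_distrib]
  have hne : ¬ (a :: w = []) := by simp
  simp only [hne, not_false_eq_true, true_and]
  have hif : (if Even (w.length + 1) then
      ∑ k ∈ Finset.range ((a :: w).tail.length + 1),
        f ((a :: w).tail.take k) * g ((a :: w).tail.drop k) else 0) =
      ∑ k ∈ Finset.range (w.length + 1),
        if Even (w.length + 1) then f (w.take k) * g (w.drop k) else 0 := by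
    split_ifs <;> simp
  rw [hif]
  refine Finset.sum_congr rfl fun k hk => ?_
  obtain ⟨h1, h2⟩ := hd k hk
  have hk' : k ≤ w.length := Nat.lt_succ_iff.1 (Finset.mem_range.1 hk)
  have h3 : (a :: w).drop k ≠ [] := by
    intro h
    have := congrArg List.length h
    simp at this
    omega
  rw [← smul_mul_assoc, hsign, ← h1, ← h2]
  have hl : (w.take k).length = k := by simp [hk']
  have hl2 : ((a :: w).drop k).length = w.length + 1 - k := by simp
  have hl3 : ((a :: w).take (k + 1)).length = k + 1 := by simp [hk']
  have h4 : (a :: w).take (k + 1) ≠ [] := by simp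
  have h5 : ((a :: w).take (k + 1)).tail = w.take k := by simp
  have h6 : (a :: w).drop (k + 1) = w.drop k := by simp
  rw [hl, hl2, hl3, h5, h6]
  simp only [h3, h4, not_false_eq_true, true_and]
  by_cases hkk : Even k
  · have hk1 : ¬ Even (k + 1) := by simpa [Nat.even_add_one] using hkk
    have e1 : ((k : ℤ).negOnePow : ℤ) = 1 := by
      rw [Int.negOnePow_even _ (by exact_mod_cast hkk)]; rfl
    have e2 : Even (w.length + 1 - k) ↔ Even (w.length + 1) := by
      rw [Nat.even_sub (by omega)]; simp [hkk]
    by_cases hw : Even (w.length + 1) <;> simp [hk1, e1, e2, hw]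
  · have hk1 : Even (k + 1) := by simpa [Nat.even_add_one] using hkk
    have e1 : ((k : ℤ).negOnePow : ℤ) = -1 := by
      rw [Int.negOnePow_odd _ (by exact_mod_cast Nat.not_even_iff_odd.1 hkk)]; rfl
    have e2 : Even (w.length + 1 - k) ↔ ¬ Even (w.length + 1) := by
      rw [Nat.even_sub (by omega)]; simp [hkk]
    by_cases hw : Even (w.length + 1) <;> simp [hk1, e1, e2, hw]

/-- The `A∞`-structure of the ground ring `K`. -/
def groundStructure (hodd : ∀ n, Odd n → 𝒜 n = ⊥) :
    AInfStructure 𝒜 (fun _ : Unit => 0) where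
  m := groundMap
  continuous w := ⟨{w.tail}, fun f hf => by simp [groundMap, hf]⟩
  degree_one n f hf w := by
    by_cases h : w ≠ [] ∧ Even w.length
    · have h1 := hf w.tail
      have hpos : 1 ≤ w.length := List.length_pos_iff.2 h.1
      have h2 : n + 1 - wordDeg (fun _ : Unit => 0) w
          = n - wordDeg (fun _ : Unit => 0) w.tail := by
        simp [wordDeg, Nat.cast_sub hpos]
        ring
      simpa only [groundMap, LinearMap.coe_mk, AddHom.coe_mk, if_pos h, h2] using h1
    · simp only [groundMap, LinearMap.coe_mk, AddHom.coe_mk, if_neg h, Submodule.zero_mem]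
  leibniz n f hf g := groundMap_leibniz hodd n f hf g
  vanishes_at_zero _ := by simp [groundMap]
  sq_zero f := by
    have hz : ∀ w, groundMap (groundMap f) w = 0 := by
      intro w
      change (if w ≠ [] ∧ Even w.length then
        (if w.tail ≠ [] ∧ Even w.tail.length then f w.tail.tail else 0) else 0) = 0
      rcases w with _ | ⟨a, w⟩
      · simp
      · by_cases hw : Even w.length <;> simp [Nat.even_add_one, hw]
    exact funext hz

variable {I : Type v} {deg : I → ℤ}

/-- The map `K⟨⟨τ, t⟩⟩ → K⟨⟨τ⟩⟩`, `τ ↦ τ`, `t_i ↦ 0`, dual to the inclusion `K ⊆ V`. -/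
def restrictUnit : NCSeries K (Option I) →ₗ[K] NCSeries K Unit where
  toFun f u := f (u.map fun _ => none)
  map_add' _ _ := rfl
  map_smul' _ _ := rfl

theorem restrictUnit_commutators :
    commutators 𝒜 (unitalDeg deg) ≤
      (commutators 𝒜 (fun _ : Unit => 0)).comap (restrictUnit (K := K) (I := I)) := by
  classical
  intro f hf F
  obtain ⟨g, hg, hgf⟩ := hf (F.image (List.map fun _ => none))
  refine ⟨restrictUnit g, ?_, fun w hw => hgf _ (Finset.mem_image_of_mem _ hw)⟩
  clear hgf
  have hmul : ∀ a b : NCSeries K (Option I),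
      restrictUnit (mul a b) = mul (restrictUnit a) (restrictUnit b) := by
    intro a b
    ext w
    simp [restrictUnit, mul]
  have hhom : ∀ (n : ℤ) (a : NCSeries K (Option I)), a ∈ homog 𝒜 (unitalDeg deg) n →
      restrictUnit a ∈ homog 𝒜 (fun _ : Unit => 0) n := by
    intro n a ha w
    have := ha (w.map fun _ => none)
    simpa [wordDeg, unitalDeg, restrictUnit, Function.comp_def] using this
  induction hg using Submodule.span_induction with
  | zero => simp
  | add x y _ _ hx hy => rw [map_add]; exact Submodule.add_mem _ hx hy
  | smul a x _ hx => rw [map_smul]; exact Submodule.smul_mem _ a hx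
  | mem x hx =>
    obtain ⟨p, q, a, ha, b, hb, rfl⟩ := hx
    refine Submodule.subset_span ⟨p, q, _, hhom p a ha, _, hhom q b hb, ?_⟩
    simp only [bracket, map_sub, map_zsmul, hmul]

/-- The map `π` on `0`-forms, dual to the inclusion `K ⊆ V`. -/
def piMap (𝒜 : ℤ → Submodule ℚ K) (deg : I → ℤ) :
    DRZero 𝒜 (unitalDeg deg) →ₗ[ℚ] DRZero 𝒜 (fun _ : Unit => 0) :=
  (Submodule.mapQ _ _ restrictUnit restrictUnit_commutators).restrictScalars ℚ

end GroundRing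

section CyclicCohomology

variable {K : Type u} [CommRing K] [Algebra ℚ K]

/-- Cyclic Hochschild cohomology `HCⁿ(V)`. -/
abbrev HC {𝒜 : ℤ → Submodule ℚ K} {J : Type v} {deg : J → ℤ} (S : AInfStructure 𝒜 deg) (n : ℤ) :
    Type (max u v) :=
  Cohomology S.lieOp (cyclicCochains 𝒜 deg) n

/-- Normalised cyclic cohomology of a unital `A∞`-algebra. -/
abbrev HCNorm {𝒜 : ℤ → Submodule ℚ K} {I : Type v} {deg : I → ℤ}
    (S : AInfStructure 𝒜 (unitalDeg deg)) (n : ℤ) : Type (max u v) :=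
  Cohomology S.lieOp (normalisedCochains 𝒜 deg) n

end CyclicCohomology

end HomotopyAlg

open HomotopyAlg

/-!
Modulo the closure of the graded commutators a series is determined by its constant term and by its
*norm*, the sum `cycNorm` of its rotations: since `K` contains `ℚ`, the closed commutator submodule
is the kernel of the norm on series without constant term (`mem_commutators_iff`). So, apart from
constants, `DR⁰` is the space of rotation invariant series, which gives the injectivity of
`DR⁰(T̂(Σ V̄^*)) → DR⁰(T̂(Σ V^*))` at once. On series in the `t_i` alone, `m` is a derivation of
`K⟨⟨t⟩⟩` plus the inner derivation `ad τ`, and inner derivations vanish modulo commutators; so the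
normalised cochains are a subcomplex.

*The exact sequence.* It suffices that the kernel of `π`, modulo the normalised cochains, is
acyclic: a cochain `f` which vanishes on the powers of `τ`, and whose differential is normalised,
is a coboundary up to a normalised cochain (`AInfStructure.exists_primitive`). By minimality the
part of `m` that does not increase the number of letters `t_i` is `ad τ - τ² ∂_τ`. Modulo
commutators only `τ ↦ -τ²` is left, which acts on each run of letters `τ` separately; together with
its transpose it satisfies a Laplacian identity (`mergeTau_doubleTau`) whose eigenvalue is, up to
sign, the number of runs of `τ`. Hence the transpose, divided by this number, is a contraction of
the leading part on words containing both `τ` and some `t_i`, and a perturbation series in the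
number of letters `t_i`, which converges, corrects it to a contraction for `m`.

*The `C∞` case.* The connecting map vanishes if every cocycle of `K⟨⟨τ⟩⟩` lifts to a cocycle.
Modulo commutators only the odd powers of `τ` survive. In a minimal `C∞`-algebra `m τ` is a Lie
series without linear part, so that `τ` itself is a cocycle. The other powers come from the
periodicity operator. A *cyclic one-form* is a combination of words with a marked letter, up to
rotation, and is encoded by the series in which the marked letter is last; `m` acts on one-forms
through `IsOddDerivation.act`. In this encoding `f dg ↦ [f, g]` is `1 - rot` and `g ↦ dg` is the
norm, and both commute with the action of `m`. If `m f` is a sum of commutators it is `h - rot h`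
for some `h`, and then `act h` is rotation invariant and so the norm of a series, again a cocycle
(`AInfStructure.cycNorm_m_periodicity`). This operator takes `τ^{2k+1}` to a nonzero rational
multiple of `τ^{2k+3}` as far as powers of `τ` are concerned, and it raises the length of words, so
that infinite combinations of the resulting cocycles converge.
-/

namespace HomotopyAlg

universe u v

/-! ### Parities and signs -/

section Signs

variable {K : Type u} [CommRing K] {J : Type v}

/-- The sign `(-1)^x` in `K` of a parity `x`. -/
def sg (K : Type u) [CommRing K] (x : ZMod 2) : K := if x = 0 then 1 else -1

theorem zmod2_cases (x : ZMod 2) : x = 0 ∨ x = 1 := by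
  revert x; decide

@[simp] theorem sg_zero : sg K 0 = 1 := by simp [sg]

@[simp] theorem sg_one : sg K 1 = -1 := by simp [sg]

theorem sg_add (x y : ZMod 2) : sg K (x + y) = sg K x * sg K y := by
  have h2 : (1 + 1 : ZMod 2) = 0 := by decide
  rcases zmod2_cases x with rfl | rfl <;> rcases zmod2_cases y with rfl | rfl <;> simp [h2]

theorem sg_mul_self (x : ZMod 2) : sg K x * sg K x = 1 := by
  rcases zmod2_cases x with rfl | rfl <;> simp

theorem negOnePow_eq_sg (n : ℤ) : (((n.negOnePow : ℤˣ) : ℤ) : K) = sg K (n : ZMod 2) := by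
  rcases Int.even_or_odd n with h | h
  · rw [Int.negOnePow_even _ h,
      (ZMod.intCast_zmod_eq_zero_iff_dvd n 2).2 (by exact_mod_cast h.two_dvd)]
    simp
  · have h1 : ((n : ℤ) : ZMod 2) = 1 := by
      obtain ⟨k, rfl⟩ := h
      have h2 : (2 : ZMod 2) = 0 := by decide
      push_cast
      rw [h2]; simp
    rw [Int.negOnePow_odd _ h, h1]
    simp

theorem sg_natCast (n : ℕ) : sg K (n : ZMod 2) = if Even n then 1 else -1 := by
  by_cases h : Even n
  · rw [if_pos h, (ZMod.natCast_eq_zero_iff n 2).2 h.two_dvd, sg_zero]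
  · rw [if_neg h]
    have : (n : ZMod 2) ≠ 0 := fun h1 =>
      h (even_iff_two_dvd.2 ((ZMod.natCast_eq_zero_iff n 2).1 h1))
    rw [sg, if_neg this]

/-- The parity of the degree of a word. -/
def par (deg : J → ℤ) (w : List J) : ZMod 2 := (wordDeg deg w : ZMod 2)

variable (deg : J → ℤ)

@[simp] theorem par_nil : par deg [] = 0 := by simp [par, wordDeg]

theorem par_append (u v : List J) : par deg (u ++ v) = par deg u + par deg v := by
  simp [par, wordDeg]

theorem par_cons (j : J) (v : List J) : par deg (j :: v) = par deg [j] + par deg v := by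
  rw [← par_append]; rfl

theorem wordDeg_append (u v : List J) : wordDeg deg (u ++ v) = wordDeg deg u + wordDeg deg v := by
  simp [wordDeg]

theorem intCast_eq_of_even_sub {a b : ℤ} (h : Even (a - b)) : (a : ZMod 2) = (b : ZMod 2) := by
  rw [← sub_eq_zero, ← Int.cast_sub]
  exact (ZMod.intCast_zmod_eq_zero_iff_dvd _ 2).2 (by exact_mod_cast h.two_dvd)

/-- All words occurring in the series `f` have parity `p`. -/
def HasPar (p : ZMod 2) (f : NCSeries K J) : Prop := ∀ w, f w ≠ 0 → par deg w = p

end Signs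

/-! ### Continuous linear maps are determined by monomials -/

section Monomials

variable {K : Type u} [CommRing K] {J : Type v}

open Classical in
/-- The series consisting of a single word. -/
noncomputable def mono (K : Type u) [CommRing K] {J : Type v} (u : List J) : NCSeries K J :=
  fun w => if w = u then 1 else 0

theorem letter_eq_mono (j : J) : letter K j = mono K [j] := rfl

@[simp] theorem mono_self (u : List J) : mono K u u = 1 := by simp [mono]

theorem mono_of_ne {u w : List J} (h : w ≠ u) : mono K u w = 0 := by simp [mono, h]

theorem eq_of_mono_ne {u w : List J} (h : mono K u w ≠ 0) : w = u := by
  by_contra h1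
  exact h (mono_of_ne h1)

theorem hasPar_mono (deg : J → ℤ) (u : List J) : HasPar deg (par deg u) (mono K u) :=
  fun w hw => by rw [eq_of_mono_ne hw]

theorem IsContinuous.exists_eq_sum {φ : NCSeries K J →ₗ[K] NCSeries K J} (hφ : IsContinuous φ)
    (w : List J) : ∃ F : Finset (List J), ∀ f, φ f w = ∑ u ∈ F, f u * φ (mono K u) w := by
  classical
  obtain ⟨F, hF⟩ := hφ w
  refine ⟨F, fun f => ?_⟩
  have h := hF (f - ∑ u ∈ F, f u • mono K u) (by
    intro v hv
    simp [Finset.sum_apply, mono, hv])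
  rw [map_sub, map_sum, Pi.sub_apply, sub_eq_zero] at h
  simpa [Finset.sum_apply] using h

/-- A continuous linear map vanishes on a series as soon as it vanishes on its monomials. -/
theorem IsContinuous.apply_eq_zero {φ : NCSeries K J →ₗ[K] NCSeries K J} (hφ : IsContinuous φ)
    {f : NCSeries K J} {w : List J} (h : ∀ u, f u ≠ 0 → φ (mono K u) w = 0) : φ f w = 0 := by
  obtain ⟨F, hF⟩ := hφ.exists_eq_sum w
  rw [hF]
  refine Finset.sum_eq_zero fun u _ => ?_
  by_cases hu : f u = 0
  · rw [hu, zero_mul]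
  · rw [h u hu, mul_zero]

theorem IsContinuous.apply_congr {φ ψ : NCSeries K J →ₗ[K] NCSeries K J} (hφ : IsContinuous φ)
    (hψ : IsContinuous ψ) {f : NCSeries K J} {w : List J}
    (h : ∀ u, f u ≠ 0 → φ (mono K u) w = ψ (mono K u) w) : φ f w = ψ f w := by
  classical
  have hc : IsContinuous (φ - ψ) := by
    intro w
    obtain ⟨F, hF⟩ := hφ w
    obtain ⟨G, hG⟩ := hψ w
    refine ⟨F ∪ G, fun f hf => ?_⟩
    rw [LinearMap.sub_apply, Pi.sub_apply, hF f fun u hu => hf u (Finset.mem_union_left _ hu),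
      hG f fun u hu => hf u (Finset.mem_union_right _ hu), sub_zero]
  have := hc.apply_eq_zero (f := f) (w := w) fun u hu => by
    rw [LinearMap.sub_apply, Pi.sub_apply, h u hu, sub_self]
  rwa [LinearMap.sub_apply, Pi.sub_apply, sub_eq_zero] at this

theorem IsContinuous.add {φ ψ : NCSeries K J →ₗ[K] NCSeries K J} (hφ : IsContinuous φ)
    (hψ : IsContinuous ψ) : IsContinuous (φ + ψ) := by
  classical
  intro w
  obtain ⟨F, hF⟩ := hφ w
  obtain ⟨G, hG⟩ := hψ w
  refine ⟨F ∪ G, fun f hf => ?_⟩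
  rw [LinearMap.add_apply, Pi.add_apply, hF f fun u hu => hf u (Finset.mem_union_left _ hu),
    hG f fun u hu => hf u (Finset.mem_union_right _ hu), add_zero]

theorem IsContinuous.smul {φ : NCSeries K J →ₗ[K] NCSeries K J} (hφ : IsContinuous φ)
    (c : K) : IsContinuous (c • φ) := by
  intro w
  obtain ⟨F, hF⟩ := hφ w
  exact ⟨F, fun f hf => by rw [LinearMap.smul_apply, Pi.smul_apply, hF f hf, smul_zero]⟩

theorem IsContinuous.sub {φ ψ : NCSeries K J →ₗ[K] NCSeries K J} (hφ : IsContinuous φ)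
    (hψ : IsContinuous ψ) : IsContinuous (φ - ψ) := by
  have e : φ - ψ = φ + (-1 : K) • ψ := by
    ext f w
    simp [sub_eq_add_neg]
  rw [e]
  exact hφ.add (hψ.smul (-1))

theorem IsContinuous.comp {φ ψ : NCSeries K J →ₗ[K] NCSeries K J} (hφ : IsContinuous φ)
    (hψ : IsContinuous ψ) : IsContinuous (φ ∘ₗ ψ) := by
  classical
  intro w
  obtain ⟨F, hF⟩ := hφ w
  choose G hG using hψ
  exact ⟨F.biUnion G, fun f hf => hF _ fun u hu => hG u f fun v hv =>
    hf v (Finset.mem_biUnion.2 ⟨u, hu, hv⟩)⟩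

theorem isContinuous_id : IsContinuous (LinearMap.id : NCSeries K J →ₗ[K] NCSeries K J) :=
  fun w => ⟨{w}, fun f hf => hf w (by simp)⟩

theorem isContinuous_of_pointwise {φ : NCSeries K J →ₗ[K] NCSeries K J}
    (h : ∀ w, ∃ ψ : NCSeries K J →ₗ[K] NCSeries K J, IsContinuous ψ ∧ ∀ f, φ f w = ψ f w) :
    IsContinuous φ := by
  intro w
  obtain ⟨ψ, hψ, h1⟩ := h w
  obtain ⟨F, hF⟩ := hψ w
  exact ⟨F, fun f hf => by rw [h1, hF f hf]⟩

theorem IsContinuous.sum {α : Type*} (s : Finset α) {φ : α → NCSeries K J →ₗ[K] NCSeries K J}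
    (hφ : ∀ a ∈ s, IsContinuous (φ a)) : IsContinuous (∑ a ∈ s, φ a) := by
  classical
  induction s using Finset.induction_on with
  | empty => exact fun w => ⟨∅, fun f _ => by simp⟩
  | insert a s ha ih =>
    rw [Finset.sum_insert ha]
    exact (hφ a (Finset.mem_insert_self _ _)).add
      (ih fun b hb => hφ b (Finset.mem_insert_of_mem hb))

/-- The image of a series under a continuous linear map lies in the closure of any submodule
containing the images of its monomials. -/
theorem IsContinuous.apply_mem_profiniteClosure {φ : NCSeries K J →ₗ[K] NCSeries K J}
    (hφ : IsContinuous φ) (S : Submodule K (NCSeries K J)) {f : NCSeries K J}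
    (h : ∀ u, f u ≠ 0 → φ (mono K u) ∈ S) : φ f ∈ profiniteClosure S := by
  classical
  intro F
  choose G hG using hφ
  refine ⟨∑ u ∈ F.biUnion G, f u • φ (mono K u), Submodule.sum_mem _ fun u _ => ?_, ?_⟩
  · by_cases hu : f u = 0
    · rw [hu, zero_smul]; exact Submodule.zero_mem _
    · exact Submodule.smul_mem _ _ (h u hu)
  · intro w hw
    have h := hG w (f - ∑ u ∈ F.biUnion G, f u • mono K u) (by
      intro v hv
      have hv' : v ∈ F.biUnion G := Finset.mem_biUnion.2 ⟨w, hw, hv⟩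
      rw [Pi.sub_apply, Finset.sum_apply, Finset.sum_eq_single v]
      · simp
      · intro b _ hb
        simp [mono_of_ne hb.symm]
      · exact fun h => absurd hv' h)
    rw [map_sub, map_sum, Pi.sub_apply, sub_eq_zero] at h
    rw [h]
    simp [Finset.sum_apply]

/-- A locally finite sum: the `k`-th summand is only seen by words of weight at least `k`. -/
def locSum (μ : List J → ℕ) (F : ℕ → NCSeries K J) : NCSeries K J :=
  fun w => ∑ k ∈ Finset.range (μ w + 1), F k w

theorem locSum_apply {μ : List J → ℕ} {F : ℕ → NCSeries K J}
    (hF : ∀ k w, μ w < k → F k w = 0) {w : List J} {n : ℕ} (hn : μ w < n) :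
    locSum μ F w = ∑ k ∈ Finset.range n, F k w := by
  refine Finset.sum_subset (fun k hk => ?_) fun k _ hk => ?_
  · simp only [Finset.mem_range] at hk ⊢; omega
  · exact hF k w (by simp only [Finset.mem_range] at hk; omega)

theorem IsContinuous.map_locSum {φ : NCSeries K J →ₗ[K] NCSeries K J} (hφ : IsContinuous φ)
    {μ : List J → ℕ} {F : ℕ → NCSeries K J} (hF : ∀ k w, μ w < k → F k w = 0) (w : List J) :
    ∃ n₀, ∀ n, n₀ ≤ n → φ (locSum μ F) w = ∑ k ∈ Finset.range n, φ (F k) w := by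
  obtain ⟨G, hG⟩ := hφ w
  refine ⟨G.sup μ + 1, fun n hn => ?_⟩
  have := hG (locSum μ F - ∑ k ∈ Finset.range n, F k) (by
    intro u hu
    have : μ u ≤ G.sup μ := Finset.le_sup hu
    rw [Pi.sub_apply, locSum_apply hF (n := n) (by omega), Finset.sum_apply, sub_self])
  rw [map_sub, map_sum, Pi.sub_apply, sub_eq_zero] at this
  rw [this, Finset.sum_apply]

end Monomials

/-! ### The product -/

section Product

variable {K : Type u} [CommRing K] {J : Type v}

/-- The product as a bilinear map. -/
def mulB : NCSeries K J →ₗ[K] NCSeries K J →ₗ[K] NCSeries K J :=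
  LinearMap.mk₂ K mul
    (fun f g h => by ext w; simp [mul, add_mul, Finset.sum_add_distrib])
    (fun c f g => by ext w; simp [mul, Finset.mul_sum, mul_assoc])
    (fun f g h => by ext w; simp [mul, mul_add, Finset.sum_add_distrib])
    (fun c f g => by ext w; simp [mul, Finset.mul_sum, mul_left_comm])

@[simp] theorem mulB_apply (f g : NCSeries K J) : mulB f g = mul f g := rfl

@[simp] theorem mulB_flip_apply (f g : NCSeries K J) : mulB.flip f g = mul g f := rfl

theorem isContinuous_mulB (f : NCSeries K J) : IsContinuous (mulB f) := by
  classical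
  intro w
  refine ⟨(Finset.range (w.length + 1)).image fun k => w.drop k, fun g hg => ?_⟩
  change ∑ k ∈ Finset.range (w.length + 1), f (w.take k) * g (w.drop k) = 0
  refine Finset.sum_eq_zero fun k hk => ?_
  rw [hg _ (Finset.mem_image_of_mem _ hk), mul_zero]

theorem isContinuous_mulB_flip (f : NCSeries K J) : IsContinuous (mulB.flip f) := by
  classical
  intro w
  refine ⟨(Finset.range (w.length + 1)).image fun k => w.take k, fun g hg => ?_⟩
  change ∑ k ∈ Finset.range (w.length + 1), g (w.take k) * f (w.drop k) = 0
  refine Finset.sum_eq_zero fun k hk => ?_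
  rw [hg _ (Finset.mem_image_of_mem _ hk), zero_mul]

theorem mul_zero_series (f : NCSeries K J) : mul f 0 = 0 := map_zero (mulB f)

theorem zero_mul_series (f : NCSeries K J) : mul 0 f = 0 := map_zero (mulB.flip f)

/-- A word occurring in a product factors into words occurring in the factors. -/
theorem exists_of_mul_ne_zero {f g : NCSeries K J} {w : List J} (h : mul f g w ≠ 0) :
    ∃ x y, w = x ++ y ∧ f x ≠ 0 ∧ g y ≠ 0 := by
  obtain ⟨k, _, hk⟩ := Finset.exists_ne_zero_of_sum_ne_zero h
  exact ⟨_, _, (List.take_append_drop k w).symm, left_ne_zero_of_mul hk, right_ne_zero_of_mul hk⟩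

theorem mono_mul_append (u : List J) (g : NCSeries K J) (w : List J) :
    mul (mono K u) g (u ++ w) = g w := by
  rw [mul, Finset.sum_eq_single u.length]
  · simp
  · intro k hk hne
    rw [mono_of_ne, zero_mul]
    intro h
    apply hne
    have := congrArg List.length h
    simp only [Finset.mem_range, List.length_append, List.length_take] at hk this
    omega
  · simp

theorem mul_mono_append (v : List J) (f : NCSeries K J) (w : List J) :
    mul f (mono K v) (w ++ v) = f w := by
  rw [mul, Finset.sum_eq_single w.length]
  · simp
  · intro k hk hne
    rw [mono_of_ne (u := v), mul_zero]
    intro h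
    apply hne
    have := congrArg List.length h
    simp only [Finset.mem_range, List.length_append, List.length_drop] at hk this
    omega
  · simp

theorem mono_mul_mono (u v : List J) : mul (mono K u) (mono K v) = mono K (u ++ v) := by
  ext w
  by_cases h : w = u ++ v
  · subst h; rw [mono_mul_append, mono_self, mono_self]
  · rw [mono_of_ne h]
    by_contra h1
    obtain ⟨x, y, rfl, hx, hy⟩ := exists_of_mul_ne_zero h1
    exact h (by rw [eq_of_mono_ne hx, eq_of_mono_ne hy])

theorem mono_singleton_mul_cons (j a : J) (g : NCSeries K J) (w : List J) :
    mul (mono K [j]) g (a :: w) = mono K [j] [a] * g w := by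
  by_cases h : a = j
  · subst h
    rw [mono_self, one_mul]
    exact mono_mul_append [a] g w
  · rw [mono_of_ne (by simpa using h), zero_mul]
    by_contra h1
    obtain ⟨x, y, hw, hx, -⟩ := exists_of_mul_ne_zero h1
    rw [eq_of_mono_ne hx] at hw
    simp only [List.cons_append, List.nil_append, List.cons.injEq] at hw
    exact h hw.1

theorem mul_mono_singleton_concat (j a : J) (f : NCSeries K J) (w : List J) :
    mul f (mono K [j]) (w ++ [a]) = f w * mono K [j] [a] := by
  by_cases h : a = j
  · subst h
    rw [mono_self, mul_one, mul_mono_append]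
  · rw [mono_of_ne (by simpa using h), mul_zero]
    by_contra h1
    obtain ⟨x, y, hw, -, hy⟩ := exists_of_mul_ne_zero h1
    rw [eq_of_mono_ne hy] at hw
    exact h (by simpa using (List.append_inj' hw rfl).2)

@[simp] theorem mul_nil (f g : NCSeries K J) : mul f g [] = f [] * g [] := by simp [mul]

theorem mono_nil_mul (f : NCSeries K J) : mul (mono K []) f = f := by
  ext w
  exact mono_mul_append [] f w

theorem mul_mono_nil (f : NCSeries K J) : mul f (mono K []) = f := by
  ext w
  simpa using mul_mono_append [] f w

theorem mul_assoc_series (f g h : NCSeries K J) : mul (mul f g) h = mul f (mul g h) := by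
  have h1 : ∀ u v w, mul (mul (mono K u) (mono K v)) (mono K w) =
      mul (mono K u) (mul (mono K v) (mono K (J := J) w)) := by
    intro u v w; simp only [mono_mul_mono, List.append_assoc]
  have h2 : ∀ f v w, mul (mul f (mono K v)) (mono K w) =
      mul f (mul (mono K v) (mono K (J := J) w)) := by
    intro f v w
    ext x
    exact ((isContinuous_mulB_flip (mono K w)).comp
      (isContinuous_mulB_flip (mono K v))).apply_congr
      (isContinuous_mulB_flip (mul (mono K v) (mono K w))) fun u _ => congrFun (h1 u v w) x
  have h3 : ∀ f g w, mul (mul f g) (mono K w) = mul f (mul g (mono K (J := J) w)) := by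
    intro f g w
    ext x
    exact ((isContinuous_mulB_flip (mono K w)).comp (isContinuous_mulB f)).apply_congr
      ((isContinuous_mulB f).comp (isContinuous_mulB_flip (mono K w)))
      fun v _ => congrFun (h2 f v w) x
  ext x
  exact (isContinuous_mulB (mul f g)).apply_congr
      ((isContinuous_mulB f).comp (isContinuous_mulB g))
      fun w _ => congrFun (h3 f g w) x

end Product

/-! ### Signed rotation and the norm -/

section Rotation

variable {K : Type u} [CommRing K] {J : Type v} (deg : J → ℤ)

/-- The signed rotation of words: it takes the monomial `w a`, with `a` a letter, to
`(-1)^{|a||w|} a w`. -/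
def rot : NCSeries K J →ₗ[K] NCSeries K J where
  toFun f w := match w with
    | [] => f []
    | a :: w => sg K (par deg [a] * par deg w) * f (w ++ [a])
  map_add' f g := by ext w; cases w <;> simp [mul_add]
  map_smul' c f := by ext w; cases w <;> simp [mul_left_comm]

theorem rot_cons (f : NCSeries K J) (a : J) (w : List J) :
    rot deg f (a :: w) = sg K (par deg [a] * par deg w) * f (w ++ [a]) := rfl

theorem rot_pow_append (f : NCSeries K J) (x y : List J) :
    (rot deg ^ x.length) f (x ++ y) = sg K (par deg x * par deg y) * f (y ++ x) := by
  induction x generalizing y with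
  | nil => simp
  | cons a x ih =>
    rw [List.length_cons, pow_succ', Module.End.mul_apply, List.cons_append, rot_cons,
      List.append_assoc, ih, ← mul_assoc, ← sg_add, par_append, par_append, par_cons deg a x,
      List.append_assoc]
    congr 2
    have : ∀ a x y : ZMod 2, a * (x + y) + x * (y + a) = (a + x) * y := by decide
    exact this _ _ _

theorem rot_pow_apply (f : NCSeries K J) {k : ℕ} {w : List J} (hk : k ≤ w.length) :
    (rot deg ^ k) f w =
      sg K (par deg (w.take k) * par deg (w.drop k)) * f (w.drop k ++ w.take k) := by
  have := rot_pow_append deg f (w.take k) (w.drop k)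
  rwa [List.take_append_drop, List.length_take_of_le hk] at this

theorem rot_pow_length (f : NCSeries K J) (w : List J) : (rot deg ^ w.length) f w = f w := by
  simpa using rot_pow_append deg f w []

theorem isContinuous_rot : IsContinuous (rot (K := K) deg) := by
  intro w
  cases w with
  | nil => exact ⟨{[]}, fun f hf => hf [] (by simp)⟩
  | cons a w =>
    exact ⟨{w ++ [a]}, fun f hf => by rw [rot_cons, hf _ (by simp), mul_zero]⟩

theorem isContinuous_rot_pow (k : ℕ) : IsContinuous (rot (K := K) deg ^ k) := by
  induction k with
  | zero => exact isContinuous_id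
  | succ k ih => rw [pow_succ]; exact ih.comp (isContinuous_rot deg)

theorem rot_pow_congr {f g : NCSeries K J} {w : List J} (k : ℕ)
    (h : ∀ u, u.Perm w → f u = g u) : (rot deg ^ k) f w = (rot deg ^ k) g w := by
  induction k generalizing w with
  | zero => exact h w (List.Perm.refl w)
  | succ k ih =>
    rw [pow_succ', Module.End.mul_apply, Module.End.mul_apply]
    cases w with
    | nil => exact ih h
    | cons a w =>
      rw [rot_cons, rot_cons, ih fun u hu => h u (hu.trans (List.perm_append_singleton a w))]

theorem rot_pow_mono (x y : List J) : (rot deg ^ y.length) (mono K (x ++ y)) =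
    sg K (par deg x * par deg y) • mono K (y ++ x) := by
  ext w
  by_cases hl : w.length = (y ++ x).length
  · have hk : y.length ≤ w.length := by simp at hl; omega
    rw [rot_pow_apply deg _ hk, Pi.smul_apply, smul_eq_mul]
    by_cases h : w = y ++ x
    · subst h; simp [mul_comm]
    · rw [mono_of_ne h, mono_of_ne, mul_zero, mul_zero]
      intro h1
      have hlen : (w.drop y.length).length = x.length := by simp at hl ⊢; omega
      have h2 := List.append_inj h1 hlen
      exact h (by rw [← List.take_append_drop y.length w, h2.1, h2.2])
  · rw [rot_pow_congr deg (g := 0), map_zero, Pi.smul_apply, mono_of_ne, smul_zero]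
    · rfl
    · intro h; exact hl (by rw [h])
    · intro u hu
      refine mono_of_ne fun h => hl ?_
      rw [← hu.length_eq, h]; simp [add_comm]

/-- The norm: the sum of all signed rotations. -/
def cycNorm : NCSeries K J →ₗ[K] NCSeries K J where
  toFun f w := ∑ k ∈ Finset.range w.length, (rot deg ^ k) f w
  map_add' f g := by ext w; simp [Finset.sum_add_distrib]
  map_smul' c f := by ext w; simp [Finset.mul_sum]

theorem cycNorm_apply (f : NCSeries K J) (w : List J) :
    cycNorm deg f w = ∑ k ∈ Finset.range w.length, (rot deg ^ k) f w := rfl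

@[simp] theorem cycNorm_nil (f : NCSeries K J) : cycNorm deg f [] = 0 := rfl

theorem isContinuous_cycNorm : IsContinuous (cycNorm (K := K) deg) :=
  isContinuous_of_pointwise fun w => ⟨∑ k ∈ Finset.range w.length, rot deg ^ k,
    IsContinuous.sum _ fun k _ => isContinuous_rot_pow deg k, fun f => by
      rw [cycNorm_apply, LinearMap.sum_apply, Finset.sum_apply]⟩

theorem sum_rot_pow_succ (f : NCSeries K J) (w : List J) :
    ∑ k ∈ Finset.range w.length, (rot deg ^ (k + 1)) f w = cycNorm deg f w := by
  have h1 := Finset.sum_range_succ (fun k => (rot deg ^ k) f w) w.length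
  rw [Finset.sum_range_succ' (fun k => (rot deg ^ k) f w) w.length, rot_pow_length] at h1
  exact add_right_cancel h1

theorem cycNorm_rot (f : NCSeries K J) : cycNorm deg (rot deg f) = cycNorm deg f := by
  ext w
  rw [← sum_rot_pow_succ deg f, cycNorm_apply]
  simp only [pow_succ, Module.End.mul_apply]

theorem rot_cycNorm (f : NCSeries K J) : rot deg (cycNorm deg f) = cycNorm deg f := by
  ext w
  cases w with
  | nil => rfl
  | cons a w =>
    rw [← sum_rot_pow_succ, rot_cons, cycNorm_apply, Finset.mul_sum]
    rw [show (w ++ [a]).length = (a :: w).length by simp]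
    refine Finset.sum_congr rfl fun k _ => ?_
    rw [pow_succ', Module.End.mul_apply, rot_cons]

theorem rot_pow_of_rot_eq {f : NCSeries K J} (h : rot deg f = f) (k : ℕ) :
    (rot deg ^ k) f = f := by
  induction k with
  | zero => rfl
  | succ k ih => rw [pow_succ, Module.End.mul_apply, h, ih]

theorem cycNorm_of_rot_eq {f : NCSeries K J} (h : rot deg f = f) (w : List J) :
    cycNorm deg f w = w.length * f w := by
  rw [cycNorm_apply]
  simp [rot_pow_of_rot_eq deg h]

theorem cycNorm_congr {f g : NCSeries K J} {w : List J} (h : ∀ u, u.Perm w → f u = g u) :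
    cycNorm deg f w = cycNorm deg g w := by
  rw [cycNorm_apply, cycNorm_apply]
  exact Finset.sum_congr rfl fun k _ => rot_pow_congr deg k h

theorem eq_of_rot_eq {f : NCSeries K J} (h : rot deg f = f) (x y : List J) :
    f (x ++ y) = sg K (par deg x * par deg y) * f (y ++ x) := by
  rw [← rot_pow_append, rot_pow_of_rot_eq deg h]

end Rotation

/-! ### Diagonal operators and continuous extension -/

section Diagonal

variable {K : Type u} [CommRing K] {J : Type v} (deg : J → ℤ)

/-- Multiplication of the coefficient of each word `w` by `c w`. -/
def diag (c : List J → K) : NCSeries K J →ₗ[K] NCSeries K J where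
  toFun f w := c w * f w
  map_add' f g := by ext w; simp [mul_add]
  map_smul' a f := by ext w; simp [mul_left_comm]

@[simp] theorem diag_apply (c : List J → K) (f : NCSeries K J) (w : List J) :
    diag c f w = c w * f w := rfl

theorem isContinuous_diag (c : List J → K) : IsContinuous (diag c) :=
  fun w => ⟨{w}, fun f hf => by rw [diag_apply, hf w (by simp), mul_zero]⟩

theorem rot_diag {c : List J → K} (hc : ∀ a w, c (a :: w) = c (w ++ [a])) (f : NCSeries K J) :
    rot deg (diag c f) = diag c (rot deg f) := by
  ext w
  cases w with
  | nil => rfl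
  | cons a w => rw [rot_cons, diag_apply, diag_apply, rot_cons, hc, mul_left_comm]

theorem rot_pow_diag {c : List J → K} (hc : ∀ a w, c (a :: w) = c (w ++ [a]))
    (f : NCSeries K J) (k : ℕ) : (rot deg ^ k) (diag c f) = diag c ((rot deg ^ k) f) := by
  induction k with
  | zero => rfl
  | succ k ih => rw [pow_succ', Module.End.mul_apply, ih, rot_diag deg hc]; rfl

theorem cycNorm_diag {c : List J → K} (hc : ∀ a w, c (a :: w) = c (w ++ [a]))
    (f : NCSeries K J) : cycNorm deg (diag c f) = diag c (cycNorm deg f) := by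
  ext w
  rw [cycNorm_apply, diag_apply, cycNorm_apply, Finset.mul_sum]
  exact Finset.sum_congr rfl fun k _ => by rw [rot_pow_diag deg hc]; rfl

/-- The continuous linear map with prescribed values on monomials. -/
noncomputable def extendMono (E : List J → NCSeries K J) (hE : ∀ w, {u | E u w ≠ 0}.Finite) :
    NCSeries K J →ₗ[K] NCSeries K J where
  toFun f w := ∑ u ∈ (hE w).toFinset, f u * E u w
  map_add' f g := by ext w; simp [add_mul, Finset.sum_add_distrib]
  map_smul' a f := by ext w; simp [Finset.mul_sum, mul_assoc]

theorem isContinuous_extendMono (E : List J → NCSeries K J) (hE : ∀ w, {u | E u w ≠ 0}.Finite) :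
    IsContinuous (extendMono E hE) := fun w =>
  ⟨(hE w).toFinset, fun f hf => Finset.sum_eq_zero fun u hu => by rw [hf u hu, zero_mul]⟩

theorem extendMono_mono (E : List J → NCSeries K J) (hE : ∀ w, {u | E u w ≠ 0}.Finite)
    (u : List J) : extendMono E hE (mono K u) = E u := by
  ext w
  change ∑ v ∈ (hE w).toFinset, mono K u v * E v w = E u w
  rw [Finset.sum_eq_single u]
  · rw [mono_self, one_mul]
  · intro v _ hv
    rw [mono_of_ne hv, zero_mul]
  · intro h
    rw [mono_self, one_mul]
    simpa using h

variable [Algebra ℚ K]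

/-- Division of the coefficient of each word by its length. -/
def divLen : NCSeries K J →ₗ[K] NCSeries K J :=
  diag fun w => algebraMap ℚ K (w.length : ℚ)⁻¹

theorem divLen_apply (f : NCSeries K J) (w : List J) :
    divLen f w = algebraMap ℚ K (w.length : ℚ)⁻¹ * f w := rfl

theorem rat_inv_mul_cast {n : ℕ} (hn : n ≠ 0) : algebraMap ℚ K (n : ℚ)⁻¹ * (n : K) = 1 := by
  rw [← map_natCast (algebraMap ℚ K) n, ← map_mul,
    inv_mul_cancel₀ (by exact_mod_cast hn), map_one]

theorem cycNorm_divLen (f : NCSeries K J) : cycNorm deg (divLen f) = divLen (cycNorm deg f) :=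
  cycNorm_diag deg (by simp) f

/-- Division by the length, followed by the norm, is the identity on rotation invariant series
without constant term. -/
theorem cycNorm_divLen_of_rot_eq {f : NCSeries K J} (hf : rot deg f = f) (h0 : f [] = 0) :
    cycNorm deg (divLen f) = f := by
  ext w
  rw [cycNorm_divLen, divLen_apply, cycNorm_of_rot_eq deg hf, ← mul_assoc]
  cases w with
  | nil => simp [h0]
  | cons a w => rw [rat_inv_mul_cast (by simp), one_mul]

end Diagonal

/-! ### Commutators are the kernel of the norm -/

section Commutators

variable {K : Type u} [CommRing K] {J : Type v} (deg : J → ℤ)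

theorem cycNorm_rot_pow (f : NCSeries K J) (k : ℕ) :
    cycNorm deg ((rot deg ^ k) f) = cycNorm deg f := by
  induction k with
  | zero => rfl
  | succ k ih => rw [pow_succ', Module.End.mul_apply, cycNorm_rot, ih]

theorem cycNorm_mono_append_comm (x y : List J) : cycNorm deg (mono K (x ++ y)) =
    sg K (par deg x * par deg y) • cycNorm deg (mono K (y ++ x)) := by
  rw [← cycNorm_rot_pow deg _ y.length, rot_pow_mono, map_smul]

theorem cycNorm_mul_comm {p q : ZMod 2} {f g : NCSeries K J} (hf : HasPar deg p f)
    (hg : HasPar deg q g) :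
    cycNorm deg (mul f g) = sg K (p * q) • cycNorm deg (mul g f) := by
  have hN := isContinuous_cycNorm (K := K) deg
  ext w
  refine (hN.comp (isContinuous_mulB f)).apply_congr
    ((hN.comp (isContinuous_mulB_flip f)).smul (sg K (p * q))) fun v hv => ?_
  refine (hN.comp (isContinuous_mulB_flip (mono K v))).apply_congr
    ((hN.comp (isContinuous_mulB (mono K v))).smul (sg K (p * q))) fun u hu => ?_
  change cycNorm deg (mul (mono K u) (mono K v)) w =
    (sg K (p * q) • cycNorm deg (mul (mono K v) (mono K u))) w
  rw [mono_mul_mono, mono_mul_mono, cycNorm_mono_append_comm, hf u hu, hg v hv]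

variable {deg} in
theorem bracket_eq (p q : ℤ) (f g : NCSeries K J) :
    bracket p q f g = mul f g - sg K ((p : ZMod 2) * q) • mul g f := by
  rw [bracket, ← Int.cast_mul, ← negOnePow_eq_sg, Int.cast_smul_eq_zsmul]

theorem cycNorm_bracket {p q : ℤ} {f g : NCSeries K J} (hf : HasPar deg p f)
    (hg : HasPar deg q g) : cycNorm deg (bracket p q f g) = 0 := by
  rw [bracket_eq, map_sub, map_smul, cycNorm_mul_comm deg hf hg, sub_self]

variable [Algebra ℚ K] (𝒜 : ℤ → Submodule ℚ K)

variable {𝒜 deg} in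
theorem hasPar_of_mem_homog (hodd : ∀ n, Odd n → 𝒜 n = ⊥) {n : ℤ} {f : NCSeries K J}
    (hf : f ∈ homog 𝒜 deg n) : HasPar deg n f := by
  intro w hw
  refine (intCast_eq_of_even_sub ?_).symm
  by_contra h
  have h1 := hf w
  rw [hodd _ (Int.not_even_iff_odd.1 h), Submodule.mem_bot] at h1
  exact hw h1

theorem mono_mem_homog [GradedAlgebra 𝒜] (u : List J) :
    mono K u ∈ homog 𝒜 deg (wordDeg deg u) := by
  intro w
  by_cases h : w = u
  · subst h
    rw [mono_self, sub_self]
    exact SetLike.GradedOne.one_mem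
  · rw [mono_of_ne h]
    exact Submodule.zero_mem _

variable {𝒜} in
theorem bracket_nil (hodd : ∀ n, Odd n → 𝒜 n = ⊥) {p q : ℤ} {f g : NCSeries K J}
    (hf : f ∈ homog 𝒜 deg p) (hg : g ∈ homog 𝒜 deg q) : bracket p q f g [] = 0 := by
  rw [bracket_eq]
  by_cases h : f [] = 0
  · simp [h]
  · by_cases h' : g [] = 0
    · simp [h']
    · have h1 := hasPar_of_mem_homog hodd hf [] h
      have h2 := hasPar_of_mem_homog hodd hg [] h'
      rw [par_nil] at h1 h2
      simp [← h1, mul_comm]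

theorem mono_sub_rot_pow_mem [GradedAlgebra 𝒜] (u : List J) {k : ℕ} (hk : k ≤ u.length) :
    mono K u - (rot deg ^ k) (mono K u) ∈ Submodule.span K {h | ∃ p q : ℤ,
      ∃ f ∈ homog 𝒜 deg p, ∃ g ∈ homog 𝒜 deg q, h = bracket p q f g} := by
  obtain ⟨x, y, rfl, rfl⟩ : ∃ x y, u = x ++ y ∧ y.length = k :=
    ⟨u.take (u.length - k), u.drop (u.length - k), (List.take_append_drop _ _).symm, by simp; omega⟩
  refine Submodule.subset_span ⟨_, _, _, mono_mem_homog deg 𝒜 x, _, mono_mem_homog deg 𝒜 y, ?_⟩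
  rw [rot_pow_mono, bracket_eq, mono_mul_mono, mono_mul_mono]
  rfl

/-- Since `K` contains `ℚ`, the closed commutator submodule is the kernel of the norm (apart from
the constant term, on which the norm vanishes). -/
theorem mem_commutators_iff [GradedAlgebra 𝒜] (hodd : ∀ n, Odd n → 𝒜 n = ⊥) (f : NCSeries K J) :
    f ∈ commutators 𝒜 deg ↔ f [] = 0 ∧ cycNorm deg f = 0 := by
  classical
  constructor
  · intro hf
    have key : ∀ g ∈ Submodule.span K {h : NCSeries K J | ∃ p q : ℤ, ∃ f ∈ homog 𝒜 deg p,
        ∃ g ∈ homog 𝒜 deg q, h = bracket p q f g}, g [] = 0 ∧ cycNorm deg g = 0 := by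
      intro g hg
      induction hg using Submodule.span_induction with
      | zero => simp
      | add x y _ _ hx hy => simp [hx, hy]
      | smul a x _ hx => simp [hx]
      | mem x hx =>
        obtain ⟨p, q, a, ha, b, hb, rfl⟩ := hx
        exact ⟨bracket_nil deg hodd ha hb, cycNorm_bracket deg (hasPar_of_mem_homog hodd ha)
          (hasPar_of_mem_homog hodd hb)⟩
    constructor
    · obtain ⟨g, hg, h⟩ := hf {[]}
      rw [← h [] (by simp), (key g hg).1]
    · ext w
      obtain ⟨F, hF⟩ := isContinuous_cycNorm (K := K) deg w
      obtain ⟨g, hg, h⟩ := hf F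
      have := hF (f - g) fun u hu => by simp [h u hu]
      rw [map_sub, (key g hg).2, sub_zero] at this
      exact this
  · rintro ⟨h0, hN⟩
    have hc : IsContinuous (LinearMap.id - divLen ∘ₗ cycNorm (K := K) deg) :=
      isContinuous_id.sub ((isContinuous_diag _).comp (isContinuous_cycNorm deg))
    have h := hc.apply_mem_profiniteClosure (f := f) (Submodule.span K {h | ∃ p q : ℤ,
      ∃ f ∈ homog 𝒜 deg p, ∃ g ∈ homog 𝒜 deg q, h = bracket p q f g}) ?_
    · have e : (LinearMap.id - divLen ∘ₗ cycNorm (K := K) deg : NCSeries K J →ₗ[K] NCSeries K J) f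
          = f := by
        change f - divLen (cycNorm deg f) = f
        rw [hN, map_zero, sub_zero]
      rwa [e] at h
    · intro u hu
      have hu0 : u ≠ [] := by rintro rfl; exact hu h0
      have hl : u.length ≠ 0 := by simpa using hu0
      have e : mono K u - divLen (cycNorm deg (mono K u)) =
          algebraMap ℚ K (u.length : ℚ)⁻¹ •
            ∑ k ∈ Finset.range u.length, (mono K u - (rot deg ^ k) (mono K u)) := by
        ext w
        simp only [Pi.sub_apply, divLen_apply, cycNorm_apply, Pi.smul_apply, Finset.sum_apply,
          Finset.sum_sub_distrib,
          Finset.sum_const, Finset.card_range, smul_eq_mul, nsmul_eq_mul, mul_sub,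
          Pi.mul_apply, Pi.natCast_apply]
        rw [← mul_assoc, rat_inv_mul_cast hl, one_mul]
        by_cases hw : w.length = u.length
        · rw [hw]
        · have hz : ∀ k, (rot deg ^ k) (mono K u) w = 0 := fun k => by
            rw [rot_pow_congr deg k (g := 0), map_zero]
            · rfl
            · intro v hv
              refine mono_of_ne ?_
              rintro rfl
              exact hw hv.length_eq.symm
          simp [hz]
      change mono K u - divLen (cycNorm deg (mono K u)) ∈ _
      rw [e]
      exact Submodule.smul_mem _ _ (Submodule.sum_mem _ fun k hk =>
        mono_sub_rot_pow_mem deg 𝒜 u (Finset.mem_range.1 hk).le)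

end Commutators

/-! ### Cyclic one-forms -/

section OneForms

variable {K : Type u} [CommRing K] {J : Type v} (deg : J → ℤ)

/-- The part of a series in words of length more than `i`. -/
def lenGT (i : ℕ) : NCSeries K J →ₗ[K] NCSeries K J :=
  diag fun w => if i < w.length then 1 else 0

theorem lenGT_mono_of_lt {i : ℕ} {u : List J} (h : i < u.length) :
    lenGT i (mono K u) = mono K u := by
  ext w
  rw [lenGT, diag_apply]
  by_cases hw : w = u
  · subst hw; simp [h]
  · rw [mono_of_ne hw, mul_zero]

theorem lenGT_mono_of_le {i : ℕ} {u : List J} (h : u.length ≤ i) :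
    lenGT i (mono K u) = 0 := by
  ext w
  rw [lenGT, diag_apply]
  by_cases hw : w = u
  · subst hw; simp [h]
  · rw [mono_of_ne hw, mul_zero]; rfl

/-- The cyclic one-form `f dg`.  A cyclic one-form is a combination of words with one marked letter,
up to rotation; it is encoded by the series in which the marked letter is rotated to the last place,
so that `dg` is the sum over all letters of `g` of the rotations placing that letter last. -/
def oneForm : NCSeries K J →ₗ[K] NCSeries K J →ₗ[K] NCSeries K J :=
  LinearMap.mk₂ K
    (fun f g w => ∑ i ∈ Finset.range w.length, (rot deg ^ i) (mulB f (lenGT i g)) w)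
    (fun f g h => by ext w; simp only [map_add, LinearMap.add_apply, Pi.add_apply,
      Finset.sum_add_distrib])
    (fun c f g => by ext w; simp only [map_smul, LinearMap.smul_apply, Pi.smul_apply,
      Finset.smul_sum])
    (fun f g h => by ext w; simp only [map_add, Pi.add_apply, Finset.sum_add_distrib])
    (fun c f g => by ext w; simp only [map_smul, Pi.smul_apply, Finset.smul_sum])

theorem oneForm_apply (f g : NCSeries K J) (w : List J) : oneForm deg f g w =
    ∑ i ∈ Finset.range w.length, (rot deg ^ i) (mul f (lenGT i g)) w := rfl

theorem isContinuous_oneForm (f : NCSeries K J) : IsContinuous (oneForm deg f) :=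
  isContinuous_of_pointwise fun w =>
    ⟨∑ i ∈ Finset.range w.length, (rot deg ^ i) ∘ₗ mulB f ∘ₗ lenGT i,
      IsContinuous.sum _ fun i _ => (isContinuous_rot_pow deg i).comp
        ((isContinuous_mulB f).comp (isContinuous_diag _)), fun g => by
      rw [oneForm_apply, LinearMap.sum_apply, Finset.sum_apply]; rfl⟩

theorem isContinuous_oneForm_flip (g : NCSeries K J) : IsContinuous ((oneForm deg).flip g) :=
  isContinuous_of_pointwise fun w =>
    ⟨∑ i ∈ Finset.range w.length, (rot deg ^ i) ∘ₗ mulB.flip (lenGT i g),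
      IsContinuous.sum _ fun i _ => (isContinuous_rot_pow deg i).comp
        (isContinuous_mulB_flip _), fun f => by
      rw [LinearMap.flip_apply, oneForm_apply, LinearMap.sum_apply, Finset.sum_apply]; rfl⟩

theorem exists_of_rot_pow_ne_zero {f : NCSeries K J} {k : ℕ} {w : List J}
    (h : (rot deg ^ k) f w ≠ 0) : ∃ u, u.Perm w ∧ f u ≠ 0 := by
  by_contra h1
  push Not at h1
  rw [rot_pow_congr deg k (g := 0) h1, map_zero] at h
  exact h rfl

/-- A word occurring in `f dg` is a rearrangement of a product of words of `f` and of `g`. -/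
theorem exists_of_oneForm_ne_zero {f g : NCSeries K J} {w : List J} (h : oneForm deg f g w ≠ 0) :
    ∃ x y, (x ++ y).Perm w ∧ f x ≠ 0 ∧ g y ≠ 0 := by
  rw [oneForm_apply] at h
  obtain ⟨k, _, hk⟩ := Finset.exists_ne_zero_of_sum_ne_zero h
  obtain ⟨u, hu, hfu⟩ := exists_of_rot_pow_ne_zero deg hk
  obtain ⟨x, y, rfl, hx, hy⟩ := exists_of_mul_ne_zero hfu
  exact ⟨x, y, hu, hx, right_ne_zero_of_mul hy⟩

theorem oneForm_mono_mono (u v : List J) : oneForm deg (mono K u) (mono K v) =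
    ∑ i ∈ Finset.range v.length, (rot deg ^ i) (mono K (u ++ v)) := by
  have hz : ∀ i w, w.length ≠ (u ++ v).length → (rot deg ^ i) (mono K (u ++ v)) w = 0 := by
    intro i w hw
    by_contra h
    obtain ⟨x, hx, hx'⟩ := exists_of_rot_pow_ne_zero deg h
    rw [eq_of_mono_ne hx'] at hx
    exact hw hx.length_eq.symm
  ext w
  rw [oneForm_apply, Finset.sum_apply]
  by_cases hw : w.length = (u ++ v).length
  · have hle : v.length ≤ w.length := by simp [hw]
    rw [← Finset.sum_subset (Finset.range_mono hle)]
    · refine Finset.sum_congr rfl fun i hi => ?_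
      rw [lenGT_mono_of_lt (Finset.mem_range.1 hi), mono_mul_mono]
    · intro i _ hi
      rw [lenGT_mono_of_le (by simpa using hi)]
      rw [mul_zero_series, map_zero]
      rfl
  · rw [Finset.sum_eq_zero, Finset.sum_eq_zero]
    · exact fun i _ => hz i w hw
    · intro i _
      by_cases hi : i < v.length
      · rw [lenGT_mono_of_lt hi, mono_mul_mono, hz i w hw]
      · rw [lenGT_mono_of_le (by simpa using hi)]
        rw [mul_zero_series, map_zero]
        rfl

theorem oneForm_mono_singleton (f : NCSeries K J) (j : J) :
    oneForm deg f (mono K [j]) = mul f (mono K [j]) := by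
  ext w
  refine (isContinuous_oneForm_flip deg (mono K [j])).apply_congr
    (isContinuous_mulB_flip (mono K [j])) fun u _ => ?_
  rw [LinearMap.flip_apply, oneForm_mono_mono, mulB_flip_apply, mono_mul_mono]
  simp

/-- The de Rham differential `dg` is the norm of `g`. -/
theorem oneForm_one (g : NCSeries K J) : oneForm deg (mono K []) g = cycNorm deg g := by
  ext w
  rw [oneForm_apply, cycNorm_apply]
  refine Finset.sum_congr rfl fun i hi => ?_
  rw [mono_nil_mul]
  refine rot_pow_congr deg i fun u hu => ?_
  rw [lenGT, diag_apply, hu.length_eq, if_pos (Finset.mem_range.1 hi), one_mul]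

/-- The map `1 - rot` takes the one-form `f dg` to the commutator `[f, g]`. -/
theorem oneForm_sub_rot (u v : List J) :
    oneForm deg (mono K u) (mono K v) - rot deg (oneForm deg (mono K u) (mono K v)) =
      mono K (u ++ v) - sg K (par deg u * par deg v) • mono K (v ++ u) := by
  rw [← rot_pow_mono, oneForm_mono_mono, map_sum]
  simp only [← Module.End.mul_apply, ← pow_succ']
  have h1 := Finset.sum_range_succ (fun k => (rot deg ^ k) (mono K (u ++ v))) v.length
  rw [Finset.sum_range_succ'] at h1
  rw [sub_eq_sub_iff_add_eq_add, ← h1, add_comm]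
  rfl

theorem oneForm_mul_mono (u v x : List J) :
    oneForm deg (mono K u) (mul (mono K v) (mono K x)) =
      sg K (par deg x * (par deg u + par deg v)) •
        oneForm deg (mul (mono K x) (mono K u)) (mono K v) +
      oneForm deg (mul (mono K u) (mono K v)) (mono K x) := by
  simp only [mono_mul_mono, oneForm_mono_mono, List.length_append]
  rw [add_comm v.length, Finset.sum_range_add, add_comm (sg K _ • _), Finset.smul_sum,
    List.append_assoc]
  congr 1
  refine Finset.sum_congr rfl fun i _ => ?_
  rw [add_comm x.length, pow_add, Module.End.mul_apply, ← List.append_assoc, rot_pow_mono,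
    map_smul, par_append, mul_comm (par deg x), List.append_assoc]

/-- The Leibniz rule `f d(gh) = ± hf dg + fg dh` of cyclic one-forms. -/
theorem oneForm_mul {p q r : ZMod 2} {f g h : NCSeries K J} (hf : HasPar deg p f)
    (hg : HasPar deg q g) (hh : HasPar deg r h) :
    oneForm deg f (mul g h) =
      sg K (r * (p + q)) • oneForm deg (mul h f) g + oneForm deg (mul f g) h := by
  have h2 : ∀ v x, oneForm deg f (mul (mono K v) (mono K x)) =
      sg K (par deg x * (p + par deg v)) • oneForm deg (mul (mono K x) f) (mono K v) +
        oneForm deg (mul f (mono K v)) (mono K x) := by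
    intro v x
    ext w
    refine (isContinuous_oneForm_flip deg (mul (mono K v) (mono K x))).apply_congr
      ((((isContinuous_oneForm_flip deg (mono K v)).comp (isContinuous_mulB (mono K x))).smul
        (sg K (par deg x * (p + par deg v)))).add
        ((isContinuous_oneForm_flip deg (mono K x)).comp (isContinuous_mulB_flip (mono K v))))
      fun u hu => ?_
    rw [← hf u hu]
    exact congrFun (oneForm_mul_mono deg u v x) w
  have h3 : ∀ x, oneForm deg f (mul g (mono K x)) =
      sg K (par deg x * (p + q)) • oneForm deg (mul (mono K x) f) g +
        oneForm deg (mul f g) (mono K x) := by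
    intro x
    ext w
    refine ((isContinuous_oneForm deg f).comp (isContinuous_mulB_flip (mono K x))).apply_congr
      (((isContinuous_oneForm deg (mul (mono K x) f)).smul (sg K (par deg x * (p + q)))).add
        ((isContinuous_oneForm_flip deg (mono K x)).comp (isContinuous_mulB f)))
      fun v hv => ?_
    rw [← hg v hv]
    exact congrFun (h2 v x) w
  ext w
  refine ((isContinuous_oneForm deg f).comp (isContinuous_mulB g)).apply_congr
      ((((isContinuous_oneForm_flip deg g).comp (isContinuous_mulB_flip f)).smul
        (sg K (r * (p + q)))).add
        (isContinuous_oneForm deg (mul f g)))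
      fun x hx => ?_
  rw [← hh x hx]
  exact congrFun (h3 x) w

end OneForms

/-! ### Odd derivations and their action on one-forms -/

section Derivations

variable {K : Type u} [CommRing K] {J : Type v} (deg : J → ℤ)

/-- A continuous derivation of odd degree of the algebra of series. -/
structure IsOddDerivation (D : NCSeries K J →ₗ[K] NCSeries K J) : Prop where
  continuous : IsContinuous D
  map_nil : D (mono K []) = 0
  map_cons : ∀ j u, D (mono K (j :: u)) =
    mul (D (mono K [j])) (mono K u) + sg K (par deg [j]) • mul (mono K [j]) (D (mono K u))
  hasPar_letter : ∀ j, HasPar deg (par deg [j] + 1) (D (mono K [j]))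

variable {deg}

theorem HasPar.mul {p q : ZMod 2} {f g : NCSeries K J} (hf : HasPar deg p f)
    (hg : HasPar deg q g) : HasPar deg (p + q) (mul f g) := by
  intro w hw
  obtain ⟨x, y, rfl, hx, hy⟩ := exists_of_mul_ne_zero hw
  rw [par_append, hf x hx, hg y hy]

theorem HasPar.add {p : ZMod 2} {f g : NCSeries K J} (hf : HasPar deg p f)
    (hg : HasPar deg p g) : HasPar deg p (f + g) := by
  intro w hw
  by_cases h : f w = 0
  · exact hg w fun h' => hw (by simp [h, h'])
  · exact hf w h

theorem HasPar.smul {p : ZMod 2} {f : NCSeries K J} (hf : HasPar deg p f) (c : K) :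
    HasPar deg p (c • f) :=
  fun w hw => hf w (right_ne_zero_of_mul hw)

namespace IsOddDerivation

variable {D D₂ : NCSeries K J →ₗ[K] NCSeries K J}

theorem hasPar_mono (hD : IsOddDerivation deg D) (u : List J) :
    HasPar deg (par deg u + 1) (D (mono K u)) := by
  induction u with
  | nil => rw [hD.map_nil]; exact fun w hw => absurd rfl hw
  | cons j u ih =>
    rw [hD.map_cons]
    refine HasPar.add ?_ (HasPar.smul ?_ _)
    · have := (hD.hasPar_letter j).mul (HomotopyAlg.hasPar_mono (K := K) deg u)
      rwa [add_right_comm, ← par_cons] at this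
    · have := (HomotopyAlg.hasPar_mono (K := K) deg [j]).mul ih
      rwa [← add_assoc, ← par_cons] at this

theorem map_append (hD : IsOddDerivation deg D) (u v : List J) : D (mono K (u ++ v)) =
    mul (D (mono K u)) (mono K v) + sg K (par deg u) • mul (mono K u) (D (mono K v)) := by
  induction u with
  | nil =>
    rw [hD.map_nil, List.nil_append, par_nil, sg_zero, one_smul, mono_nil_mul, zero_mul_series,
      zero_add]
  | cons j u ih =>
    rw [List.cons_append, hD.map_cons j (u ++ v), ih, hD.map_cons j u]
    simp only [← mulB_apply, map_add, map_smul, LinearMap.add_apply, LinearMap.smul_apply]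
    simp only [mulB_apply, mul_assoc_series, mono_mul_mono]
    rw [par_cons deg j u, sg_add, mul_smul, smul_add, add_assoc,
      ← mul_assoc_series (mono K [j]) (mono K u), mono_mul_mono]
    rfl

theorem map_mul_mono (hD : IsOddDerivation deg D) (u v : List J) :
    D (mul (mono K u) (mono K v)) =
    mul (D (mono K u)) (mono K v) + sg K (par deg u) • mul (mono K u) (D (mono K v)) := by
  rw [mono_mul_mono, hD.map_append]

theorem add (hD : IsOddDerivation deg D) (hD₂ : IsOddDerivation deg D₂) :
    IsOddDerivation deg (D + D₂) where
  continuous := hD.continuous.add hD₂.continuous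
  map_nil := by rw [LinearMap.add_apply, hD.map_nil, hD₂.map_nil, add_zero]
  map_cons j u := by
    simp only [LinearMap.add_apply]
    rw [hD.map_cons, hD₂.map_cons]
    simp only [← mulB_apply, map_add, LinearMap.add_apply, smul_add]
    abel
  hasPar_letter j := (hD.hasPar_letter j).add (hD₂.hasPar_letter j)

theorem neg (hD : IsOddDerivation deg D) : IsOddDerivation deg (-D) where
  continuous w := by
    obtain ⟨F, hF⟩ := hD.continuous w
    exact ⟨F, fun f hf => by rw [LinearMap.neg_apply, Pi.neg_apply, hF f hf, neg_zero]⟩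
  map_nil := by rw [LinearMap.neg_apply, hD.map_nil, neg_zero]
  map_cons j u := by
    simp only [LinearMap.neg_apply]
    rw [hD.map_cons]
    simp only [← mulB_apply, map_neg, LinearMap.neg_apply, smul_neg]
    abel
  hasPar_letter j w hw := hD.hasPar_letter j w fun h => hw (by
    rw [LinearMap.neg_apply, Pi.neg_apply, h, neg_zero])

end IsOddDerivation

end Derivations

section OneFormAction

variable {K : Type u} [CommRing K] {J : Type v} (deg : J → ℤ)

theorem oneForm_mono_nil (f : NCSeries K J) : oneForm deg f (mono K []) = 0 := by
  ext w
  rw [oneForm_apply]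
  refine Finset.sum_eq_zero fun i _ => ?_
  rw [lenGT_mono_of_le (by simp), mul_zero_series, map_zero]
  rfl

/-- The action of a derivation `D` on the one-form `u dj` given by a word `u` with marked last
letter `j`, namely `D(u) dj ± u dD(j)`. -/
noncomputable def actMono (D : NCSeries K J →ₗ[K] NCSeries K J) (u : List J) : NCSeries K J :=
  if h : u = [] then 0 else
    oneForm deg (D (mono K u.dropLast)) (mono K [u.getLast h]) +
      sg K (par deg u.dropLast) • oneForm deg (mono K u.dropLast) (D (mono K [u.getLast h]))

theorem actMono_concat (D : NCSeries K J →ₗ[K] NCSeries K J) (u : List J) (j : J) :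
    actMono deg D (u ++ [j]) = oneForm deg (D (mono K u)) (mono K [j]) +
      sg K (par deg u) • oneForm deg (mono K u) (D (mono K [j])) := by
  rw [actMono, dif_neg (by simp)]
  simp

theorem finite_actMono_ne_zero {D : NCSeries K J →ₗ[K] NCSeries K J} (hD : IsContinuous D)
    (w : List J) : {u | actMono deg D u w ≠ 0}.Finite := by
  classical
  choose F hF using hD
  have hF' : ∀ u w, D (mono K u) w ≠ 0 → u ∈ F w := by
    intro u w h
    by_contra h1
    refine h (hF w _ fun v hv => mono_of_ne ?_)
    rintro rfl
    exact h1 hv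
  -- the factors of the rearrangements of `w`
  let P : Finset (List J) := w.permutations.toFinset.biUnion fun z =>
    (Finset.range (z.length + 1)).image (fun k => z.take k) ∪
      (Finset.range (z.length + 1)).image (fun k => z.drop k)
  have hP : ∀ x y, (x ++ y).Perm w → x ∈ P ∧ y ∈ P := by
    intro x y h
    constructor
    · refine Finset.mem_biUnion.2 ⟨x ++ y, by simpa using h, Finset.mem_union_left _
        (Finset.mem_image.2 ⟨x.length, by simp, by simp⟩)⟩
    · refine Finset.mem_biUnion.2 ⟨x ++ y, by simpa using h, Finset.mem_union_right _
        (Finset.mem_image.2 ⟨x.length, by simp, by simp⟩)⟩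
  let Q := P ∪ P.biUnion F
  refine ((Q ×ˢ Q).image fun q => q.1 ++ q.2).finite_toSet.subset fun u hu => ?_
  rcases List.eq_nil_or_concat u with rfl | ⟨v, j, rfl⟩
  · exact absurd rfl hu
  rw [Finset.mem_coe, Finset.mem_image]
  refine ⟨(v, [j]), Finset.mem_product.2 ?_, by simp⟩
  have hu' : actMono deg D (v ++ [j]) w ≠ 0 := by simpa using hu
  rw [actMono_concat, Pi.add_apply] at hu'
  by_cases h : oneForm deg (D (mono K v)) (mono K [j]) w = 0
  · rw [h, zero_add, Pi.smul_apply] at hu'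
    obtain ⟨x, y, hxy, hx, hy⟩ := exists_of_oneForm_ne_zero deg (right_ne_zero_of_mul hu')
    rw [eq_of_mono_ne hx] at hxy
    exact ⟨Finset.mem_union_left _ (hP _ _ hxy).1, Finset.mem_union_right _
      (Finset.mem_biUnion.2 ⟨y, (hP _ _ hxy).2, hF' _ _ hy⟩)⟩
  · obtain ⟨x, y, hxy, hx, hy⟩ := exists_of_oneForm_ne_zero deg h
    rw [eq_of_mono_ne hy] at hxy
    exact ⟨Finset.mem_union_right _ (Finset.mem_biUnion.2 ⟨x, (hP _ _ hxy).1, hF' _ _ hx⟩),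
      Finset.mem_union_left _ (hP _ _ hxy).2⟩

variable {deg}

namespace IsOddDerivation

variable {D : NCSeries K J →ₗ[K] NCSeries K J}

/-- The Lie derivative of cyclic one-forms along an odd derivation. -/
noncomputable def act (hD : IsOddDerivation deg D) : NCSeries K J →ₗ[K] NCSeries K J :=
  extendMono (actMono deg D) (finite_actMono_ne_zero deg hD.continuous)

variable (hD : IsOddDerivation deg D)

theorem isContinuous_act : IsContinuous hD.act := isContinuous_extendMono _ _

theorem act_mono_nil : hD.act (mono K []) = 0 := by
  rw [act, extendMono_mono, actMono, dif_pos rfl]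

theorem act_mono_concat (u : List J) (j : J) : hD.act (mono K (u ++ [j])) =
    oneForm deg (D (mono K u)) (mono K [j]) +
      sg K (par deg u) • oneForm deg (mono K u) (D (mono K [j])) := by
  rw [act, extendMono_mono, actMono_concat]

theorem act_oneForm_mono (u v : List J) : hD.act (oneForm deg (mono K u) (mono K v)) =
    oneForm deg (D (mono K u)) (mono K v) +
      sg K (par deg u) • oneForm deg (mono K u) (D (mono K v)) := by
  induction v using List.reverseRecOn generalizing u with
  | nil => rw [oneForm_mono_nil, oneForm_mono_nil, hD.map_nil, map_zero, map_zero, smul_zero,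
      zero_add]
  | append_singleton v j ih =>
    have hu := HomotopyAlg.hasPar_mono (K := K) deg u
    have hv := HomotopyAlg.hasPar_mono (K := K) deg v
    have hj := HomotopyAlg.hasPar_mono (K := K) deg [j]
    rw [← mono_mul_mono v [j], oneForm_mul deg hu hv hj, oneForm_mul deg (hD.hasPar_mono u) hv hj,
      hD.map_mul_mono, map_add, map_smul, map_add, map_smul,
      oneForm_mul deg hu (hD.hasPar_mono v) hj, oneForm_mul deg hu hv (hD.hasPar_mono [j]),
      mono_mul_mono [j] u, ih, mono_mul_mono u v, oneForm_mono_singleton, mono_mul_mono,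
      act_mono_concat, hD.map_append u v, hD.map_append [j] u]
    simp only [map_add, map_smul, LinearMap.add_apply, LinearMap.smul_apply, par_append,
      ← mono_mul_mono]
    generalize par deg u = a
    generalize par deg v = b
    generalize par deg [j] = c
    have h2 : (1 + 1 : ZMod 2) = 0 := by decide
    rcases zmod2_cases a with rfl | rfl <;> rcases zmod2_cases b with rfl | rfl <;>
      rcases zmod2_cases c with rfl | rfl <;> simp [h2] <;> abel

theorem act_oneForm {p : ZMod 2} {f : NCSeries K J} (hf : HasPar deg p f) (g : NCSeries K J) :
    hD.act (oneForm deg f g) = oneForm deg (D f) g + sg K p • oneForm deg f (D g) := by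
  have hc := hD.isContinuous_act
  have h1 : ∀ v, hD.act (oneForm deg f (mono K v)) =
      oneForm deg (D f) (mono K v) + sg K p • oneForm deg f (D (mono K v)) := by
    intro v
    ext w
    refine (hc.comp (isContinuous_oneForm_flip deg (mono K v))).apply_congr
      (((isContinuous_oneForm_flip deg (mono K v)).comp hD.continuous).add
        ((isContinuous_oneForm_flip deg (D (mono K v))).smul (sg K p))) fun u hu => ?_
    rw [← hf u hu]
    exact congrFun (hD.act_oneForm_mono u v) w
  ext w
  exact (hc.comp (isContinuous_oneForm deg f)).apply_congr
    ((isContinuous_oneForm deg (D f)).add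
      (((isContinuous_oneForm deg f).comp hD.continuous).smul (sg K p)))
    fun v _ => congrFun (h1 v) w

/-- The de Rham differential commutes with Lie derivatives. -/
theorem act_cycNorm (f : NCSeries K J) : hD.act (cycNorm deg f) = cycNorm deg (D f) := by
  have := hD.act_oneForm (HomotopyAlg.hasPar_mono (K := K) deg []) f
  rwa [oneForm_one, oneForm_one, hD.map_nil, map_zero, LinearMap.zero_apply, zero_add, par_nil,
    sg_zero, one_smul] at this

/-- The map `1 - rot` from one-forms to series, `f dg ↦ [f, g]`, commutes with Lie derivatives. -/
theorem act_sub_rot (f : NCSeries K J) :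
    hD.act f - rot deg (hD.act f) = D f - D (rot deg f) := by
  have hc := hD.isContinuous_act
  have hr := isContinuous_rot (K := K) deg
  have hm : ∀ u v, oneForm deg (mono K u) (mono K v) -
      rot deg (oneForm deg (mono K u) (mono K v)) = mul (mono K u) (mono K v) -
        sg K (par deg u * par deg v) • mul (mono K v) (mono K u) := by
    intro u v
    rw [oneForm_sub_rot, mono_mul_mono, mono_mul_mono]
  -- `f dg ↦ [f, g]` for a series `f` or `g`
  have h1 : ∀ (p : ZMod 2) (f : NCSeries K J) (v : List J), HasPar deg p f →
      oneForm deg f (mono K v) - rot deg (oneForm deg f (mono K v)) =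
      mul f (mono K v) - sg K (p * par deg v) • mul (mono K v) f := by
    intro p f v hf
    have c := isContinuous_oneForm_flip deg (mono K v)
    ext w
    refine (c.sub (hr.comp c)).apply_congr ((isContinuous_mulB_flip (mono K v)).sub
      ((isContinuous_mulB (mono K v)).smul (sg K (p * par deg v)))) fun u hu => ?_
    rw [← hf u hu]
    exact congrFun (hm u v) w
  have h2 : ∀ (p : ZMod 2) (u : List J) (g : NCSeries K J), HasPar deg p g →
      oneForm deg (mono K u) g - rot deg (oneForm deg (mono K u) g) =
      mul (mono K u) g - sg K (par deg u * p) • mul g (mono K u) := by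
    intro p u g hg
    have c := isContinuous_oneForm deg (mono K u)
    ext w
    refine (c.sub (hr.comp c)).apply_congr ((isContinuous_mulB (mono K u)).sub
      ((isContinuous_mulB_flip (mono K u)).smul (sg K (par deg u * p)))) fun v hv => ?_
    rw [← hg v hv]
    exact congrFun (hm u v) w
  ext w
  refine (hc.sub (hr.comp hc)).apply_congr (hD.continuous.sub (hD.continuous.comp hr))
    fun u _ => ?_
  refine congrFun (?_ : hD.act (mono K u) - rot deg (hD.act (mono K u)) =
    D (mono K u) - D (rot deg (mono K u))) w
  rcases List.eq_nil_or_concat u with rfl | ⟨v, j, rfl⟩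
  · rw [hD.act_mono_nil, map_zero, sub_zero]
    have e : rot deg (mono K []) = mono K ([] : List J) := by
      ext w
      cases w with
      | nil => rfl
      | cons a w => rw [rot_cons, mono_of_ne (by simp), mono_of_ne (by simp), mul_zero]
    rw [e, hD.map_nil, sub_zero]
  · have e : rot deg (mono K (v ++ [j])) = sg K (par deg v * par deg [j]) • mono K ([j] ++ v) :=
      rot_pow_mono deg v [j]
    rw [List.concat_eq_append, hD.act_mono_concat, e, map_smul, map_add, map_smul, hD.map_append,
      hD.map_append, add_sub_add_comm, ← smul_sub, h1 _ _ _ (hD.hasPar_mono v),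
      h2 _ _ _ (hD.hasPar_letter j)]
    generalize par deg v = a
    generalize par deg [j] = c
    have h2 : (1 + 1 : ZMod 2) = 0 := by decide
    rcases zmod2_cases a with rfl | rfl <;>
      rcases zmod2_cases c with rfl | rfl <;> simp [h2] <;> abel

theorem act_act (hsq : ∀ f, D (D f) = 0) (f : NCSeries K J) : hD.act (hD.act f) = 0 := by
  have hc := hD.isContinuous_act
  ext w
  refine (hc.comp hc).apply_eq_zero fun u _ => ?_
  refine congrFun (?_ : hD.act (hD.act (mono K u)) = 0) w
  rcases List.eq_nil_or_concat u with rfl | ⟨v, j, rfl⟩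
  · rw [hD.act_mono_nil, map_zero]
  · rw [List.concat_eq_append, hD.act_mono_concat, map_add, map_smul,
      hD.act_oneForm (hD.hasPar_mono v), hD.act_oneForm (HomotopyAlg.hasPar_mono (K := K) deg v),
      hsq, hsq, map_zero, map_zero, LinearMap.zero_apply, sg_add, sg_one]
    simp

end IsOddDerivation

end OneFormAction

section Structure

variable {K : Type u} [CommRing K] [Algebra ℚ K] {𝒜 : ℤ → Submodule ℚ K} [GradedAlgebra 𝒜]
  {J : Type v} {deg : J → ℤ}

theorem AInfStructure.isOddDerivation (hodd : ∀ n, Odd n → 𝒜 n = ⊥) (S : AInfStructure 𝒜 deg) :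
    IsOddDerivation deg S.m := by
  have hl : ∀ u v, S.m (mono K (u ++ v)) =
      mul (S.m (mono K u)) (mono K v) + sg K (par deg u) • mul (mono K u) (S.m (mono K v)) := by
    intro u v
    rw [← mono_mul_mono, S.leibniz _ _ (mono_mem_homog deg 𝒜 u), par, ← negOnePow_eq_sg,
      Int.cast_smul_eq_zsmul]
  refine ⟨S.continuous, ?_, fun j u => hl [j] u, fun j => ?_⟩
  · have := hl [] []
    rw [List.append_nil, par_nil, sg_zero, one_smul, mono_nil_mul, mul_mono_nil] at this
    simpa using this
  · have := hasPar_of_mem_homog hodd (S.degree_one _ _ (mono_mem_homog deg 𝒜 [j]))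
    rwa [Int.cast_add, Int.cast_one] at this

end Structure

/-! ### The derivation `τ ↦ τ²` and its transpose -/

section TauSq

variable {K : Type u} [CommRing K] {I : Type v} (deg : I → ℤ)

/-- Whether the first letter of a word is `τ`. -/
def startsTau : List (Option I) → Bool
  | none :: _ => true
  | _ => false

/-- The coefficient at a word of the image of a series under the derivation `τ ↦ τ²`, `t_i ↦ 0`:
the alternating sum over all factors `ττ` of the word, merged into `τ`. -/
def mergeTau : List (Option I) → NCSeries K (Option I) → K
  | [], _ => 0
  | a :: w, f => (if a = none ∧ startsTau w then f w else 0) +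
      sg K (par (unitalDeg deg) [a]) * mergeTau w fun v => f (a :: v)

/-- The transpose of the derivation `τ ↦ τ²`, `t_i ↦ 0`: the alternating sum over all letters `τ`
of a word, doubled to `ττ`. -/
def doubleTau : List (Option I) → NCSeries K (Option I) → K
  | [], _ => 0
  | a :: w, f => (if a = none then f (none :: none :: w) else 0) +
      sg K (par (unitalDeg deg) [a]) * doubleTau w fun v => f (a :: v)

/-- The number of maximal runs of `τ` in a word. -/
def numRuns : List (Option I) → ℕ
  | [] => 0
  | a :: w => numRuns w + if a = none ∧ ¬ startsTau w then 1 else 0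

@[simp] theorem par_none : par (unitalDeg deg) [none] = 1 := by
  simp [par, wordDeg, unitalDeg]

theorem mergeTau_add (w : List (Option I)) (f g : NCSeries K (Option I)) :
    mergeTau deg w (f + g) = mergeTau deg w f + mergeTau deg w g := by
  induction w generalizing f g with
  | nil => simp [mergeTau]
  | cons a w ih =>
    have := ih (fun v => f (a :: v)) fun v => g (a :: v)
    simp only [mergeTau, Pi.add_apply]
    rw [show (fun v => f (a :: v) + g (a :: v)) = (fun v => f (a :: v)) + fun v => g (a :: v)
      from rfl, this]
    split_ifs <;> ring

theorem mergeTau_smul (w : List (Option I)) (c : K) (f : NCSeries K (Option I)) :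
    mergeTau deg w (c • f) = c * mergeTau deg w f := by
  induction w generalizing f with
  | nil => simp [mergeTau]
  | cons a w ih =>
    have := ih fun v => f (a :: v)
    simp only [mergeTau, Pi.smul_apply, smul_eq_mul]
    rw [show (fun v => c * f (a :: v)) = c • (fun v => f (a :: v)) from rfl, this]
    split_ifs <;> ring

theorem doubleTau_add (w : List (Option I)) (f g : NCSeries K (Option I)) :
    doubleTau deg w (f + g) = doubleTau deg w f + doubleTau deg w g := by
  induction w generalizing f g with
  | nil => simp [doubleTau]
  | cons a w ih =>
    have := ih (fun v => f (a :: v)) fun v => g (a :: v)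
    simp only [doubleTau, Pi.add_apply]
    rw [show (fun v => f (a :: v) + g (a :: v)) = (fun v => f (a :: v)) + fun v => g (a :: v)
      from rfl, this]
    split_ifs <;> ring

theorem doubleTau_smul (w : List (Option I)) (c : K) (f : NCSeries K (Option I)) :
    doubleTau deg w (c • f) = c * doubleTau deg w f := by
  induction w generalizing f with
  | nil => simp [doubleTau]
  | cons a w ih =>
    have := ih fun v => f (a :: v)
    simp only [doubleTau, Pi.smul_apply, smul_eq_mul]
    rw [show (fun v => c * f (a :: v)) = c • (fun v => f (a :: v)) from rfl, this]
    split_ifs <;> ring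

theorem mergeTau_congr {w : List (Option I)} {f g : NCSeries K (Option I)}
    (h : ∀ x y, w = x ++ none :: none :: y → f (x ++ none :: y) = g (x ++ none :: y)) :
    mergeTau deg w f = mergeTau deg w g := by
  induction w generalizing f g with
  | nil => rfl
  | cons a w ih =>
    simp only [mergeTau]
    rw [ih (f := fun v => f (a :: v)) (g := fun v => g (a :: v)) fun x y hw =>
      h (a :: x) y (by rw [hw]; rfl)]
    congr 1
    rcases a with _ | i
    · rcases w with _ | ⟨_ | j, w⟩
      · simp [startsTau]
      · simpa [startsTau] using h [] w rfl
      · simp [startsTau]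
    · simp

theorem doubleTau_congr {w : List (Option I)} {f g : NCSeries K (Option I)}
    (h : ∀ x y, w = x ++ none :: y → f (x ++ none :: none :: y) = g (x ++ none :: none :: y)) :
    doubleTau deg w f = doubleTau deg w g := by
  induction w generalizing f g with
  | nil => rfl
  | cons a w ih =>
    simp only [doubleTau]
    rw [ih (f := fun v => f (a :: v)) (g := fun v => g (a :: v)) fun x y hw =>
      h (a :: x) y (by rw [hw]; rfl)]
    congr 1
    rcases a with _ | i
    · simpa using h [] w rfl
    · simp

theorem mergeTau_zero (w : List (Option I)) : mergeTau deg w (0 : NCSeries K (Option I)) = 0 := by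
  have := mergeTau_smul (K := K) deg w 0 0
  rwa [zero_smul, zero_mul] at this

theorem doubleTau_zero (w : List (Option I)) :
    doubleTau deg w (0 : NCSeries K (Option I)) = 0 := by
  have := doubleTau_smul (K := K) deg w 0 0
  rwa [zero_smul, zero_mul] at this

theorem doubleTau_restrict_startsTau (w : List (Option I)) (f : NCSeries K (Option I)) :
    doubleTau deg w (fun v => if startsTau v then f v else 0) =
      if startsTau w then doubleTau deg w f else 0 := by
  rcases w with _ | ⟨_ | i, w⟩
  · simp [doubleTau]
  · simp [doubleTau, startsTau]
  · simp only [doubleTau, startsTau]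
    have := doubleTau_zero (K := K) deg w
    simp only [reduceCtorEq, if_false, Bool.false_eq_true, zero_add]
    erw [this]
    rw [mul_zero]

/-- The Laplacian of the derivation `τ ↦ τ²` multiplies each word by its number of runs of `τ`. -/
theorem mergeTau_doubleTau (w : List (Option I)) (f : NCSeries K (Option I)) :
    mergeTau deg w (fun v => doubleTau deg v f) + doubleTau deg w (fun v => mergeTau deg v f) =
      numRuns w * f w := by
  induction w generalizing f with
  | nil => simp [mergeTau, doubleTau, numRuns]
  | cons a w ih =>
    have ih' := ih fun v => f (a :: v)
    rcases a with _ | i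
    · have e1 : mergeTau deg w (fun v => f (none :: none :: v) + sg K (par (unitalDeg deg) [none]) *
          doubleTau deg v fun v => f (none :: v)) =
          mergeTau deg w (fun v => f (none :: none :: v)) -
            mergeTau deg w fun v => doubleTau deg v fun v => f (none :: v) := by
        have := mergeTau_add deg w (fun v => f (none :: none :: v))
          ((-1 : K) • fun v => doubleTau deg v fun v => f (none :: v))
        rw [mergeTau_smul] at this
        rw [sub_eq_add_neg, ← neg_one_mul, ← this]
        simp only [par_none, sg_one]
        rfl
      have e2 : doubleTau deg w (fun v => (if startsTau v then f v else 0) +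
          sg K (par (unitalDeg deg) [none]) * mergeTau deg v fun v => f (none :: v)) =
          (if startsTau w then doubleTau deg w f else 0) -
            doubleTau deg w fun v => mergeTau deg v fun v => f (none :: v) := by
        have := doubleTau_add deg w (fun v => if startsTau v then f v else 0)
          ((-1 : K) • fun v => mergeTau deg v fun v => f (none :: v))
        rw [doubleTau_smul, doubleTau_restrict_startsTau] at this
        rw [sub_eq_add_neg, ← neg_one_mul, ← this]
        simp only [par_none, sg_one]
        rfl
      have h1 : mergeTau deg (none :: w) (fun v => doubleTau deg v f) =
          (if startsTau w then doubleTau deg w f else 0) -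
          (mergeTau deg w (fun v => f (none :: none :: v)) -
            mergeTau deg w fun v => doubleTau deg v fun v => f (none :: v)) := by
        rw [← e1]
        simp only [mergeTau, doubleTau, if_true, true_and, par_none, sg_one]
        ring
      have h2 : doubleTau deg (none :: w) (fun v => mergeTau deg v f) =
          f (none :: w) - ((if startsTau w then f (none :: w) else 0) -
            mergeTau deg w fun v => f (none :: none :: v)) -
          ((if startsTau w then doubleTau deg w f else 0) -
            doubleTau deg w fun v => mergeTau deg v fun v => f (none :: v)) := by
        rw [← e2]
        have hs : startsTau (none :: w) = true := rfl
        simp only [mergeTau, doubleTau, if_true, true_and, par_none, sg_one, hs]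
        ring
      rw [h1, h2, numRuns]
      by_cases hs : startsTau w
      · simp only [hs, if_true, not_true_eq_false, and_false, if_false, add_zero]
        linear_combination ih'
      · simp only [hs, if_false, not_false_eq_true, and_self, if_true, Bool.false_eq_true]
        push_cast
        linear_combination ih'
    · have h1 : mergeTau deg (some i :: w) (fun v => doubleTau deg v f) =
          mergeTau deg w fun v => doubleTau deg v fun v => f (some i :: v) := by
        have := mergeTau_smul deg w (sg K (par (unitalDeg deg) [some i]))
          fun v => doubleTau deg v fun v => f (some i :: v)
        simp only [mergeTau, doubleTau, reduceCtorEq, if_false, false_and, zero_add]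
        erw [this]
        rw [← mul_assoc, sg_mul_self, one_mul]
      have h2 : doubleTau deg (some i :: w) (fun v => mergeTau deg v f) =
          doubleTau deg w fun v => mergeTau deg v fun v => f (some i :: v) := by
        have := doubleTau_smul deg w (sg K (par (unitalDeg deg) [some i]))
          fun v => mergeTau deg v fun v => f (some i :: v)
        simp only [mergeTau, doubleTau, reduceCtorEq, if_false, false_and, zero_add]
        erw [this]
        rw [← mul_assoc, sg_mul_self, one_mul]
      rw [h1, h2, ih']
      simp [numRuns]

theorem doubleTau_append (x y : List (Option I)) (f : NCSeries K (Option I)) :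
    doubleTau deg (x ++ y) f = doubleTau deg x (fun v => f (v ++ y)) +
      sg K (par (unitalDeg deg) x) * doubleTau deg y fun v => f (x ++ v) := by
  induction x generalizing f with
  | nil => simp [doubleTau]
  | cons a x ih =>
    simp only [List.cons_append, doubleTau, ih]
    rw [par_cons (unitalDeg deg) a x, sg_add]
    ring

/-- The transpose of a derivation preserves rotation invariant series. -/
theorem rot_doubleTau {f : NCSeries K (Option I)} (hf : rot (unitalDeg deg) f = f) :
    rot (unitalDeg deg) (fun w => doubleTau deg w f) = fun w => doubleTau deg w f := by
  ext w
  cases w with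
  | nil => rfl
  | cons a w =>
    rw [rot_cons, doubleTau_append]
    have h1 : doubleTau deg w (fun v => f (a :: v)) =
        sg K (par (unitalDeg deg) [a] * (par (unitalDeg deg) w + 1)) *
          doubleTau deg w fun v => f (v ++ [a]) := by
      rw [← doubleTau_smul]
      refine doubleTau_congr deg fun x y hw => ?_
      have hp : par (unitalDeg deg) (x ++ none :: none :: y) = par (unitalDeg deg) w + 1 := by
        rw [hw, par_append, par_append, par_cons _ none (none :: y), par_none]
        ring
      rw [Pi.smul_apply, ← hp]
      exact eq_of_rot_eq _ hf [a] _
    have h2 := eq_of_rot_eq _ hf [none, none] w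
    have hp : par (unitalDeg deg) ([none, none] : List (Option I)) = 0 := by
      rw [par_cons, par_none]; decide
    rw [hp, zero_mul, sg_zero, one_mul] at h2
    simp only [doubleTau]
    rw [h1]
    generalize par (unitalDeg deg) w = q
    have h3 : (1 + 1 : ZMod 2) = 0 := by decide
    rcases a with _ | i
    · rw [par_none]
      simp only [if_true, mul_zero, add_zero]
      rw [show f (none :: none :: w) = f ([none, none] ++ w) from rfl, h2]
      rcases zmod2_cases q with rfl | rfl <;> simp [h3]
      ring
    · generalize par (unitalDeg deg) [some i] = p
      rcases zmod2_cases q with rfl | rfl <;> rcases zmod2_cases p with rfl | rfl <;> simp [h3]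

theorem par_replicate_none (n : ℕ) :
    par (unitalDeg deg) (List.replicate n none) = n := by
  simp [par, wordDeg, unitalDeg]

theorem mergeTau_replicate (f : NCSeries K (Option I)) (n : ℕ) :
    mergeTau deg (List.replicate (n + 1) none) f =
      if Even (n + 1) then f (List.replicate n none) else 0 := by
  induction n generalizing f with
  | zero => simp [mergeTau, startsTau]
  | succ n ih =>
    have hs : startsTau (List.replicate (n + 1) (none : Option I)) = true := rfl
    rw [List.replicate_succ, mergeTau, ih, par_none, sg_one, if_pos ⟨rfl, hs⟩,
      ← List.replicate_succ]
    by_cases h : Even (n + 1)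
    · rw [if_pos h, if_neg (by simpa [Nat.even_add_one] using h)]; ring
    · rw [if_neg h, if_pos (by rwa [Nat.even_add_one (n := n + 1)])]; ring

/-- The derivation `τ ↦ τ²`, `t_i ↦ 0`. -/
def tauSq : NCSeries K (Option I) →ₗ[K] NCSeries K (Option I) where
  toFun f w := mergeTau deg w f
  map_add' f g := by ext w; exact mergeTau_add deg w f g
  map_smul' c f := by ext w; exact mergeTau_smul deg w c f

theorem tauSq_apply (f : NCSeries K (Option I)) (w : List (Option I)) :
    tauSq deg f w = mergeTau deg w f := rfl

theorem tauSq_cons (f : NCSeries K (Option I)) (a : Option I) (w : List (Option I)) :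
    tauSq deg f (a :: w) = (if a = none ∧ startsTau w then f w else 0) +
      sg K (par (unitalDeg deg) [a]) * tauSq deg (fun v => f (a :: v)) w := rfl

theorem isContinuous_tauSq : IsContinuous (tauSq (K := K) deg) := by
  classical
  intro w
  refine ⟨(Finset.range w.length).image fun k => w.take k ++ w.drop (k + 1), fun f hf => ?_⟩
  rw [tauSq_apply, ← mergeTau_zero deg w]
  refine mergeTau_congr deg fun x y hw => hf _ (Finset.mem_image.2 ⟨x.length, ?_, ?_⟩)
  · simp [hw]
  · simp [hw]

theorem tauSq_letter (j : Option I) :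
    tauSq deg (mono K [j]) = if j = none then mono K [none, none] else 0 := by
  ext w
  rcases w with _ | ⟨a, w⟩
  · rcases j with _ | j
    · rw [if_pos rfl, mono_of_ne (by simp)]; rfl
    · rfl
  rw [tauSq_cons]
  have h0 : tauSq deg (fun v => mono K [j] (a :: v)) w = 0 := by
    rw [tauSq_apply, ← mergeTau_zero deg w]
    refine mergeTau_congr deg fun x y hw => ?_
    rw [mono_of_ne (by simp)]
    rfl
  rw [h0, mul_zero, add_zero]
  rcases j with _ | j
  · rw [if_pos rfl]
    by_cases h : a = none ∧ w = [none]
    · obtain ⟨rfl, rfl⟩ := h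
      simp [startsTau]
    · rw [mono_of_ne (u := [none, none])]
      · split_ifs with h1
        · exact mono_of_ne fun h2 => h ⟨h1.1, h2⟩
        · rfl
      · intro h1
        simp only [List.cons.injEq] at h1
        exact h ⟨h1.1, h1.2⟩
  · rw [if_neg (Option.some_ne_none j)]
    split_ifs with h1
    · refine mono_of_ne ?_
      rintro rfl
      simp [startsTau] at h1
    · rfl

theorem isOddDerivation_tauSq : IsOddDerivation (unitalDeg deg) (tauSq (K := K) deg) where
  continuous := isContinuous_tauSq deg
  map_nil := by
    ext w
    rw [tauSq_apply]
    refine (mergeTau_congr deg fun x y hw => ?_).trans (mergeTau_zero deg w)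
    exact mono_of_ne (by simp)
  map_cons j u := by
    rw [tauSq_letter]
    ext w
    rcases w with _ | ⟨a, w⟩
    · rw [Pi.add_apply, Pi.smul_apply, mul_nil, mul_nil, mono_of_ne (u := [j]) (by simp)]
      split_ifs
      · rw [mono_of_ne (by simp)]
        simp [tauSq_apply, mergeTau]
      · simp [tauSq_apply, mergeTau]
    rw [tauSq_cons, Pi.add_apply, Pi.smul_apply, mono_singleton_mul_cons, smul_eq_mul]
    have h1 : (fun v => mono K (j :: u) (a :: v)) = mono K [j] [a] • mono K u := by
      ext v
      rw [show j :: u = [j] ++ u from rfl, ← mono_mul_mono, mono_singleton_mul_cons]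
      rfl
    rw [h1, map_smul, Pi.smul_apply, smul_eq_mul]
    have h2 : sg K (par (unitalDeg deg) [a]) * (mono K [j] [a] * tauSq deg (mono K u) w) =
        sg K (par (unitalDeg deg) [j]) * (mono K [j] [a] * tauSq deg (mono K u) w) := by
      by_cases h : a = j
      · rw [h]
      · rw [mono_of_ne (by simpa using h)]; ring
    rw [h2]
    congr 1
    rcases j with _ | j
    · rw [if_pos rfl, mono_mul_mono]
      by_cases h : a :: w = [none, none] ++ u
      · rw [h, mono_self]
        simp only [List.cons_append, List.nil_append, List.cons.injEq] at h
        obtain ⟨rfl, rfl⟩ := h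
        simp [startsTau]
      · rw [mono_of_ne h]
        split_ifs with h3
        · refine mono_of_ne ?_
          rintro rfl
          exact h (by rw [h3.1]; rfl)
        · rfl
    · rw [if_neg (Option.some_ne_none j), zero_mul_series]
      split_ifs with h3
      · refine mono_of_ne ?_
        rintro rfl
        simp [startsTau] at h3
      · rfl
  hasPar_letter j := by
    rw [tauSq_letter]
    rcases j with _ | j
    · rw [if_pos rfl, par_none]
      have := hasPar_mono (K := K) (unitalDeg deg) [none, none]
      rwa [par_cons, par_none] at this
    · rw [if_neg (Option.some_ne_none j)]
      exact fun w hw => absurd rfl hw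

/-- On words ending in one of the `t_i` the action of the derivation `τ ↦ τ²` on cyclic one-forms is
the action on series. -/
theorem act_tauSq_concat (f : NCSeries K (Option I)) (w : List (Option I)) (i : I) :
    (isOddDerivation_tauSq deg).act f (w ++ [some i]) = mergeTau deg (w ++ [some i]) f := by
  have hD := isOddDerivation_tauSq (K := K) deg
  rw [← tauSq_apply]
  refine hD.isContinuous_act.apply_congr hD.continuous fun u _ => ?_
  rcases List.eq_nil_or_concat u with rfl | ⟨v, j, rfl⟩
  · rw [hD.act_mono_nil, hD.map_nil]
  rw [List.concat_eq_append, hD.act_mono_concat, hD.map_append, oneForm_mono_singleton,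
    Pi.add_apply, Pi.add_apply, Pi.smul_apply, Pi.smul_apply]
  congr 2
  rw [tauSq_letter]
  rcases j with _ | j
  · rw [if_pos rfl, mono_mul_mono, oneForm_mono_mono]
    have h1 : mono K (v ++ [none, none]) (w ++ [some i]) = 0 := by
      refine mono_of_ne fun h => ?_
      rw [show v ++ [none, none] = (v ++ [none]) ++ [none] by simp] at h
      simpa using (List.append_inj' h rfl).2
    have h2 : rot (unitalDeg deg) (mono K (v ++ [none, none])) (w ++ [some i]) = 0 := by
      have := rot_pow_mono (K := K) (unitalDeg deg) (v ++ [none]) [none]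
      simp only [List.append_assoc, List.length_singleton, pow_one, List.cons_append,
        List.nil_append] at this
      rw [this, Pi.smul_apply, mono_of_ne, smul_zero]
      intro h
      rw [show none :: (v ++ [none]) = (none :: v) ++ [none] by simp] at h
      simpa using (List.append_inj' h rfl).2
    rw [h1]
    simp [Finset.sum_range_succ, h1, h2]
  · rw [if_neg (Option.some_ne_none j), mul_zero_series, map_zero]

end TauSq

/-! ### Weights of words -/

section Weights

variable {K : Type u} [CommRing K] {J : Type v} {deg : J → ℤ}

/-- The weight of a word, given the weights of the letters. -/
def wt (c : J → ℕ) (w : List J) : ℕ := (w.map c).sum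

theorem wt_append (c : J → ℕ) (x y : List J) : wt c (x ++ y) = wt c x + wt c y := by
  simp [wt]

theorem wt_cons (c : J → ℕ) (a : J) (y : List J) : wt c (a :: y) = c a + wt c y := by
  simp [wt]

@[simp] theorem wt_nil (c : J → ℕ) : wt c [] = 0 := rfl

theorem wt_perm (c : J → ℕ) {x y : List J} (h : x.Perm y) : wt c x = wt c y :=
  (h.map c).sum_eq

theorem wt_one (w : List J) : wt (fun _ => 1) w = w.length := by simp [wt]

/-- The linear map raises the weight of words by at least `r`. -/
def Raises (c : J → ℕ) (r : ℕ) (φ : NCSeries K J →ₗ[K] NCSeries K J) : Prop :=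
  ∀ u w, φ (mono K u) w ≠ 0 → wt c u + r ≤ wt c w

theorem Raises.apply_eq_zero {c : J → ℕ} {r : ℕ} {φ : NCSeries K J →ₗ[K] NCSeries K J}
    (h : Raises c r φ) (hφ : IsContinuous φ) {f : NCSeries K J} {n : ℕ}
    (hf : ∀ u, wt c u < n → f u = 0) {w : List J} (hw : wt c w < n + r) : φ f w = 0 := by
  refine hφ.apply_eq_zero fun u hu => ?_
  by_contra h1
  have h2 := h u w h1
  exact hu (hf u (by omega))

namespace IsOddDerivation

variable {D : NCSeries K J →ₗ[K] NCSeries K J}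

theorem raises (hD : IsOddDerivation deg D) {c : J → ℕ} {r : ℕ}
    (hl : ∀ j w, D (mono K [j]) w ≠ 0 → c j + r ≤ wt c w) : Raises c r D := by
  intro u
  induction u with
  | nil =>
    intro w hw
    rw [hD.map_nil] at hw
    exact absurd rfl hw
  | cons j u ih =>
    intro w hw
    rw [hD.map_cons, Pi.add_apply] at hw
    rw [wt_cons]
    by_cases h : mul (D (mono K [j])) (mono K u) w = 0
    · rw [h, zero_add, Pi.smul_apply] at hw
      obtain ⟨x, y, rfl, hx, hy⟩ := exists_of_mul_ne_zero (right_ne_zero_of_mul hw)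
      have := ih y hy
      rw [eq_of_mono_ne hx, wt_append, wt_cons, wt_nil]
      omega
    · obtain ⟨x, y, rfl, hx, hy⟩ := exists_of_mul_ne_zero h
      have := hl j x hx
      rw [eq_of_mono_ne hy, wt_append]
      omega

theorem raises_act (hD : IsOddDerivation deg D) {c : J → ℕ} {r : ℕ}
    (hl : ∀ j w, D (mono K [j]) w ≠ 0 → c j + r ≤ wt c w) : Raises c r hD.act := by
  intro u w hw
  rcases List.eq_nil_or_concat u with rfl | ⟨v, j, rfl⟩
  · rw [hD.act_mono_nil] at hw
    exact absurd rfl hw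
  rw [List.concat_eq_append] at hw ⊢
  rw [hD.act_mono_concat, Pi.add_apply] at hw
  rw [wt_append, wt_cons, wt_nil]
  by_cases h : oneForm deg (D (mono K v)) (mono K [j]) w = 0
  · rw [h, zero_add, Pi.smul_apply] at hw
    obtain ⟨x, y, hxy, hx, hy⟩ := exists_of_oneForm_ne_zero deg (right_ne_zero_of_mul hw)
    have := hl j y hy
    rw [← wt_perm c hxy, eq_of_mono_ne hx, wt_append]
    omega
  · obtain ⟨x, y, hxy, hx, hy⟩ := exists_of_oneForm_ne_zero deg h
    have := hD.raises hl v x hx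
    rw [← wt_perm c hxy, eq_of_mono_ne hy, wt_append, wt_cons, wt_nil]
    omega

end IsOddDerivation

end Weights

/-! ### The inner derivation by `τ` -/

section AdTau

variable {K : Type u} [CommRing K] {I : Type v} (deg : I → ℤ)

/-- The inner derivation `ad τ`. -/
noncomputable def adTau : NCSeries K (Option I) →ₗ[K] NCSeries K (Option I) :=
  mulB (mono K [none]) -
    mulB.flip (mono K [none]) ∘ₗ diag fun w => sg K (par (unitalDeg deg) w)

theorem adTau_apply (f : NCSeries K (Option I)) : adTau deg f = mul (mono K [none]) f -
    mul (diag (fun w => sg K (par (unitalDeg deg) w)) f) (mono K [none]) := rfl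

theorem isContinuous_adTau : IsContinuous (adTau (K := K) deg) :=
  (isContinuous_mulB _).sub ((isContinuous_mulB_flip _).comp (isContinuous_diag _))

theorem adTau_mono (u : List (Option I)) : adTau deg (mono K u) =
    mono K (none :: u) - sg K (par (unitalDeg deg) u) • mono K (u ++ [none]) := by
  have e : diag (fun w => sg K (par (unitalDeg deg) w)) (mono K u) =
      sg K (par (unitalDeg deg) u) • mono K u := by
    ext w
    by_cases h : w = u
    · subst h; simp
    · simp [mono_of_ne h]
  rw [adTau_apply, e, mono_mul_mono, ← mulB_apply, map_smul, LinearMap.smul_apply, mulB_apply,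
    mono_mul_mono]
  rfl

theorem isOddDerivation_adTau : IsOddDerivation (unitalDeg deg) (adTau (K := K) deg) where
  continuous := isContinuous_adTau deg
  map_nil := by rw [adTau_mono]; simp
  map_cons j u := by
    simp only [adTau_mono, par_cons _ j u, sg_add]
    simp only [← mulB_apply, map_sub, map_smul, LinearMap.sub_apply, LinearMap.smul_apply]
    simp only [mulB_apply, mono_mul_mono, List.cons_append, List.nil_append, smul_sub, smul_smul]
    abel
  hasPar_letter j w hw := by
    rw [adTau_mono, Pi.sub_apply, Pi.smul_apply] at hw
    by_cases h : mono K [none, j] w = 0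
    · rw [h, zero_sub, neg_ne_zero] at hw
      rw [eq_of_mono_ne (right_ne_zero_of_mul hw), par_append, par_none]
    · rw [eq_of_mono_ne h, par_cons, par_none, add_comm]

/-- Inner derivations act trivially modulo commutators. -/
theorem cycNorm_adTau (f : NCSeries K (Option I)) : cycNorm (unitalDeg deg) (adTau deg f) = 0 := by
  ext w
  refine ((isContinuous_cycNorm _).comp (isContinuous_adTau deg)).apply_eq_zero fun u _ => ?_
  refine congrFun (?_ : cycNorm (unitalDeg deg) (adTau deg (mono K u)) = 0) w
  have := cycNorm_mono_append_comm (K := K) (unitalDeg deg) [none] u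
  rw [par_none, one_mul] at this
  rw [adTau_mono, map_sub, map_smul, ← this, List.singleton_append, sub_self]

theorem adTau_apply_eq_zero {f : NCSeries K (Option I)} {w : List (Option I)}
    (h : ∀ u, (none :: u).Perm w → f u = 0) : adTau deg f w = 0 := by
  refine (isContinuous_adTau deg).apply_eq_zero fun u hu => ?_
  rw [adTau_mono, Pi.sub_apply, Pi.smul_apply, mono_of_ne, mono_of_ne, smul_zero, sub_zero]
  · rintro rfl
    exact hu (h u (List.perm_append_singleton _ _).symm)
  · rintro rfl
    exact hu (h u (List.Perm.refl _))

end AdTau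

/-! ### Unital structures -/

section Unital

variable {K : Type u} [CommRing K] {I : Type v}

theorem incl_map_some (f : NCSeries K I) (w : List I) : incl f (w.map some) = f w := by
  have h : (w.map some).all Option.isSome = true := by simp
  have h2 : (w.map some).reduceOption = w := by simp [List.reduceOption]
  change (if (w.map some).all Option.isSome then f (w.map some).reduceOption else 0) = f w
  rw [if_pos h, h2]

theorem incl_of_mem (f : NCSeries K I) {w : List (Option I)} (h : none ∈ w) : incl f w = 0 := by
  refine if_neg fun h1 => ?_
  simpa using (List.all_eq_true.1 h1) none h

theorem exists_map_some {w : List (Option I)} (h : none ∉ w) : ∃ v : List I, w = v.map some := by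
  induction w with
  | nil => exact ⟨[], rfl⟩
  | cons a w ih =>
    obtain ⟨v, hv⟩ := ih fun h1 => h (List.mem_cons_of_mem _ h1)
    rcases a with _ | i
    · simp at h
    · exact ⟨i :: v, by rw [hv]; rfl⟩

theorem eq_incl {f : NCSeries K (Option I)} (h : ∀ w, none ∈ w → f w = 0) :
    f = incl fun v => f (v.map some) := by
  ext w
  by_cases hw : none ∈ w
  · rw [h w hw, incl_of_mem _ hw]
  · obtain ⟨v, rfl⟩ := exists_map_some hw
    rw [incl_map_some]

/-- The weight of the letters for which the weight of a word is its number of letters `t_i`. -/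
def tWt (a : Option I) : ℕ := if a = none then 0 else 1

@[simp] theorem tWt_none : tWt (none : Option I) = 0 := rfl

@[simp] theorem tWt_some (i : I) : tWt (some i) = 1 := rfl

theorem wt_tWt_map_some (v : List I) : wt tWt (v.map some) = v.length := by
  induction v with
  | nil => rfl
  | cons a v ih => rw [List.map_cons, wt_cons, ih, List.length_cons, tWt_some, add_comm]

variable [Algebra ℚ K] {𝒜 : ℤ → Submodule ℚ K} {deg : I → ℤ}

namespace AInfStructure

variable (S : AInfStructure 𝒜 (unitalDeg deg))

/-- The derivation `m - ad τ + τ² ∂_τ = A(t) ∂_τ + ∑ B_i(t) ∂_{t_i}`. -/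
noncomputable def reduced : NCSeries K (Option I) →ₗ[K] NCSeries K (Option I) :=
  S.m + -adTau deg + tauSq deg

theorem m_apply (f : NCSeries K (Option I)) (w : List (Option I)) :
    S.m f w = S.reduced f w + adTau deg f w - tauSq deg f w := by
  change _ = (S.m f w + -adTau deg f w + tauSq deg f w) + adTau deg f w - tauSq deg f w
  ring

theorem isOddDerivation_reduced [GradedAlgebra 𝒜] (hodd : ∀ n, Odd n → 𝒜 n = ⊥) :
    IsOddDerivation (unitalDeg deg) S.reduced :=
  ((S.isOddDerivation hodd).add (isOddDerivation_adTau deg).neg).add (isOddDerivation_tauSq deg)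

theorem reduced_letter (hunital : S.IsUnital) (hmin : S.IsMinimal) (j : Option I) :
    ∃ A : NCSeries K I, S.reduced (mono K [j]) = incl A ∧ A [] = 0 ∧ ∀ k, A [k] = 0 := by
  suffices h : ∃ A : NCSeries K I, S.reduced (mono K [j]) = incl A by
    obtain ⟨A, hA⟩ := h
    have hv : ∀ v : List I, v.length ≤ 1 → A v = S.m (mono K [j]) (v.map some) := by
      intro v hv
      rw [m_apply, hA, incl_map_some]
      have h1 : adTau deg (mono K [j]) (v.map some) = 0 := by
        refine adTau_apply_eq_zero deg fun u hu => absurd (hu.subset List.mem_cons_self) (by simp)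
      have h2 : tauSq deg (mono K [j]) (v.map some) = 0 := by
        rw [tauSq_letter]
        split_ifs
        · refine mono_of_ne fun h => ?_
          have := congrArg List.length h
          simp at this
          omega
        · rfl
      rw [h1, h2]
      ring
    exact ⟨A, hA, by rw [hv [] (by simp)]; exact S.vanishes_at_zero j,
      fun k => by rw [hv [k] (by simp)]; exact hmin j (some k)⟩
  rcases j with _ | i
  · obtain ⟨A, hA⟩ := hunital.1
    refine ⟨A, ?_⟩
    ext w
    have h1 := congrFun hA w
    rw [bracket_eq, show tau K I = mono K [none] from rfl, mono_mul_mono, m_apply, adTau_mono,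
      tauSq_letter, if_pos rfl, par_none] at h1
    simp only [Int.cast_one, mul_one, List.singleton_append] at h1
    simp only [Pi.sub_apply, Pi.add_apply] at h1
    linear_combination h1
  · obtain ⟨B, hB⟩ := hunital.2 i
    refine ⟨B, ?_⟩
    ext w
    have h1 := congrFun hB w
    have hp : par (unitalDeg deg) [some i] = ((1 - deg i : ℤ) : ZMod 2) := by
      simp [par, wordDeg, unitalDeg]
    rw [bracket_eq, show tau K I = mono K [none] from rfl, letter_eq_mono, mono_mul_mono,
      mono_mul_mono, m_apply, adTau_mono, tauSq_letter, if_neg (Option.some_ne_none i), hp] at h1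
    simp only [Int.cast_one, one_mul, List.singleton_append] at h1
    simp only [Pi.sub_apply, Pi.add_apply, Pi.zero_apply] at h1
    linear_combination h1

/-- By minimality the series `A` and `B_i` have no linear terms. -/
theorem reduced_letter_ne_zero (hunital : S.IsUnital) (hmin : S.IsMinimal)
    {j : Option I} {w : List (Option I)}
    (h : S.reduced (mono K [j]) w ≠ 0) : none ∉ w ∧ tWt j + 1 ≤ wt tWt w := by
  obtain ⟨A, hA, h0, h1⟩ := S.reduced_letter hunital hmin j
  rw [hA] at h
  have hw : none ∉ w := fun hw => h (incl_of_mem A hw)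
  refine ⟨hw, ?_⟩
  obtain ⟨v, rfl⟩ := exists_map_some hw
  rw [incl_map_some] at h
  rw [wt_tWt_map_some]
  have hj : tWt j ≤ 1 := by cases j <;> simp
  rcases v with _ | ⟨a, _ | ⟨b, v⟩⟩
  · exact absurd h0 h
  · exact absurd (h1 a) h
  · simp only [List.length_cons]; omega

variable [GradedAlgebra 𝒜] (hodd : ∀ n, Odd n → 𝒜 n = ⊥) (hunital : S.IsUnital)
  (hmin : S.IsMinimal)

include hodd hunital hmin in
theorem raises_reduced : Raises tWt 1 S.reduced :=
  (S.isOddDerivation_reduced hodd).raises fun _ _ h =>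
    (S.reduced_letter_ne_zero hunital hmin h).2

include hodd hunital hmin in
theorem reduced_mono_tauFree {u w : List (Option I)} (hu : none ∉ u)
    (h : S.reduced (mono K u) w ≠ 0) : none ∉ w := by
  have hD := S.isOddDerivation_reduced hodd
  induction u generalizing w with
  | nil => rw [hD.map_nil] at h; exact absurd rfl h
  | cons j u ih =>
    simp only [List.mem_cons, not_or] at hu
    rw [hD.map_cons, Pi.add_apply] at h
    by_cases h1 : mul (S.reduced (mono K [j])) (mono K u) w = 0
    · rw [h1, zero_add, Pi.smul_apply] at h
      obtain ⟨x, y, rfl, hx, hy⟩ := exists_of_mul_ne_zero (right_ne_zero_of_mul h)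
      rw [eq_of_mono_ne hx]
      simp [hu.1, ih hu.2 hy]
    · obtain ⟨x, y, rfl, hx, hy⟩ := exists_of_mul_ne_zero h1
      rw [eq_of_mono_ne hy]
      simp [hu.2, (S.reduced_letter_ne_zero hunital hmin hx).1]

/-- The series `m f` for `f` a series in the variables `t`, modulo the commutator `[τ, f]`. -/
noncomputable def restrictM (f : NCSeries K I) : NCSeries K I := fun v => S.m (incl f) (v.map some)

include hodd hunital hmin in
theorem m_incl (f : NCSeries K I) : S.m (incl f) = incl (S.restrictM f) + adTau deg (incl f) := by
  have h0 : tauSq deg (incl f) = 0 := by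
    ext w
    refine (isContinuous_tauSq deg).apply_eq_zero fun u hu => ?_
    have hu' : none ∉ u := fun h => hu (incl_of_mem f h)
    rw [tauSq_apply, ← mergeTau_zero deg w]
    refine mergeTau_congr deg fun x y _ => mono_of_ne ?_
    rintro rfl
    simp at hu'
  have h1 : S.m (incl f) = S.reduced (incl f) + adTau deg (incl f) := by
    ext w
    rw [m_apply, h0, Pi.zero_apply, sub_zero]
    rfl
  have h2 : S.reduced (incl f) = incl fun v => S.reduced (incl f) (v.map some) := by
    refine eq_incl fun w hw => ?_
    refine (S.isOddDerivation_reduced hodd).continuous.apply_eq_zero fun u hu => ?_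
    by_contra h
    exact S.reduced_mono_tauFree hodd hunital hmin (fun h => hu (incl_of_mem f h)) h hw
  have h3 : S.restrictM f = fun v => S.reduced (incl f) (v.map some) := by
    ext v
    rw [restrictM, m_apply, h0, Pi.zero_apply, sub_zero, adTau_apply_eq_zero, add_zero]
    exact fun u hu => absurd (hu.subset List.mem_cons_self) (by simp)
  rw [h1, h3, ← h2]

include hodd hunital hmin in
/-- The part of `m` that does not raise the number of letters `t_i` is `ad τ - τ² ∂_τ`. -/
theorem m_apply_leading {f : NCSeries K (Option I)} {n : ℕ}
    (hf : ∀ u, wt tWt u < n → f u = 0) {w : List (Option I)} (hw : wt tWt w ≤ n) :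
    S.m f w = adTau deg f w - tauSq deg f w := by
  rw [m_apply, (S.raises_reduced hodd hunital hmin).apply_eq_zero
    (S.isOddDerivation_reduced hodd).continuous hf (by omega), zero_add]

include hodd hunital hmin in
theorem m_apply_eq_zero {f : NCSeries K (Option I)} {n : ℕ}
    (hf : ∀ u, wt tWt u < n → f u = 0) {w : List (Option I)} (hw : wt tWt w < n) :
    S.m f w = 0 := by
  rw [S.m_apply_leading hodd hunital hmin hf hw.le, adTau_apply_eq_zero, tauSq_apply,
    mergeTau_congr (g := 0), mergeTau_zero, sub_zero]
  · intro x y h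
    refine hf _ ?_
    simpa [h, wt_append, wt_cons] using hw
  · intro u hu
    refine hf u ?_
    simpa [← wt_perm tWt hu, wt_cons] using hw

end AInfStructure

/-- The projection `t_i ↦ 0` intertwines `m` with the differential `τ ↦ τ²`. -/
theorem AInfStructure.restrictUnit_m [GradedAlgebra 𝒜] (hodd : ∀ n, Odd n → 𝒜 n = ⊥)
    (S : AInfStructure 𝒜 (unitalDeg deg)) (hunital : S.IsUnital) (hmin : S.IsMinimal)
    (f : NCSeries K (Option I)) : restrictUnit (S.m f) = groundMap (restrictUnit f) := by
  ext w
  obtain ⟨n, rfl⟩ : ∃ n, w = List.replicate n () := ⟨w.length, by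
    rw [List.eq_replicate_iff]; exact ⟨rfl, fun _ _ => rfl⟩⟩
  change S.m f ((List.replicate n ()).map fun _ => none) =
    if List.replicate n () ≠ [] ∧ Even (List.replicate n ()).length then
      f ((List.replicate n ()).tail.map fun _ => none) else 0
  rw [List.map_replicate, S.m_apply_leading hodd hunital hmin (n := 0) (by simp)
    (by simp [wt])]
  cases n with
  | zero => simp [adTau_apply, tauSq_apply, mergeTau, mono_of_ne]
  | succ n =>
    have h1 : mul (mono K [none]) f (List.replicate (n + 1) none) = f (List.replicate n none) := by
      rw [List.replicate_succ, mono_singleton_mul_cons, mono_self, one_mul]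
    have h2 : ∀ g : NCSeries K (Option I),
        mul g (mono K [none]) (List.replicate (n + 1) none) = g (List.replicate n none) := by
      intro g
      rw [List.replicate_succ', mul_mono_singleton_concat, mono_self, mul_one]
    rw [adTau_apply, Pi.sub_apply, h1, h2, diag_apply, par_replicate_none, sg_natCast,
      tauSq_apply, mergeTau_replicate]
    simp only [List.replicate_succ, List.tail_cons, List.map_replicate, List.length_cons,
      List.length_replicate, ne_eq, reduceCtorEq, not_false_eq_true, true_and, Nat.even_add_one]
    by_cases h : Even n <;> simp [h]

end Unital

/-! ### Counting runs of `τ` cyclically -/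

section CyclicRuns

variable {I : Type v}

theorem startsTau_cons (a : Option I) (w : List (Option I)) :
    startsTau (a :: w) = decide (a = none) := by
  cases a <;> rfl

/-- The number of factors `τ t_i` of a word. -/
def tauPairs : List (Option I) → ℕ
  | a :: b :: w => tauPairs (b :: w) + if a = none ∧ ¬ b = none then 1 else 0
  | _ => 0

/-- The number of factors `τ t_i` of a cyclic word. -/
def cycRuns : List (Option I) → ℕ
  | [] => 0
  | a :: w => tauPairs (a :: w ++ [a])

theorem tauPairs_concat (x : List (Option I)) (a b : Option I) : tauPairs (x ++ [a, b]) =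
    tauPairs (x ++ [a]) + if a = none ∧ ¬ b = none then 1 else 0 := by
  induction x with
  | nil => simp [tauPairs]
  | cons c x ih =>
    rcases x with _ | ⟨d, x⟩
    · simp [tauPairs, add_comm]
    · simp only [List.cons_append, tauPairs] at ih ⊢
      omega

theorem cycRuns_rotate (a : Option I) (w : List (Option I)) :
    cycRuns (a :: w) = cycRuns (w ++ [a]) := by
  rcases w with _ | ⟨b, w⟩
  · rfl
  · have := tauPairs_concat (b :: w) a b
    simp only [cycRuns, List.cons_append, List.append_assoc, List.nil_append, tauPairs] at this ⊢
    omega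

theorem tauPairs_eq_numRuns (x : List (Option I)) (i : I) :
    tauPairs (x ++ [some i]) = numRuns (x ++ [some i]) := by
  induction x with
  | nil => simp [tauPairs, numRuns]
  | cons a x ih =>
    rcases x with _ | ⟨_ | d, x⟩
    · simp [tauPairs, numRuns, startsTau]
    · simp only [List.cons_append, tauPairs] at ih ⊢
      rw [ih, numRuns.eq_2 a, startsTau_cons]
      simp
    · simp only [List.cons_append, tauPairs] at ih ⊢
      rw [ih, numRuns.eq_2 a, startsTau_cons]
      simp

theorem cycRuns_eq_numRuns (x : List (Option I)) (i : I) :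
    cycRuns (x ++ [some i]) = numRuns (x ++ [some i]) := by
  have h := fun a => tauPairs_concat x (some i) a
  rw [← tauPairs_eq_numRuns]
  rcases x with _ | ⟨c, x⟩
  · simp [cycRuns, tauPairs]
  · simpa [cycRuns] using h c

theorem numRuns_ne_zero {w : List (Option I)} (h : none ∈ w) : numRuns w ≠ 0 := by
  induction w with
  | nil => simp at h
  | cons a w ih =>
    rw [numRuns]
    by_cases hw : none ∈ w
    · have := ih hw
      omega
    · have ha : a = none := by
        rcases List.mem_cons.1 h with h | h
        · exact h.symm
        · exact absurd h hw
      have hs : ¬ startsTau w := by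
        rcases w with _ | ⟨_ | b, w⟩
        · simp [startsTau]
        · simp at hw
        · simp [startsTau]
      rw [if_pos ⟨ha, hs⟩]
      omega

theorem numRuns_merge (x y : List (Option I)) :
    numRuns (x ++ none :: none :: y) = numRuns (x ++ none :: y) := by
  induction x with
  | nil => simp [numRuns, startsTau]
  | cons a x ih =>
    have hs : startsTau (x ++ none :: none :: y) = startsTau (x ++ none :: y) := by
      cases x with
      | nil => rfl
      | cons b x => rw [List.cons_append, List.cons_append, startsTau_cons, startsTau_cons]
    rw [List.cons_append, List.cons_append, numRuns, numRuns, ih, hs]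

theorem exists_concat_of_append_none {X x y : List (Option I)} {i : I}
    (h : X ++ [some i] = x ++ none :: y) : ∃ z, y = z ++ [some i] := by
  rcases List.eq_nil_or_concat y with rfl | ⟨z, j, rfl⟩
  · have := (List.append_inj' h rfl).2
    simp at this
  · refine ⟨z, ?_⟩
    rw [List.concat_eq_append, ← List.cons_append, ← List.append_assoc] at h
    rw [List.concat_eq_append, (List.append_inj' h rfl).2]

end CyclicRuns

/-! ### Homogeneity -/

section Homogeneity

variable {K : Type u} [CommRing K] [Algebra ℚ K] {𝒜 : ℤ → Submodule ℚ K} {J : Type v}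
  {deg : J → ℤ}

theorem sg_mul_mem (S : Submodule ℚ K) (x : ZMod 2) {y : K} (hy : y ∈ S) : sg K x * y ∈ S := by
  rcases zmod2_cases x with rfl | rfl
  · simpa using hy
  · simpa using hy

theorem algebraMap_mul_mem (S : Submodule ℚ K) (q : ℚ) {y : K} (hy : y ∈ S) :
    algebraMap ℚ K q * y ∈ S := by
  rw [← Algebra.smul_def]
  exact S.smul_mem q hy

theorem wordDeg_perm {x y : List J} (h : x.Perm y) : wordDeg deg x = wordDeg deg y :=
  (h.map _).sum_eq

theorem rot_pow_mem_homog {n : ℤ} {f : NCSeries K J} (hf : f ∈ homog 𝒜 deg n) (k : ℕ) :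
    (rot deg ^ k) f ∈ homog 𝒜 deg n := by
  induction k with
  | zero => exact hf
  | succ k ih =>
    rw [pow_succ', Module.End.mul_apply]
    intro w
    rcases w with _ | ⟨a, w⟩
    · exact ih []
    · rw [rot_cons, wordDeg_perm (List.perm_append_singleton a w).symm]
      exact sg_mul_mem _ _ (ih _)

theorem cycNorm_mem_homog {n : ℤ} {f : NCSeries K J} (hf : f ∈ homog 𝒜 deg n) :
    cycNorm deg f ∈ homog 𝒜 deg n := fun w => by
  rw [cycNorm_apply]
  exact Submodule.sum_mem _ fun k _ => rot_pow_mem_homog hf k w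

theorem divLen_mem_homog {n : ℤ} {f : NCSeries K J} (hf : f ∈ homog 𝒜 deg n) :
    divLen f ∈ homog 𝒜 deg n := fun w => algebraMap_mul_mem _ _ (hf w)

theorem locSum_mem_homog {n : ℤ} {μ : List J → ℕ} {F : ℕ → NCSeries K J}
    (hF : ∀ k, F k ∈ homog 𝒜 deg n) : locSum μ F ∈ homog 𝒜 deg n :=
  fun w => Submodule.sum_mem _ fun k _ => hF k w

theorem doubleTau_mem {I : Type v} {deg : I → ℤ} (S : Submodule ℚ K) {w : List (Option I)}
    {f : NCSeries K (Option I)}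
    (hf : ∀ v, wordDeg (unitalDeg deg) v = wordDeg (unitalDeg deg) w + 1 → f v ∈ S) :
    doubleTau deg w f ∈ S := by
  induction w generalizing f with
  | nil => exact S.zero_mem
  | cons a w ih =>
    refine S.add_mem ?_ (sg_mul_mem _ _ (ih fun v hv => hf _ ?_))
    · split_ifs with h
      · subst h
        refine hf _ ?_
        simp [wordDeg, unitalDeg]
        ring
      · exact S.zero_mem
    · rw [← List.singleton_append, ← List.singleton_append (l := w), wordDeg_append,
        wordDeg_append, hv]
      ring

end Homogeneity

/-! ### The contraction of the cochains containing `τ` -/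

section Contraction

variable {K : Type u} [CommRing K] {I : Type v}

open Classical in
/-- The part of a series in words containing `τ`. -/
noncomputable def tauPart : NCSeries K (Option I) →ₗ[K] NCSeries K (Option I) :=
  diag fun w => if none ∈ w then 1 else 0

theorem tauPart_of_mem (f : NCSeries K (Option I)) {w : List (Option I)} (h : none ∈ w) :
    tauPart f w = f w := by
  rw [tauPart, diag_apply, if_pos h, one_mul]

theorem tauPart_of_notMem (f : NCSeries K (Option I)) {w : List (Option I)} (h : none ∉ w) :
    tauPart f w = 0 := by
  rw [tauPart, diag_apply, if_neg h, zero_mul]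

theorem rot_tauPart (deg : I → ℤ) {f : NCSeries K (Option I)} (h : rot (unitalDeg deg) f = f) :
    rot (unitalDeg deg) (tauPart f) = tauPart f := by
  rw [tauPart, rot_diag, h]
  intro a w
  congr 1
  rw [(List.perm_append_singleton a w).mem_iff]

variable [Algebra ℚ K]

/-- Division of the coefficient of each word by its number of cyclic runs of `τ`. -/
def divRuns : NCSeries K (Option I) →ₗ[K] NCSeries K (Option I) :=
  diag fun w => algebraMap ℚ K (cycRuns w : ℚ)⁻¹

theorem divRuns_apply (f : NCSeries K (Option I)) (w : List (Option I)) :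
    divRuns f w = algebraMap ℚ K (cycRuns w : ℚ)⁻¹ * f w := rfl

variable (deg : I → ℤ)

/-- The contracting homotopy: on rotation invariant series it is the transpose of `τ ↦ τ²` after
division by the number of runs of `τ`, up to sign and restricted to words containing some `t_i`. -/
def contraction (f : NCSeries K (Option I)) : NCSeries K (Option I) :=
  diag (fun w => if wt tWt w = 0 then 0 else -1)
    (divLen fun w => doubleTau deg w (divRuns (cycNorm (unitalDeg deg) f)))

theorem contraction_of_wt_eq_zero (f : NCSeries K (Option I)) {w : List (Option I)}
    (h : wt tWt w = 0) : contraction deg f w = 0 := by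
  rw [contraction, diag_apply, if_pos h, zero_mul]

theorem contraction_mem_homog {𝒜 : ℤ → Submodule ℚ K} {n : ℤ} {f : NCSeries K (Option I)}
    (hf : f ∈ homog 𝒜 (unitalDeg deg) (n + 1)) :
    contraction deg f ∈ homog 𝒜 (unitalDeg deg) n := by
  intro w
  rw [contraction, diag_apply]
  have h : (divLen fun w => doubleTau deg w (divRuns (cycNorm (unitalDeg deg) f))) w ∈
      𝒜 (n - wordDeg (unitalDeg deg) w) := by
    refine algebraMap_mul_mem _ _ (doubleTau_mem _ fun v hv => algebraMap_mul_mem _ _ ?_)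
    have := cycNorm_mem_homog hf v
    rwa [hv, add_sub_add_right_eq_sub] at this
  split_ifs
  · rw [zero_mul]; exact Submodule.zero_mem _
  · rw [neg_one_mul]; exact Submodule.neg_mem _ h

theorem cycNorm_contraction (f : NCSeries K (Option I)) {w : List (Option I)}
    (h : wt tWt w ≠ 0) : cycNorm (unitalDeg deg) (contraction deg f) w =
      - doubleTau deg w (divRuns (cycNorm (unitalDeg deg) f)) := by
  rw [contraction, cycNorm_diag, diag_apply, if_neg h, cycNorm_divLen_of_rot_eq, neg_one_mul]
  · refine rot_doubleTau deg ?_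
    rw [divRuns, rot_diag, rot_cycNorm]
    exact fun a w => by rw [cycRuns_rotate]
  · rfl
  · intro a w
    rw [wt_perm tWt (List.perm_append_singleton a w)]

variable {deg}

namespace AInfStructure

/-- The successive remainders of the perturbation argument. -/
def remainder {𝒜 : ℤ → Submodule ℚ K} (S : AInfStructure 𝒜 (unitalDeg deg))
    (f : NCSeries K (Option I)) : ℕ → NCSeries K (Option I)
  | 0 => f
  | n + 1 => remainder S f n - S.m (contraction deg (remainder S f n))

theorem remainder_mem_homog {𝒜 : ℤ → Submodule ℚ K} (S : AInfStructure 𝒜 (unitalDeg deg))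
    {n : ℤ} {f : NCSeries K (Option I)}
    (hf : f ∈ homog 𝒜 (unitalDeg deg) (n + 1)) (k : ℕ) :
    S.remainder f k ∈ homog 𝒜 (unitalDeg deg) (n + 1) := by
  induction k with
  | zero => exact hf
  | succ k ih => exact Submodule.sub_mem _ ih (S.degree_one _ _ (contraction_mem_homog deg ih))

end AInfStructure

variable {𝒜 : ℤ → Submodule ℚ K} [GradedAlgebra 𝒜] (hodd : ∀ n, Odd n → 𝒜 n = ⊥)
  (S : AInfStructure 𝒜 (unitalDeg deg)) (hunital : S.IsUnital) (hmin : S.IsMinimal)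

namespace AInfStructure

include hodd hunital hmin in
theorem cycNorm_m_eq_zero {f : NCSeries K (Option I)} {n : ℕ}
    (hf : ∀ u, wt tWt u < n → f u = 0) {w : List (Option I)} (hw : wt tWt w < n) :
    cycNorm (unitalDeg deg) (S.m f) w = 0 := by
  rw [cycNorm_congr (g := 0), map_zero]
  · rfl
  · exact fun u hu => S.m_apply_eq_zero hodd hunital hmin hf (by rwa [wt_perm tWt hu])

include hodd hunital hmin in
/-- To leading order in the number of letters `t_i`, `m` acts on rotation invariant series, at
words ending in some `t_i`, as the derivation `τ ↦ -τ²`. -/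
theorem cycNorm_m_leading {f : NCSeries K (Option I)} {n : ℕ}
    (hf : ∀ u, wt tWt u < n → f u = 0) {x : List (Option I)} {i : I}
    (hw : wt tWt (x ++ [some i]) ≤ n) :
    cycNorm (unitalDeg deg) (S.m f) (x ++ [some i]) =
      - mergeTau deg (x ++ [some i]) (cycNorm (unitalDeg deg) f) := by
  rw [cycNorm_congr (g := adTau deg f - tauSq deg f), map_sub, cycNorm_adTau, zero_sub,
    Pi.neg_apply, ← act_tauSq_concat, IsOddDerivation.act_cycNorm]
  exact fun u hu => S.m_apply_leading hodd hunital hmin hf (by rwa [wt_perm tWt hu])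

include hodd hunital hmin in
theorem cycNorm_m_incl (f : NCSeries K I) {w : List (Option I)} (hw : none ∈ w) :
    cycNorm (unitalDeg deg) (S.m (incl f)) w = 0 := by
  rw [S.m_incl hodd hunital hmin, map_add, cycNorm_adTau, add_zero, cycNorm_congr (g := 0),
    map_zero]
  · rfl
  · exact fun u hu => incl_of_mem _ (hu.mem_iff.2 hw)

include hodd hunital hmin in
/-- If `m f` is normalised modulo commutators, so is `m` of the part of `f` in words
containing `τ`. -/
theorem cycNorm_m_divLen_tauPart {f : NCSeries K (Option I)}
    (hf : ∀ w, none ∈ w → cycNorm (unitalDeg deg) (S.m f) w = 0) {w : List (Option I)}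
    (hw : none ∈ w) :
    cycNorm (unitalDeg deg) (S.m (divLen (tauPart (cycNorm (unitalDeg deg) f)))) w = 0 := by
  have hD := S.isOddDerivation hodd
  set φ := cycNorm (unitalDeg deg) f
  have hφ : rot (unitalDeg deg) φ = φ := rot_cycNorm _ f
  have hr := rot_tauPart deg hφ
  have h0 : φ [] = 0 := rfl
  have h1 : cycNorm (unitalDeg deg) (divLen (tauPart φ)) = tauPart φ :=
    cycNorm_divLen_of_rot_eq _ hr (by rw [tauPart, diag_apply, h0, mul_zero])
  have h2 : cycNorm (unitalDeg deg) (divLen (φ - tauPart φ)) = φ - tauPart φ :=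
    cycNorm_divLen_of_rot_eq _ (by rw [map_sub, hφ, hr])
      (by rw [Pi.sub_apply, tauPart, diag_apply, h0, mul_zero, sub_zero])
  have h3 : divLen (φ - tauPart φ) = incl fun v => divLen (φ - tauPart φ) (v.map some) :=
    eq_incl fun w hw => by
      rw [divLen_apply, Pi.sub_apply, tauPart_of_mem _ hw, sub_self, mul_zero]
  have h4 := hf w hw
  rw [← hD.act_cycNorm, h1]
  rw [← hD.act_cycNorm, show cycNorm (unitalDeg deg) f = tauPart φ + (φ - tauPart φ) by
    rw [add_sub_cancel], map_add, ← h2, hD.act_cycNorm, h3, Pi.add_apply,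
    S.cycNorm_m_incl hodd hunital hmin _ hw, add_zero] at h4
  exact h4

include hodd hunital hmin in
/-- One step of the perturbation argument: the contraction removes the terms of `f` that
contain `τ` and the least number `n` of letters `t_i`. -/
theorem cycNorm_sub_m_contraction {f : NCSeries K (Option I)} {n : ℕ} (hn : 1 ≤ n)
    (hf : ∀ w, none ∈ w → cycNorm (unitalDeg deg) (S.m f) w = 0)
    (hfn : ∀ w, none ∈ w → wt tWt w < n → cycNorm (unitalDeg deg) f w = 0)
    {w : List (Option I)} (hw : none ∈ w) (hwn : wt tWt w ≤ n) :
    cycNorm (unitalDeg deg) (f - S.m (contraction deg f)) w = 0 := by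
  have hg : ∀ u, wt tWt u < n → contraction deg f u = 0 := by
    intro u hu
    rw [contraction, diag_apply, divLen_apply, doubleTau_congr (g := 0), doubleTau_zero, mul_zero,
      mul_zero]
    intro x y h
    rw [divRuns_apply, hfn _ (by simp), mul_zero]
    · rfl
    · simpa [h, wt_append, wt_cons] using hu
  by_cases h0 : wt tWt w = 0
  · rw [map_sub, Pi.sub_apply, hfn w hw (by omega),
      S.cycNorm_m_eq_zero hodd hunital hmin hg (by omega), sub_zero]
  -- the derivation `τ ↦ τ²` annihilates the lowest order part of the norm of `f`
  have hc : ∀ x i, wt tWt (x ++ [some i]) ≤ n →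
      mergeTau deg (x ++ [some i]) (tauPart (cycNorm (unitalDeg deg) f)) = 0 := by
    intro x i hx
    by_cases hm : none ∈ x ++ [some i]
    · have h1 := S.cycNorm_m_divLen_tauPart hodd hunital hmin hf hm
      rw [S.cycNorm_m_leading hodd hunital hmin (n := n) _ hx, cycNorm_divLen_of_rot_eq,
        neg_eq_zero] at h1
      · exact h1
      · exact rot_tauPart deg (rot_cycNorm _ f)
      · exact tauPart_of_notMem _ (by simp)
      · intro u hu
        rw [divLen_apply]
        by_cases hu' : none ∈ u
        · rw [tauPart_of_mem _ hu', hfn u hu' hu, mul_zero]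
        · rw [tauPart_of_notMem _ hu', mul_zero]
    · rw [mergeTau_congr (g := 0), mergeTau_zero]
      intro a b h
      rw [h] at hm
      simp at hm
  have hψ : ∀ x i, wt tWt (x ++ [some i]) ≤ n →
      mergeTau deg (x ++ [some i]) (divRuns (cycNorm (unitalDeg deg) f)) = 0 := by
    intro x i hx
    rw [mergeTau_congr (g := algebraMap ℚ K (numRuns (x ++ [some i]) : ℚ)⁻¹ •
        tauPart (cycNorm (unitalDeg deg) f)),
      mergeTau_smul, hc x i hx, mul_zero]
    intro a b h
    obtain ⟨z, hz⟩ := exists_concat_of_append_none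
      (show x ++ [some i] = (a ++ [none]) ++ none :: b by simpa using h)
    rw [divRuns_apply, Pi.smul_apply, tauPart_of_mem _ (by simp), h, numRuns_merge, hz,
      ← List.cons_append, ← List.append_assoc, cycRuns_eq_numRuns]
    rfl
  have key : ∀ x i, none ∈ x ++ [some i] → wt tWt (x ++ [some i]) ≤ n →
      cycNorm (unitalDeg deg) (f - S.m (contraction deg f)) (x ++ [some i]) = 0 := by
    intro x i hm hx
    have h1 := mergeTau_doubleTau deg (x ++ [some i]) (divRuns (cycNorm (unitalDeg deg) f))
    have h2 : doubleTau deg (x ++ [some i])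
        (fun v => mergeTau deg v (divRuns (cycNorm (unitalDeg deg) f))) = 0 := by
      rw [doubleTau_congr (g := 0), doubleTau_zero]
      intro a b h
      obtain ⟨z, hz⟩ := exists_concat_of_append_none h
      have h3 := hψ (a ++ none :: none :: z) i (by
        rw [h, hz] at hx
        simpa [wt_append, wt_cons] using hx)
      rw [hz]
      simpa using h3
    have h3 : mergeTau deg (x ++ [some i]) (cycNorm (unitalDeg deg) (contraction deg f)) =
        - mergeTau deg (x ++ [some i])
          (fun v => doubleTau deg v (divRuns (cycNorm (unitalDeg deg) f))) := by
      rw [← neg_one_mul, ← mergeTau_smul]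
      refine mergeTau_congr deg fun a b h => ?_
      rw [cycNorm_contraction, Pi.smul_apply, neg_one_smul]
      have := congrArg (wt tWt) h
      simp only [wt_append, wt_cons, wt_nil, tWt_some, tWt_none] at this ⊢
      omega
    have h4 : (numRuns (x ++ [some i]) : K) * divRuns (cycNorm (unitalDeg deg) f)
        (x ++ [some i]) = cycNorm (unitalDeg deg) f (x ++ [some i]) := by
      rw [divRuns_apply, cycRuns_eq_numRuns, ← mul_assoc, mul_comm (numRuns _ : K),
        rat_inv_mul_cast (numRuns_ne_zero hm), one_mul]
    rw [map_sub, Pi.sub_apply, S.cycNorm_m_leading hodd hunital hmin hg hx, h3, neg_neg,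
      ← h4, ← h1, h2, add_zero, sub_self]
  -- rotate `w` so that it ends in some `t_i`
  obtain ⟨i, hi⟩ : ∃ i, some i ∈ w := by
    by_contra h
    push Not at h
    refine h0 (List.sum_eq_zero fun k hk => ?_)
    obtain ⟨a, ha, rfl⟩ := List.mem_map.1 hk
    rcases a with _ | i
    · rfl
    · exact absurd ha (h i)
  obtain ⟨x, y, rfl⟩ := List.append_of_mem hi
  have hp : (y ++ (x ++ [some i])).Perm (x ++ some i :: y) := by
    rw [show x ++ some i :: y = (x ++ [some i]) ++ y by simp]
    exact List.perm_append_comm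
  rw [show x ++ some i :: y = (x ++ [some i]) ++ y by simp, eq_of_rot_eq _ (rot_cycNorm _ _),
    ← List.append_assoc, key, mul_zero]
  · rw [List.append_assoc]; exact hp.mem_iff.2 hw
  · rw [List.append_assoc, wt_perm tWt hp]; exact hwn

include hodd hunital hmin in
/-- The cochains containing both `τ` and some `t_i` form an acyclic complex. -/
theorem exists_primitive {n : ℤ} {f : NCSeries K (Option I)}
    (hf : f ∈ homog 𝒜 (unitalDeg deg) (n + 1))
    (hm : ∀ w, none ∈ w → cycNorm (unitalDeg deg) (S.m f) w = 0)
    (h0 : ∀ w, none ∈ w → wt tWt w = 0 → cycNorm (unitalDeg deg) f w = 0) :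
    ∃ g ∈ homog 𝒜 (unitalDeg deg) n, (∀ w, wt tWt w = 0 → g w = 0) ∧
      ∀ w, none ∈ w → cycNorm (unitalDeg deg) (f - S.m g) w = 0 := by
  have hk : ∀ k, (∀ w, none ∈ w → cycNorm (unitalDeg deg) (S.m (S.remainder f k)) w = 0) ∧
      ∀ w, none ∈ w → wt tWt w < k + 1 → cycNorm (unitalDeg deg) (S.remainder f k) w = 0 := by
    intro k
    induction k with
    | zero => exact ⟨hm, fun w hw hw0 => h0 w hw (by omega)⟩
    | succ k ih =>
      refine ⟨fun w hw => ?_, fun w hw hwk => ?_⟩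
      · rw [remainder, map_sub, S.sq_zero, sub_zero]
        exact ih.1 w hw
      · exact S.cycNorm_sub_m_contraction hodd hunital hmin (by omega) ih.1 ih.2 hw (by omega)
  have hF : ∀ k w, wt tWt w < k → contraction deg (S.remainder f k) w = 0 := by
    intro k w hw
    rw [contraction, diag_apply, divLen_apply, doubleTau_congr (g := 0), doubleTau_zero, mul_zero,
      mul_zero]
    intro x y h
    rw [divRuns_apply, (hk k).2 _ (by simp), mul_zero]
    · rfl
    · rw [h] at hw
      simp only [wt_append, wt_cons, tWt_none] at hw ⊢
      omega
  refine ⟨locSum (wt tWt) fun k => contraction deg (S.remainder f k),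
    locSum_mem_homog fun k => contraction_mem_homog deg (S.remainder_mem_homog hf k), ?_, ?_⟩
  · exact fun w hw => Finset.sum_eq_zero fun k _ => contraction_of_wt_eq_zero deg _ hw
  · intro w hw
    obtain ⟨n₀, hn₀⟩ := ((isContinuous_cycNorm (unitalDeg deg)).comp S.continuous).map_locSum hF w
    have hsum : ∀ n, ∑ k ∈ Finset.range n,
        cycNorm (unitalDeg deg) (S.m (contraction deg (S.remainder f k))) w =
        cycNorm (unitalDeg deg) f w - cycNorm (unitalDeg deg) (S.remainder f n) w := by
      intro n
      induction n with
      | zero => simp [remainder]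
      | succ n ih =>
        rw [Finset.sum_range_succ, ih, remainder, map_sub, Pi.sub_apply]
        ring
    have h1 := hn₀ (max n₀ (wt tWt w)) (le_max_left _ _)
    simp only [LinearMap.comp_apply] at h1
    rw [hsum, (hk _).2 w hw (by omega), sub_zero] at h1
    rw [map_sub, Pi.sub_apply, h1, sub_self]

end AInfStructure

end Contraction

/-! ### The long exact sequence of a subcomplex -/

section LongExact

variable {X Y : Type*} [AddCommGroup X] [Module ℚ X] [AddCommGroup Y] [Module ℚ Y]

theorem Cohomology.mk_eq_mk_iff {d : X →ₗ[ℚ] X} {C : ℤ → Submodule ℚ X} {n : ℤ} {x y : X}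
    (hx : x ∈ cocycles d C n) (hy : y ∈ cocycles d C n) :
    Cohomology.mk x hx = Cohomology.mk y hy ↔ x - y ∈ coboundaries d C n := by
  rw [Cohomology.mk, Cohomology.mk, Submodule.Quotient.eq]
  rfl

theorem Cohomology.mk_eq_zero_iff {d : X →ₗ[ℚ] X} {C : ℤ → Submodule ℚ X} {n : ℤ} {x : X}
    (hx : x ∈ cocycles d C n) : Cohomology.mk x hx = 0 ↔ x ∈ coboundaries d C n := by
  rw [Cohomology.mk, Submodule.Quotient.mk_eq_zero]
  rfl

theorem Cohomology.exists_mk {d : X →ₗ[ℚ] X} {C : ℤ → Submodule ℚ X} {n : ℤ}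
    (a : Cohomology d C n) : ∃ x, ∃ hx : x ∈ cocycles d C n, Cohomology.mk x hx = a := by
  obtain ⟨⟨x, hx⟩, rfl⟩ := Submodule.Quotient.mk_surjective _ a
  exact ⟨x, hx, rfl⟩

theorem mem_coboundaries_succ {d : X →ₗ[ℚ] X} {C : ℤ → Submodule ℚ X} {n : ℤ} {x : X} :
    x ∈ coboundaries d C (n + 1) ↔ ∃ u ∈ C n, d u = x := by
  rw [coboundaries, add_sub_cancel_right]
  rfl

theorem exists_isInducedBy {d : X →ₗ[ℚ] X} {C : ℤ → Submodule ℚ X} {d' : Y →ₗ[ℚ] Y}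
    {C' : ℤ → Submodule ℚ Y} (φ : X →ₗ[ℚ] Y) (hC : ∀ n, ∀ x ∈ C n, φ x ∈ C' n)
    (hd : ∀ x, φ (d x) = d' (φ x)) (n : ℤ) :
    ∃ F : Cohomology d C n →ₗ[ℚ] Cohomology d' C' n, IsInducedBy F φ := by
  have hZ : ∀ x ∈ cocycles d C n, φ x ∈ cocycles d' C' n := by
    rintro x ⟨hx, hx'⟩
    refine ⟨hC n x hx, ?_⟩
    rw [SetLike.mem_coe, LinearMap.mem_ker] at hx' ⊢
    rw [← hd, hx', map_zero]
  refine ⟨Submodule.mapQ _ _ (φ.restrict hZ) ?_, fun x hx => ⟨hZ x hx, rfl⟩⟩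
  rintro ⟨x, hx⟩ ⟨u, hu, hux⟩
  exact ⟨φ u, hC _ u hu, by rw [← hd, hux]; rfl⟩

/-- The data of a complex `(C, d)` with a subcomplex `N` and a surjection `π` to a complex
`(C', d')` which vanishes on `N` and whose kernel modulo `N` is acyclic. -/
structure ExactData (d : X →ₗ[ℚ] X) (C N : ℤ → Submodule ℚ X) (d' : Y →ₗ[ℚ] Y)
    (C' : ℤ → Submodule ℚ Y) (π : X →ₗ[ℚ] Y) : Prop where
  le : ∀ n, N n ≤ C n
  d_mem : ∀ n, ∀ x ∈ C n, d x ∈ C (n + 1)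
  d_mem_sub : ∀ n, ∀ x ∈ N n, d x ∈ N (n + 1)
  d_d : ∀ x, d (d x) = 0
  map_mem : ∀ n, ∀ x ∈ C n, π x ∈ C' n
  map_d : ∀ x, π (d x) = d' (π x)
  map_of_mem : ∀ n, ∀ x ∈ N n, π x = 0
  surj : ∀ n, ∀ y ∈ C' n, ∃ x ∈ C n, π x = y
  acyclic : ∀ n, ∀ x ∈ C (n + 1), π x = 0 → d x ∈ N (n + 1 + 1) →
    ∃ y ∈ C n, π y = 0 ∧ x - d y ∈ N (n + 1)

namespace ExactData

variable {d : X →ₗ[ℚ] X} {C N : ℤ → Submodule ℚ X} {d' : Y →ₗ[ℚ] Y} {C' : ℤ → Submodule ℚ Y}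
  {π : X →ₗ[ℚ] Y} (E : ExactData d C N d' C' π)

include E

theorem acyclic' {n : ℤ} {x : X} (hx : x ∈ C n) (h0 : π x = 0) (hd : d x ∈ N (n + 1)) :
    ∃ y ∈ C (n - 1), π y = 0 ∧ x - d y ∈ N n := by
  obtain ⟨k, rfl⟩ : ∃ k, n = k + 1 := ⟨n - 1, by ring⟩
  rw [add_sub_cancel_right]
  exact E.acyclic k x hx h0 hd

theorem exists_lift {n : ℤ} {z : Y} (hz : z ∈ cocycles d' C' n) :
    ∃ x ∈ C n, π x = z ∧ d x ∈ N (n + 1) := by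
  obtain ⟨x, hx, rfl⟩ := E.surj n z hz.1
  have hz' : d' (π x) = 0 := LinearMap.mem_ker.1 hz.2
  obtain ⟨y, hy, hy0, hyN⟩ := E.acyclic n (d x) (E.d_mem n x hx) (by rw [E.map_d, hz'])
    (by rw [E.d_d]; exact Submodule.zero_mem _)
  exact ⟨x - y, Submodule.sub_mem _ hx hy, by rw [map_sub, hy0, sub_zero],
    by rwa [map_sub]⟩

theorem map_cocycle {n : ℤ} {x : X} (hx : x ∈ C n) (hd : d x ∈ N (n + 1)) :
    π x ∈ cocycles d' C' n :=
  ⟨E.map_mem n x hx, by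
    rw [SetLike.mem_coe, LinearMap.mem_ker, ← E.map_d, E.map_of_mem _ _ hd]⟩

theorem d_cocycle {n : ℤ} {x : X} (hd : d x ∈ N n) : d x ∈ cocycles d N n :=
  ⟨hd, LinearMap.mem_ker.2 (E.d_d x)⟩

/-- The class of `d x` depends only on the class of `π x`. -/
theorem d_mem_coboundaries {n : ℤ} {x : X} (hx : x ∈ C n) (hd : d x ∈ N (n + 1))
    (hb : π x ∈ coboundaries d' C' n) : d x ∈ coboundaries d N (n + 1) := by
  obtain ⟨w, hw, hwx⟩ := hb
  obtain ⟨v, hv, rfl⟩ := E.surj _ w hw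
  have hdv : d v ∈ C n := by
    have := E.d_mem _ v hv
    rwa [sub_add_cancel] at this
  obtain ⟨y, hy, hy0, hyN⟩ := E.acyclic' (n := n) (x := x - d v) (Submodule.sub_mem _ hx hdv)
    (by rw [map_sub, E.map_d, hwx, sub_self]) (by rwa [map_sub, E.d_d, sub_zero])
  refine mem_coboundaries_succ.2 ⟨_, hyN, ?_⟩
  rw [map_sub, map_sub, E.d_d, E.d_d, sub_zero, sub_zero]

theorem exists_connecting (n : ℤ) :
    ∃ δ : Cohomology d' C' n →ₗ[ℚ] Cohomology d N (n + 1), ∀ (x : X) (hx : x ∈ C n)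
      (hd : d x ∈ N (n + 1)), δ (Cohomology.mk (π x) (E.map_cocycle hx hd)) =
        Cohomology.mk (d x) (E.d_cocycle hd) := by
  choose l hlC hlπ hlN using fun z : cocycles d' C' n => E.exists_lift z.2
  have huniq : ∀ (z : cocycles d' C' n) (x : X), x ∈ C n → ∀ hd : d x ∈ N (n + 1),
      π x - z.1 ∈ coboundaries d' C' n →
      Cohomology.mk (d (l z)) (E.d_cocycle (hlN z)) = Cohomology.mk (d x) (E.d_cocycle hd) := by
    intro z x hx hd hb
    rw [Cohomology.mk_eq_mk_iff, ← map_sub]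
    refine E.d_mem_coboundaries (Submodule.sub_mem _ (hlC z) hx) ?_ ?_
    · rw [map_sub]; exact Submodule.sub_mem _ (hlN z) hd
    · rw [map_sub, hlπ, ← neg_sub]; exact Submodule.neg_mem _ hb
  let f : cocycles d' C' n →ₗ[ℚ] Cohomology d N (n + 1) :=
    { toFun := fun z => Cohomology.mk (d (l z)) (E.d_cocycle (hlN z))
      map_add' := fun z w => by
        refine (huniq (z + w) (l z + l w) (Submodule.add_mem _ (hlC z) (hlC w))
          (by rw [map_add]; exact Submodule.add_mem _ (hlN z) (hlN w)) ?_).trans ?_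
        · rw [map_add, hlπ, hlπ, Submodule.coe_add, sub_self]; exact Submodule.zero_mem _
        · simp only [map_add]; rfl
      map_smul' := fun c z => by
        refine (huniq (c • z) (c • l z) (Submodule.smul_mem _ _ (hlC z))
          (by rw [map_smul]; exact Submodule.smul_mem _ _ (hlN z)) ?_).trans ?_
        · rw [map_smul, hlπ, Submodule.coe_smul, sub_self]; exact Submodule.zero_mem _
        · simp only [map_smul]; rfl }
  refine ⟨Submodule.liftQ _ f fun z hz => ?_, fun x hx hd => ?_⟩
  · rw [LinearMap.mem_ker]
    refine (Cohomology.mk_eq_zero_iff _).2 (E.d_mem_coboundaries (hlC z) (hlN z) ?_)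
    rw [hlπ]; exact hz
  · refine huniq ⟨π x, E.map_cocycle hx hd⟩ x hx hd ?_
    rw [sub_self]; exact Submodule.zero_mem _

/-- The long exact sequence, with its maps characterised on cochains. -/
theorem exists_longExact : ∃ (ι : ∀ n, Cohomology d N n →ₗ[ℚ] Cohomology d C n)
    (p : ∀ n, Cohomology d C n →ₗ[ℚ] Cohomology d' C' n)
    (δ : ∀ n, Cohomology d' C' n →ₗ[ℚ] Cohomology d N (n + 1)),
    (∀ n, IsInducedBy (ι n) LinearMap.id) ∧ (∀ n, IsInducedBy (p n) π) ∧
    (∀ n, ∀ x ∈ C n, d x ∈ N (n + 1) → ∃ (hx : π x ∈ cocycles d' C' n)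
      (hy : d x ∈ cocycles d N (n + 1)), δ n (Cohomology.mk _ hx) = Cohomology.mk _ hy) ∧
    (∀ n, Function.Exact (ι n) (p n)) ∧ (∀ n, Function.Exact (p n) (δ n)) ∧
    (∀ n, Function.Exact (δ n) (ι (n + 1))) ∧
    ((∀ n, ∀ z ∈ cocycles d' C' n, ∃ x ∈ C n, π x = z ∧ d x = 0) → ∀ n, δ n = 0) := by
  choose ι hι using fun n => exists_isInducedBy (d := d) (C := N) (d' := d) (C' := C)
    LinearMap.id (fun n x hx => E.le n hx) (fun _ => rfl) n
  choose p hp using fun n => exists_isInducedBy (d := d) (C := C) (d' := d') (C' := C')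
    π E.map_mem E.map_d n
  choose δ hδ using fun n => E.exists_connecting n
  refine ⟨ι, p, δ, hι, hp, fun n x hx hd => ⟨_, _, hδ n x hx hd⟩, fun n a => ?_, fun n a => ?_,
    fun n a => ?_, fun h n => ?_⟩
  · obtain ⟨x, hx, rfl⟩ := a.exists_mk
    obtain ⟨hy, hpx⟩ := hp n x hx
    rw [hpx, Cohomology.mk_eq_zero_iff]
    have hdx : d x = 0 := LinearMap.mem_ker.1 hx.2
    constructor
    · rintro ⟨w, hw, hwx⟩
      obtain ⟨v, hv, rfl⟩ := E.surj _ w hw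
      have hdv : d v ∈ C n := by
        have := E.d_mem _ v hv
        rwa [sub_add_cancel] at this
      obtain ⟨y, hyC, hy0, hyN⟩ := E.acyclic' (n := n) (x := x - d v)
        (Submodule.sub_mem _ hx.1 hdv) (by rw [map_sub, E.map_d, hwx, sub_self])
        (by rw [map_sub, E.d_d, hdx, sub_zero]; exact Submodule.zero_mem _)
      have hz : x - d v - d y ∈ cocycles d N n := ⟨hyN, LinearMap.mem_ker.2 (by
        rw [map_sub, map_sub, E.d_d, E.d_d, hdx, sub_zero, sub_zero])⟩
      obtain ⟨hz', e⟩ := hι n _ hz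
      refine ⟨Cohomology.mk _ hz, ?_⟩
      rw [e, Cohomology.mk_eq_mk_iff]
      refine ⟨-(v + y), Submodule.neg_mem _ (Submodule.add_mem _ hv hyC), ?_⟩
      rw [map_neg, map_add, LinearMap.id_apply]
      abel
    · rintro ⟨b, hb⟩
      obtain ⟨z, hz, rfl⟩ := b.exists_mk
      obtain ⟨hz', e⟩ := hι n z hz
      rw [e, Cohomology.mk_eq_mk_iff] at hb
      obtain ⟨u, hu, hux⟩ := hb
      refine ⟨-π u, Submodule.neg_mem _ (E.map_mem _ u hu), ?_⟩
      rw [map_neg, ← E.map_d, hux, map_sub, LinearMap.id_apply, E.map_of_mem n z hz.1, zero_sub,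
        neg_neg]
  · obtain ⟨z, hz, rfl⟩ := a.exists_mk
    obtain ⟨x, hx, rfl, hd⟩ := E.exists_lift hz
    rw [hδ n x hx hd, Cohomology.mk_eq_zero_iff, mem_coboundaries_succ]
    constructor
    · rintro ⟨u, hu, hux⟩
      have hc : x - u ∈ cocycles d C n := ⟨Submodule.sub_mem _ hx (E.le n hu),
        LinearMap.mem_ker.2 (by rw [map_sub, hux, sub_self])⟩
      obtain ⟨h', e⟩ := hp n _ hc
      refine ⟨Cohomology.mk _ hc, ?_⟩
      rw [e, Cohomology.mk_eq_mk_iff, map_sub, E.map_of_mem n u hu, sub_zero, sub_self]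
      exact Submodule.zero_mem _
    · rintro ⟨b, hb⟩
      obtain ⟨c, hc, rfl⟩ := b.exists_mk
      obtain ⟨h', e⟩ := hp n c hc
      have hdc : d c = 0 := LinearMap.mem_ker.1 hc.2
      rw [e, Cohomology.mk_eq_mk_iff, ← map_sub] at hb
      have := E.d_mem_coboundaries (x := c - x) (Submodule.sub_mem _ hc.1 hx)
        (by rw [map_sub, hdc, zero_sub]; exact Submodule.neg_mem _ hd) hb
      rw [map_sub, hdc, zero_sub] at this
      exact mem_coboundaries_succ.1 (neg_neg (d x) ▸ Submodule.neg_mem _ this)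
  · obtain ⟨z, hz, rfl⟩ := a.exists_mk
    obtain ⟨hz', e⟩ := hι (n + 1) z hz
    rw [e, Cohomology.mk_eq_zero_iff, mem_coboundaries_succ, LinearMap.id_apply]
    constructor
    · rintro ⟨x, hx, rfl⟩
      exact ⟨_, hδ n x hx hz.1⟩
    · rintro ⟨b, hb⟩
      obtain ⟨y, hy, rfl⟩ := b.exists_mk
      obtain ⟨x, hx, rfl, hd⟩ := E.exists_lift hy
      rw [hδ n x hx hd, Cohomology.mk_eq_mk_iff, mem_coboundaries_succ] at hb
      obtain ⟨u, hu, hux⟩ := hb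
      exact ⟨x - u, Submodule.sub_mem _ hx (E.le n hu), by rw [map_sub, hux, sub_sub_cancel]⟩
  · ext1
    ext ⟨z, hz⟩
    obtain ⟨x, hx, rfl, hd⟩ := h n z hz
    have hd' : d x ∈ N (n + 1) := by rw [hd]; exact Submodule.zero_mem _
    refine (hδ n x hx hd').trans ((Cohomology.mk_eq_zero_iff _).2 ?_)
    rw [hd]
    exact Submodule.zero_mem _

end ExactData

end LongExact

/-! ### The normalised subcomplex and its quotient -/

section Normalised

variable {K : Type u} [CommRing K] {I : Type v} {deg : I → ℤ}

theorem wordDeg_map_some (v : List I) : wordDeg (unitalDeg deg) (v.map some) = wordDeg deg v := by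
  simp [wordDeg, unitalDeg, Function.comp_def]

theorem par_map_some (v : List I) : par (unitalDeg deg) (v.map some) = par deg v := by
  rw [par, wordDeg_map_some]; rfl

theorem rot_pow_incl (f : NCSeries K I) (k : ℕ) (v : List I) :
    (rot (unitalDeg deg) ^ k) (incl f) (v.map some) = (rot deg ^ k) f v := by
  induction k generalizing v with
  | zero => exact incl_map_some f v
  | succ k ih =>
    rw [pow_succ', pow_succ', Module.End.mul_apply, Module.End.mul_apply]
    rcases v with _ | ⟨a, v⟩
    · exact ih []
    · have h := par_map_some (deg := deg) [a]
      rw [List.map_singleton] at h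
      rw [List.map_cons, rot_cons, rot_cons, ← List.map_singleton, ← List.map_append, ih,
        List.map_singleton, h, par_map_some]

theorem wordDeg_replicate_none (k : ℕ) :
    wordDeg (unitalDeg deg) (List.replicate k none) = k := by
  simp [wordDeg, unitalDeg]

theorem wordDeg_unit (w : List Unit) : wordDeg (fun _ : Unit => 0) w = w.length := by
  simp [wordDeg]

theorem restrictUnit_apply (f : NCSeries K (Option I)) (w : List Unit) :
    restrictUnit f w = f (List.replicate w.length none) := by
  change f (w.map fun _ => none) = _
  rw [List.map_const']

theorem eq_replicate_of_wt_eq_zero {w : List (Option I)} (h : wt tWt w = 0) :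
    w = List.replicate w.length none := by
  refine List.eq_replicate_of_mem fun a ha => ?_
  rcases a with _ | i
  · rfl
  · obtain ⟨x, y, rfl⟩ := List.append_of_mem ha
    simp [wt_append, wt_cons] at h

theorem wt_replicate_none (n : ℕ) : wt tWt (List.replicate n (none : Option I)) = 0 := by
  simp [wt]

theorem rot_pow_restrictUnit (f : NCSeries K (Option I)) (k : ℕ) (w : List Unit) :
    (rot (unitalDeg deg) ^ k) f (List.replicate w.length none) =
      (rot (fun _ : Unit => 0) ^ k) (restrictUnit f) w := by
  induction k generalizing w with
  | zero => exact (restrictUnit_apply f w).symm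
  | succ k ih =>
    rw [pow_succ', pow_succ', Module.End.mul_apply, Module.End.mul_apply]
    rcases w with _ | ⟨a, w⟩
    · exact ih []
    · have h := ih (w ++ [a])
      rw [List.length_append, List.length_singleton, List.replicate_succ'] at h
      have hp : par (fun _ : Unit => 0) w = w.length := by rw [par, wordDeg_unit]; simp
      have hp' : par (fun _ : Unit => 0) [a] = 1 := by simp [par, wordDeg]
      rw [List.length_cons, List.replicate_succ, rot_cons, rot_cons, h, par_none,
        par_replicate_none, hp, hp']

theorem cycNorm_restrictUnit (f : NCSeries K (Option I)) (n : ℕ) :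
    cycNorm (unitalDeg deg) f (List.replicate n none) =
      cycNorm (fun _ : Unit => 0) (restrictUnit f) (List.replicate n ()) := by
  rw [cycNorm_apply, cycNorm_apply, List.length_replicate, List.length_replicate]
  refine Finset.sum_congr rfl fun k _ => ?_
  rw [← rot_pow_restrictUnit (deg := deg), List.length_replicate]

open Classical in
/-- The extension of a series in `τ` by zero. -/
noncomputable def extendUnit (I : Type v) (g : NCSeries K Unit) : NCSeries K (Option I) :=
  fun w => if w = List.replicate w.length none then g (List.replicate w.length ()) else 0

theorem restrictUnit_extendUnit (g : NCSeries K Unit) : restrictUnit (extendUnit I g) = g := by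
  ext w
  rw [restrictUnit_apply, extendUnit, if_pos (by simp), List.length_replicate]
  congr 1
  exact (List.eq_replicate_of_mem fun _ _ => rfl).symm

variable [Algebra ℚ K] {𝒜 : ℤ → Submodule ℚ K}

theorem cls_eq_cls_iff {J : Type v} {deg : J → ℤ} {f g : NCSeries K J} :
    cls 𝒜 deg f = cls 𝒜 deg g ↔ f - g ∈ commutators 𝒜 deg :=
  Submodule.Quotient.eq _

theorem cls_eq_zero_iff {J : Type v} {deg : J → ℤ} {f : NCSeries K J} :
    cls 𝒜 deg f = 0 ↔ f ∈ commutators 𝒜 deg :=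
  Submodule.Quotient.mk_eq_zero _

theorem mem_cyclicCochains_iff {J : Type v} {deg : J → ℤ} {n : ℤ} {x : DRZero 𝒜 deg} :
    x ∈ cyclicCochains 𝒜 deg n ↔ ∃ f ∈ homog 𝒜 deg (n + 1), f [] = 0 ∧ cls 𝒜 deg f = x :=
  ⟨fun ⟨f, ⟨h1, h2⟩, h3⟩ => ⟨f, h1, h2, h3⟩, fun ⟨f, h1, h2, h3⟩ => ⟨f, ⟨h1, h2⟩, h3⟩⟩

theorem mem_normalisedCochains_iff {n : ℤ} {x : DRZero 𝒜 (unitalDeg deg)} :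
    x ∈ normalisedCochains 𝒜 deg n ↔
      ∃ f ∈ homog 𝒜 deg (n + 1), f [] = 0 ∧ cls 𝒜 (unitalDeg deg) (incl f) = x :=
  ⟨fun ⟨f, ⟨h1, h2⟩, h3⟩ => ⟨f, h1, h2, h3⟩, fun ⟨f, h1, h2, h3⟩ => ⟨f, ⟨h1, h2⟩, h3⟩⟩

theorem incl_mem_homog {n : ℤ} {f : NCSeries K I} (hf : f ∈ homog 𝒜 deg n) :
    incl f ∈ homog 𝒜 (unitalDeg deg) n := by
  intro w
  by_cases h : none ∈ w
  · rw [incl_of_mem f h]; exact Submodule.zero_mem _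
  · obtain ⟨v, rfl⟩ := exists_map_some h
    rw [incl_map_some, wordDeg_map_some]
    exact hf v

theorem restrict_mem_homog {n : ℤ} {f : NCSeries K (Option I)}
    (hf : f ∈ homog 𝒜 (unitalDeg deg) n) : (fun v => f (v.map some)) ∈ homog 𝒜 deg n := by
  intro v
  have := hf (v.map some)
  rwa [wordDeg_map_some] at this

theorem restrictUnit_mem_homog {n : ℤ} {f : NCSeries K (Option I)}
    (hf : f ∈ homog 𝒜 (unitalDeg deg) n) : restrictUnit f ∈ homog 𝒜 (fun _ : Unit => 0) n := by
  intro w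
  have := hf (List.replicate w.length none)
  rw [restrictUnit_apply]
  rwa [wordDeg_replicate_none, ← wordDeg_unit] at this

theorem extendUnit_mem_homog {n : ℤ} {g : NCSeries K Unit}
    (hg : g ∈ homog 𝒜 (fun _ : Unit => 0) n) : extendUnit I g ∈ homog 𝒜 (unitalDeg deg) n := by
  intro w
  rw [extendUnit]
  split_ifs with h
  · have := hg (List.replicate w.length ())
    rwa [wordDeg_unit, List.length_replicate, ← wordDeg_replicate_none (deg := deg), ← h] at this
  · exact Submodule.zero_mem _

theorem piMap_cls (f : NCSeries K (Option I)) :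
    piMap 𝒜 deg (cls 𝒜 (unitalDeg deg) f) = cls 𝒜 (fun _ : Unit => 0) (restrictUnit f) := rfl

theorem AInfStructure.lieOp_cls {J : Type v} {deg : J → ℤ} (S : AInfStructure 𝒜 deg)
    (f : NCSeries K J) : S.lieOp (cls 𝒜 deg f) = cls 𝒜 deg (S.m f) := rfl

theorem exists_cls {J : Type v} {deg : J → ℤ} (x : DRZero 𝒜 deg) : ∃ f, cls 𝒜 deg f = x :=
  Submodule.Quotient.mk_surjective _ x

variable [GradedAlgebra 𝒜] (hodd : ∀ n, Odd n → 𝒜 n = ⊥)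

include hodd in
/-- The map `DR⁰(T̂(Σ V̄^*)) → DR⁰(T̂(Σ V^*))` is injective: both sides embed into rotation
invariant series by the norm. -/
theorem mem_commutators_of_incl {f : NCSeries K I}
    (h : incl f ∈ commutators 𝒜 (unitalDeg deg)) : f ∈ commutators 𝒜 deg := by
  rw [mem_commutators_iff _ _ hodd] at h ⊢
  refine ⟨(incl_map_some f []).symm.trans h.1, ?_⟩
  ext v
  have h2 := congrFun h.2 (v.map some)
  rw [cycNorm_apply, List.length_map] at h2
  rw [cycNorm_apply]
  exact (Finset.sum_congr rfl fun k _ => (rot_pow_incl f k v).symm).trans h2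

/-- The normalised cochains form a subcomplex with quotient quasi-isomorphic to the cochains of the
ground ring. -/
theorem exactData (S : AInfStructure 𝒜 (unitalDeg deg)) (hunital : S.IsUnital)
    (hmin : S.IsMinimal) : ExactData S.lieOp (cyclicCochains 𝒜 (unitalDeg deg))
      (normalisedCochains 𝒜 deg) (groundStructure hodd).lieOp
      (cyclicCochains 𝒜 (fun _ : Unit => 0)) (piMap 𝒜 deg) where
  le n x hx := by
    obtain ⟨f, hf, h0, rfl⟩ := mem_normalisedCochains_iff.1 hx
    exact mem_cyclicCochains_iff.2
      ⟨incl f, incl_mem_homog hf, (incl_map_some f []).trans h0, rfl⟩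
  d_mem := S.lieOp_mem
  d_mem_sub n x hx := by
    obtain ⟨f, hf, h0, rfl⟩ := mem_normalisedCochains_iff.1 hx
    refine mem_normalisedCochains_iff.2 ⟨S.restrictM f,
      restrict_mem_homog (S.degree_one _ _ (incl_mem_homog hf)), S.m_apply_nil _, ?_⟩
    rw [S.lieOp_cls, S.m_incl hodd hunital hmin, map_add, left_eq_add, cls_eq_zero_iff,
      mem_commutators_iff _ _ hodd]
    refine ⟨?_, cycNorm_adTau deg _⟩
    exact adTau_apply_eq_zero deg fun u hu => absurd hu.length_eq (Nat.succ_ne_zero _)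
  d_d := S.lieOp_lieOp
  map_mem n x hx := by
    obtain ⟨f, hf, h0, rfl⟩ := mem_cyclicCochains_iff.1 hx
    exact mem_cyclicCochains_iff.2 ⟨restrictUnit f, restrictUnit_mem_homog hf, h0, rfl⟩
  map_d x := by
    obtain ⟨f, rfl⟩ := exists_cls x
    rw [S.lieOp_cls, piMap_cls, S.restrictUnit_m hodd hunital hmin]
    rfl
  map_of_mem n x hx := by
    obtain ⟨f, hf, h0, rfl⟩ := mem_normalisedCochains_iff.1 hx
    rw [piMap_cls, show restrictUnit (incl f) = 0 from ?_, map_zero]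
    ext w
    rcases w with _ | ⟨a, w⟩
    · exact (incl_map_some f []).trans h0
    · exact incl_of_mem f (List.mem_cons_self (a := none) (l := w.map fun _ => none))
  surj n y hy := by
    obtain ⟨g, hg, h0, rfl⟩ := mem_cyclicCochains_iff.1 hy
    refine ⟨cls 𝒜 (unitalDeg deg) (extendUnit I g), mem_cyclicCochains_iff.2
      ⟨_, extendUnit_mem_homog hg, ?_, rfl⟩, ?_⟩
    · rw [extendUnit, if_pos (by simp)]; exact h0
    · rw [piMap_cls, restrictUnit_extendUnit]
  acyclic n x hx hπ hd := by
    obtain ⟨f, hf, h0, rfl⟩ := mem_cyclicCochains_iff.1 hx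
    obtain ⟨h, hh, hh0, he⟩ := mem_normalisedCochains_iff.1 hd
    rw [S.lieOp_cls, cls_eq_cls_iff, mem_commutators_iff _ _ hodd, map_sub, sub_eq_zero] at he
    rw [piMap_cls, cls_eq_zero_iff, mem_commutators_iff _ _ hodd] at hπ
    obtain ⟨g, hg, hg0, hgN⟩ := S.exists_primitive hodd hunital hmin hf
      (fun w hw => by
        rw [← he.2, cycNorm_congr (g := 0), map_zero]
        · rfl
        · exact fun u hu => incl_of_mem _ (hu.mem_iff.2 hw))
      (fun w _ hw0 => by
        rw [eq_replicate_of_wt_eq_zero hw0, cycNorm_restrictUnit, hπ.2]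
        rfl)
    refine ⟨cls 𝒜 (unitalDeg deg) g, mem_cyclicCochains_iff.2 ⟨g, hg, hg0 [] rfl, rfl⟩, ?_, ?_⟩
    · rw [piMap_cls, show restrictUnit g = 0 from ?_, map_zero]
      ext w
      rw [restrictUnit_apply, hg0 _ (wt_replicate_none _)]
      rfl
    · set F := f - S.m g with hF
      have hFh : F ∈ homog 𝒜 (unitalDeg deg) (n + 1 + 1) :=
        Submodule.sub_mem _ hf (S.degree_one _ _ hg)
      have hF0 : F [] = 0 := by rw [hF, Pi.sub_apply, h0, S.m_apply_nil, sub_zero]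
      have hi : divLen (cycNorm (unitalDeg deg) F) =
          incl fun v => divLen (cycNorm (unitalDeg deg) F) (v.map some) :=
        eq_incl fun w hw => by rw [divLen_apply, hgN w hw, mul_zero]
      refine mem_normalisedCochains_iff.2 ⟨_, restrict_mem_homog
        (divLen_mem_homog (cycNorm_mem_homog hFh)), mul_zero _, ?_⟩
      rw [← hi, S.lieOp_cls, ← map_sub, cls_eq_cls_iff, mem_commutators_iff _ _ hodd]
      refine ⟨?_, ?_⟩
      · rw [Pi.sub_apply, ← hF, hF0, divLen_apply, cycNorm_nil, mul_zero, sub_zero]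
      · rw [map_sub, cycNorm_divLen_of_rot_eq _ (rot_cycNorm _ _) rfl, sub_self]

end Normalised

/-! ### Lie series -/

section Lie

variable {K : Type u} [CommRing K] {J : Type v} {deg : J → ℤ}

theorem IsLieMonomial.hasPar {p : ℤ} {f : NCSeries K J} (h : IsLieMonomial K deg p f) :
    HasPar deg p f := by
  induction h with
  | letter j =>
    have := hasPar_mono (K := K) deg [j]
    rwa [par, wordDeg, List.map_singleton, List.sum_singleton] at this
  | @bracket p q f g _ _ hf hg =>
    rw [bracket_eq, sub_eq_add_neg, ← neg_smul, Int.cast_add]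
    refine (hf.mul hg).add (HasPar.smul ?_ _)
    rw [add_comm]
    exact hg.mul hf

theorem cycNorm_mono_apply_of_length_ne {u w : List J} (h : w.length ≠ u.length) :
    cycNorm deg (mono K u) w = 0 := by
  rw [cycNorm_congr (g := 0), map_zero]
  · rfl
  · intro v hv
    refine mono_of_ne ?_
    rintro rfl
    exact h hv.length_eq.symm

/-- A Lie series is a sum of commutators apart from its linear part. -/
theorem cycNorm_apply_of_mem_lieHat {f : NCSeries K J} (hf : f ∈ lieHat K deg) {w : List J}
    (hw : 2 ≤ w.length) : cycNorm deg f w = 0 := by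
  have key : ∀ g ∈ Submodule.span K {f | ∃ p, IsLieMonomial K deg p f}, cycNorm deg g w = 0 := by
    intro g hg
    induction hg using Submodule.span_induction with
    | zero => rw [map_zero]; rfl
    | add x y _ _ hx hy => rw [map_add, Pi.add_apply, hx, hy, add_zero]
    | smul a x _ hx => rw [map_smul, Pi.smul_apply, hx, smul_zero]
    | mem x hx =>
      obtain ⟨p, hp⟩ := hx
      cases hp with
      | letter j =>
        exact cycNorm_mono_apply_of_length_ne (by rw [List.length_singleton]; omega)
      | bracket hf hg => rw [cycNorm_bracket deg hf.hasPar hg.hasPar]; rfl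
  obtain ⟨F, hF⟩ := isContinuous_cycNorm (K := K) deg w
  obtain ⟨g, hg, h⟩ := hf F
  have := hF (f - g) fun u hu => by rw [Pi.sub_apply, h u hu, sub_self]
  rwa [map_sub, Pi.sub_apply, key g hg, sub_zero] at this

theorem letter_mem_lieHat (j : J) : letter K j ∈ lieHat K deg :=
  fun _ => ⟨_, Submodule.subset_span ⟨_, IsLieMonomial.letter j⟩, fun _ _ => rfl⟩

end Lie

section LieStructure

variable {K : Type u} [CommRing K] [Algebra ℚ K] {𝒜 : ℤ → Submodule ℚ K} {J : Type v}
  {deg : J → ℤ}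

/-- In a minimal `C∞`-algebra every letter is a cocycle modulo commutators. -/
theorem AInfStructure.IsCInf.cycNorm_m_letter {S : AInfStructure 𝒜 deg} (hC : S.IsCInf)
    (hmin : S.IsMinimal) (j : J) : cycNorm deg (S.m (letter K j)) = 0 := by
  ext w
  rcases w with _ | ⟨a, _ | ⟨b, w⟩⟩
  · rfl
  · rw [cycNorm_apply]
    simpa using hmin j a
  · exact cycNorm_apply_of_mem_lieHat (hC _ (letter_mem_lieHat j)) (by simp)

/-- A minimal structure raises the length of words. -/
theorem AInfStructure.length_of_m_letter_ne_zero {S : AInfStructure 𝒜 deg}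
    (hmin : S.IsMinimal) {j : J} {w : List J}
    (h : S.m (mono K [j]) w ≠ 0) : 1 + 1 ≤ wt (fun _ => 1) w := by
  rw [wt_one]
  rcases w with _ | ⟨a, _ | ⟨b, w⟩⟩
  · exact absurd (S.vanishes_at_zero j) h
  · exact absurd (hmin j a) h
  · simp

end LieStructure

/-! ### The periodicity operator -/

section SolveRot

variable {K : Type u} [CommRing K]

theorem sum_mul_sub_succ (P : ℕ → K) (n : ℕ) :
    ∑ i ∈ Finset.range n, (i : K) * (P i - P (i + 1)) =
      ∑ i ∈ Finset.range n, P i + (P n - P 0) - n * P n := by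
  induction n with
  | zero => simp
  | succ n ih =>
    rw [Finset.sum_range_succ, Finset.sum_range_succ, ih]
    push_cast
    ring

theorem sum_range_mul_neg_one_pow (k : ℕ) :
    ∑ i ∈ Finset.range (2 * k), (i : K) * (-1) ^ i = -k := by
  induction k with
  | zero => simp
  | succ k ih =>
    rw [show 2 * (k + 1) = 2 * k + 1 + 1 by ring, Finset.sum_range_succ, Finset.sum_range_succ, ih,
      pow_succ, pow_mul]
    push_cast
    ring

variable [Algebra ℚ K] {J : Type v} (deg : J → ℤ)

/-- A solution `h` of `h - rot h = g`, for `g` of norm zero and without constant term: it is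
verified by summation by parts. -/
def solveRot (g : NCSeries K J) : NCSeries K J :=
  -divLen fun w => ∑ i ∈ Finset.range w.length, (i : K) * (rot deg ^ i) g w

theorem solveRot_sub_rot {g : NCSeries K J} (h0 : g [] = 0) (hg : cycNorm deg g = 0) :
    solveRot deg g - rot deg (solveRot deg g) = g := by
  rw [solveRot, map_neg, divLen, rot_diag deg (by simp)]
  ext w
  rw [Pi.sub_apply, Pi.neg_apply, Pi.neg_apply, diag_apply, diag_apply]
  rcases w with _ | ⟨a, w⟩
  · simp [h0]
  set n := (a :: w).length with hn
  have e : rot deg (fun w => ∑ i ∈ Finset.range w.length, (i : K) * (rot deg ^ i) g w) (a :: w) =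
      ∑ i ∈ Finset.range n, (i : K) * (rot deg ^ (i + 1)) g (a :: w) := by
    rw [rot_cons, Finset.mul_sum]
    rw [show (w ++ [a]).length = n by simp [hn]]
    refine Finset.sum_congr rfl fun i _ => ?_
    rw [pow_succ', Module.End.mul_apply, rot_cons, mul_left_comm]
  have hs := sum_mul_sub_succ (fun i => (rot deg ^ i) g (a :: w)) n
  have hN : ∑ i ∈ Finset.range n, (rot deg ^ i) g (a :: w) = 0 := congrFun hg (a :: w)
  have hP : (rot deg ^ n) g (a :: w) = g (a :: w) := rot_pow_length deg g (a :: w)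
  simp only [mul_sub, Finset.sum_sub_distrib] at hs
  rw [e]
  rw [hN, hP, pow_zero, Module.End.one_apply] at hs
  have hq := rat_inv_mul_cast (K := K) (n := n) (by simp [hn])
  linear_combination (-algebraMap ℚ K (n : ℚ)⁻¹) * hs + g (a :: w) * hq

variable {deg} {𝒜 : ℤ → Submodule ℚ K}

theorem solveRot_mem_homog {n : ℤ} {g : NCSeries K J} (hg : g ∈ homog 𝒜 deg n) :
    solveRot deg g ∈ homog 𝒜 deg n := by
  refine Submodule.neg_mem _ (divLen_mem_homog fun w => Submodule.sum_mem _ fun i _ => ?_)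
  rw [← nsmul_eq_mul]
  exact nsmul_mem (rot_pow_mem_homog hg i w) i

theorem solveRot_apply_eq_zero {g : NCSeries K J} {w : List J} (h : ∀ u, u.Perm w → g u = 0) :
    solveRot deg g w = 0 := by
  rw [solveRot, Pi.neg_apply, divLen_apply, Finset.sum_eq_zero, mul_zero, neg_zero]
  intro i _
  rw [rot_pow_congr deg i (g := 0) h, map_zero, Pi.zero_apply, mul_zero]

end SolveRot

section Degrees

variable {K : Type u} [CommRing K] [Algebra ℚ K] {𝒜 : ℤ → Submodule ℚ K} [GradedAlgebra 𝒜]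
  {J : Type v} {deg : J → ℤ}

theorem mul_mem_homog {p q : ℤ} {f g : NCSeries K J} (hf : f ∈ homog 𝒜 deg p)
    (hg : g ∈ homog 𝒜 deg q) : mul f g ∈ homog 𝒜 deg (p + q) := by
  intro w
  refine Submodule.sum_mem _ fun k _ => ?_
  have := SetLike.mul_mem_graded (hf (w.take k)) (hg (w.drop k))
  rwa [sub_add_sub_comm, ← wordDeg_append, List.take_append_drop] at this

theorem oneForm_mem_homog {p q : ℤ} {f g : NCSeries K J} (hf : f ∈ homog 𝒜 deg p)
    (hg : g ∈ homog 𝒜 deg q) : oneForm deg f g ∈ homog 𝒜 deg (p + q) := by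
  intro w
  rw [oneForm_apply]
  refine Submodule.sum_mem _ fun i _ => rot_pow_mem_homog (mul_mem_homog hf fun v => ?_) i w
  rw [lenGT, diag_apply]
  split_ifs
  · rw [one_mul]; exact hg v
  · rw [zero_mul]; exact Submodule.zero_mem _

theorem AInfStructure.act_mem_homog (hodd : ∀ n, Odd n → 𝒜 n = ⊥) (S : AInfStructure 𝒜 deg)
    {n : ℤ} {f : NCSeries K J} (hf : f ∈ homog 𝒜 deg n) :
    (S.isOddDerivation hodd).act f ∈ homog 𝒜 deg (n + 1) := by
  have hD := S.isOddDerivation hodd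
  have hm : ∀ u, hD.act (mono K u) ∈ homog 𝒜 deg (wordDeg deg u + 1) := by
    intro u
    rcases List.eq_nil_or_concat u with rfl | ⟨v, j, rfl⟩
    · rw [hD.act_mono_nil]; exact Submodule.zero_mem _
    have hv := mono_mem_homog deg 𝒜 v
    have hj := mono_mem_homog deg 𝒜 [j]
    rw [List.concat_eq_append, hD.act_mono_concat, wordDeg_append]
    refine Submodule.add_mem _ ?_ fun w => sg_mul_mem _ _ ?_
    · have := oneForm_mem_homog (S.degree_one _ _ hv) hj
      rwa [add_right_comm] at this
    · have := oneForm_mem_homog hv (S.degree_one _ _ hj) w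
      rwa [← add_assoc] at this
  intro w
  obtain ⟨F, hF⟩ := hD.isContinuous_act.exists_eq_sum w
  rw [hF]
  refine Submodule.sum_mem _ fun u _ => ?_
  have := SetLike.mul_mem_graded (hf u) (hm u w)
  rwa [show n - wordDeg deg u + (wordDeg deg u + 1 - wordDeg deg w) = n + 1 - wordDeg deg w by
    ring] at this

end Degrees

section Periodicity

variable {K : Type u} [CommRing K] [Algebra ℚ K] {𝒜 : ℤ → Submodule ℚ K} [GradedAlgebra 𝒜]
  {J : Type v} {deg : J → ℤ} (hodd : ∀ n, Odd n → 𝒜 n = ⊥)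

namespace AInfStructure

variable (S : AInfStructure 𝒜 deg)

/-- The periodicity operator on cyclic cocycles: `m f`, being a sum of commutators, is `h - rot h`
for a one-form `h`, whose Lie derivative along `m` is rotation invariant and so is the norm of a
series. -/
noncomputable def periodicity (f : NCSeries K J) : NCSeries K J :=
  divLen ((S.isOddDerivation hodd).act (solveRot deg (S.m f)))

theorem periodicity_mem_homog {n : ℤ} {f : NCSeries K J} (hf : f ∈ homog 𝒜 deg n) :
    S.periodicity hodd f ∈ homog 𝒜 deg (n + 2) := by
  have := divLen_mem_homog (S.act_mem_homog hodd (solveRot_mem_homog (S.degree_one _ _ hf)))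
  rwa [add_assoc] at this

theorem cycNorm_m_periodicity {f : NCSeries K J} (hf : cycNorm deg (S.m f) = 0) :
    cycNorm deg (S.m (S.periodicity hodd f)) = 0 := by
  have hD := S.isOddDerivation hodd
  have hrot : rot deg (hD.act (solveRot deg (S.m f))) = hD.act (solveRot deg (S.m f)) := by
    rw [← sub_eq_zero, ← neg_eq_zero, neg_sub, hD.act_sub_rot, ← map_sub,
      solveRot_sub_rot deg (S.m_apply_nil f) hf, S.sq_zero]
  have h0 : hD.act (solveRot deg (S.m f)) [] = 0 := by
    refine hD.isContinuous_act.apply_eq_zero fun u _ => ?_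
    rcases List.eq_nil_or_concat u with rfl | ⟨v, j, rfl⟩
    · rw [hD.act_mono_nil]; rfl
    · rw [List.concat_eq_append, hD.act_mono_concat, Pi.add_apply, Pi.smul_apply, oneForm_apply,
        oneForm_apply]
      simp
  rw [← hD.act_cycNorm, periodicity, cycNorm_divLen_of_rot_eq deg hrot h0, hD.act_act S.sq_zero]

theorem periodicity_apply_eq_zero (hmin : S.IsMinimal) {n : ℕ} {f : NCSeries K J}
    (hf : ∀ u, u.length < n → f u = 0) {w : List J} (hw : w.length < n + 2) :
    S.periodicity hodd f w = 0 := by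
  have hD := S.isOddDerivation hodd
  have hl : ∀ j w, S.m (mono K [j]) w ≠ 0 → 1 + 1 ≤ wt (fun _ => 1) w :=
    fun j w => length_of_m_letter_ne_zero hmin
  simp only [← wt_one (J := J)] at hf hw
  rw [periodicity, divLen_apply,
    (hD.raises_act hl).apply_eq_zero hD.isContinuous_act (n := n + 1) ?_ (by omega), mul_zero]
  intro u hu
  refine solveRot_apply_eq_zero fun v hv => ?_
  rw [← wt_perm _ hv] at hu
  exact (hD.raises hl).apply_eq_zero hD.continuous hf hu

end AInfStructure

end Periodicity

/-! ### Lifting the cocycles of the ground ring -/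

section Lifts

variable {K : Type u} [CommRing K] [Algebra ℚ K] {𝒜 : ℤ → Submodule ℚ K} [GradedAlgebra 𝒜]
  {I : Type v} {deg : I → ℤ} (hodd : ∀ n, Odd n → 𝒜 n = ⊥)

theorem perm_replicate_none {n : ℕ} {u : List (Option I)}
    (h : u.Perm (List.replicate n none)) : u = List.replicate n none :=
  List.perm_replicate.1 h

theorem unit_eq_replicate (w : List Unit) : w = List.replicate w.length () :=
  List.eq_replicate_of_mem fun _ _ => rfl

/-- On even powers of `τ` the operator `solveRot` is division by two. -/
theorem solveRot_replicate_none (g : NCSeries K (Option I)) (k : ℕ) :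
    solveRot (unitalDeg deg) g (List.replicate (2 * (k + 1)) none) =
      algebraMap ℚ K 2⁻¹ * g (List.replicate (2 * (k + 1)) none) := by
  set n := 2 * (k + 1) with hn
  have h : ∀ i ∈ Finset.range n, (i : K) * (rot (unitalDeg deg) ^ i) g (List.replicate n none) =
      (i : K) * (-1) ^ i * g (List.replicate n none) := by
    intro i hi
    have hi' : i < n := Finset.mem_range.1 hi
    rw [rot_pow_apply _ _ (by simpa using hi'.le), List.take_replicate, List.drop_replicate,
      ← List.replicate_add, min_eq_left hi'.le, Nat.sub_add_cancel hi'.le, par_replicate_none,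
      par_replicate_none, ← Nat.cast_mul, sg_natCast, mul_assoc]
    congr 2
    rcases Nat.even_or_odd i with he | ho
    · rw [if_pos (he.mul_right _), he.neg_one_pow]
    · have : Odd (n - i) := by
        obtain ⟨j, hj⟩ := ho
        exact ⟨k - j, by omega⟩
      rw [if_neg (Nat.not_even_iff_odd.2 (ho.mul this)), ho.neg_one_pow]
  rw [solveRot, Pi.neg_apply, divLen_apply, List.length_replicate, Finset.sum_congr rfl h,
    ← Finset.sum_mul, hn, sum_range_mul_neg_one_pow, ← hn]
  have e : algebraMap ℚ K (n : ℚ)⁻¹ * ((k + 1 : ℕ) : K) = algebraMap ℚ K 2⁻¹ := by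
    rw [← map_natCast (algebraMap ℚ K), ← map_mul, hn]
    congr 1
    have : ((k + 1 : ℕ) : ℚ) ≠ 0 := by positivity
    rw [Nat.cast_mul]
    field_simp
    norm_num
  rw [← e]
  ring

namespace AInfStructure

variable (S : AInfStructure 𝒜 (unitalDeg deg)) (hunital : S.IsUnital) (hmin : S.IsMinimal)

include hodd hunital hmin

theorem m_apply_replicate_none (f : NCSeries K (Option I)) (n : ℕ) :
    S.m f (List.replicate n none) =
      if n ≠ 0 ∧ Even n then f (List.replicate (n - 1) none) else 0 := by
  have h := congrFun (S.restrictUnit_m hodd hunital hmin f) (List.replicate n ())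
  rw [restrictUnit_apply, List.length_replicate] at h
  rw [h]
  change (if List.replicate n () ≠ [] ∧ Even (List.replicate n ()).length then
    restrictUnit f (List.replicate n ()).tail else 0) = _
  rw [restrictUnit_apply, List.length_tail, List.length_replicate]
  simp

/-- For odd `b`, the action of `m` takes the one-form `τ^b dτ` to `-τ^{b+1} dτ`, up to terms
containing some `t_i`; no other one-form contributes to `τ^{b+1} dτ`. -/
theorem act_apply_replicate_none (h : NCSeries K (Option I)) (k : ℕ) :
    (S.isOddDerivation hodd).act h (List.replicate (2 * k + 3) none) =
      -h (List.replicate (2 * k + 2) none) := by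
  have hD := S.isOddDerivation hodd
  have hl : ∀ j w, S.m (mono K [j]) w ≠ 0 → tWt j + 0 ≤ wt tWt w := by
    intro j w hw
    by_contra h1
    refine hw (S.m_apply_eq_zero hodd hunital hmin (n := tWt j) (fun u hu => mono_of_ne ?_)
      (by omega))
    rintro rfl
    simp [wt_cons] at hu
  have hraise := hD.raises_act hl
  -- the action on the monomials `τ^b dτ`
  have hmono : ∀ b, hD.act (mono K (List.replicate (b + 1) none))
      (List.replicate (2 * k + 3) none) = if b = 2 * k + 1 then -1 else 0 := by
    intro b
    rw [List.replicate_succ', hD.act_mono_concat, Pi.add_apply, Pi.smul_apply,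
      oneForm_mono_singleton, List.replicate_succ' (n := 2 * k + 2), mul_mono_singleton_concat,
      S.m_apply_replicate_none hodd hunital hmin, if_pos ⟨by omega, ⟨k + 1, by ring⟩⟩,
      ← List.replicate_succ', mono_self, mul_one]
    -- only the term `τ²` of `m τ` contributes to powers of `τ`
    have h2 : oneForm (unitalDeg deg) (mono K (List.replicate b none)) (S.m (mono K [none]))
        (List.replicate (2 * k + 3) none) =
        oneForm (unitalDeg deg) (mono K (List.replicate b none)) (mono K [none, none])
          (List.replicate (2 * k + 3) none) := by
      rw [← sub_eq_zero, ← Pi.sub_apply, ← map_sub]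
      by_contra h3
      obtain ⟨x, y, hxy, -, hy⟩ := exists_of_oneForm_ne_zero _ h3
      have hxy' := perm_replicate_none hxy
      obtain ⟨-, -, hy'⟩ := List.append_eq_replicate_iff.1 hxy'
      refine hy ?_
      rw [hy', Pi.sub_apply, S.m_apply_replicate_none hodd hunital hmin]
      generalize y.length = l
      by_cases hl2 : l = 2
      · subst hl2
        rw [if_pos ⟨by simp, by simp⟩]
        simp [mono]
      · rw [mono_of_ne (u := [none, none]), sub_zero]
        · split_ifs with h4
          · refine mono_of_ne fun h5 => hl2 ?_
            have := congrArg List.length h5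
            simp at this
            omega
          · rfl
        · intro h5
          have := congrArg List.length h5
          simp at this
          exact hl2 this
    have h3 : ∀ c, mono K (List.replicate c (none : Option I)) (List.replicate (2 * k + 3) none) =
        if c = 2 * k + 3 then 1 else 0 := by
      intro c
      split_ifs with hc
      · rw [hc, mono_self]
      · refine mono_of_ne fun h4 => hc ?_
        have := congrArg List.length h4
        simpa using this.symm
    have h4 : List.replicate b (none : Option I) ++ [none, none] = List.replicate (b + 2) none := by
      rw [List.replicate_add]; rfl
    have h5 : rot (unitalDeg deg) (mono K (List.replicate (b + 2) none)) =
        sg K ((b + 1 : ℕ) : ZMod 2) • mono K (List.replicate (b + 2) none) := by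
      have := rot_pow_mono (K := K) (unitalDeg deg) (List.replicate (b + 1) none) [none]
      rwa [par_replicate_none, par_none, mul_one, ← List.replicate_succ', List.singleton_append,
        ← List.replicate_succ, List.length_singleton, pow_one] at this
    rw [h2, oneForm_mono_mono, h4]
    simp only [List.length_cons, List.length_nil, Finset.sum_range_succ, Finset.sum_range_zero,
      zero_add, pow_zero, pow_one, Module.End.one_apply, Pi.add_apply]
    rw [h5, Pi.smul_apply, h3, par_replicate_none, sg_natCast, sg_natCast]
    by_cases hb : b = 2 * k + 1
    · subst hb
      have e1 : ¬ Even (2 * k + 1) := by simp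
      have e2 : Even (2 * k + 1 + 1) := ⟨k + 1, by ring⟩
      rw [if_pos rfl, if_pos rfl, if_neg e1, if_pos e2,
        show 2 * k + 2 - 1 = 2 * k + 1 by omega, mono_self]
      simp only [smul_eq_mul]
      ring
    · rw [if_neg (show ¬b + 2 = 2 * k + 3 by omega), if_neg hb, mono_of_ne]
      · simp
      · intro h6
        have := congrArg List.length h6
        simp at this
        omega
  set T := List.replicate (2 * k + 2) (none : Option I) with hT
  have hsub : hD.act (h - h T • mono K T) (List.replicate (2 * k + 3) none) = 0 := by
    refine hD.isContinuous_act.apply_eq_zero fun u hu => ?_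
    by_contra h1
    have h2 := hraise u _ h1
    rw [wt_replicate_none] at h2
    have hu0 := eq_replicate_of_wt_eq_zero (w := u) (by omega)
    generalize u.length = l at hu0
    subst hu0
    rcases l with _ | b
    · rw [List.replicate_zero, hD.act_mono_nil] at h1
      exact h1 rfl
    · rw [hmono] at h1
      have hb : b = 2 * k + 1 := by
        by_contra hb
        exact h1 (if_neg hb)
      subst hb
      refine hu ?_
      rw [Pi.sub_apply, Pi.smul_apply, ← hT, mono_self, smul_eq_mul, mul_one, sub_self]
  rw [map_sub, map_smul, Pi.sub_apply, Pi.smul_apply, hT, hmono, if_pos rfl, ← hT,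
    smul_eq_mul] at hsub
  linear_combination hsub

theorem periodicity_apply_replicate_none (f : NCSeries K (Option I)) (k : ℕ) :
    S.periodicity hodd f (List.replicate (2 * k + 3) none) =
      algebraMap ℚ K (-2 * (2 * k + 3))⁻¹ * f (List.replicate (2 * k + 1) none) := by
  rw [periodicity, divLen_apply, List.length_replicate,
    S.act_apply_replicate_none hodd hunital hmin, show 2 * k + 2 = 2 * (k + 1) by ring,
    solveRot_replicate_none, S.m_apply_replicate_none hodd hunital hmin,
    if_pos ⟨by omega, even_two_mul _⟩, mul_neg, ← mul_assoc, ← map_mul, ← neg_mul, ← map_neg]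
  congr 2
  have : (2 * k + 3 : ℚ) ≠ 0 := by positivity
  push_cast
  field_simp

/-- In a `C∞`-algebra every odd power of `τ` lifts to a cocycle, by iterating the periodicity
operator on `τ`. -/
theorem exists_cocycle_lift (hC : S.IsCInf) (k : ℕ) :
    ∃ x ∈ homog 𝒜 (unitalDeg deg) (2 * k + 1), cycNorm (unitalDeg deg) (S.m x) = 0 ∧
      (∀ u, u.length < 2 * k + 1 → x u = 0) ∧
      ∀ j, x (List.replicate (2 * j + 1) none) = if j = k then 1 else 0 := by
  induction k with
  | zero =>
    refine ⟨mono K [none], ?_, hC.cycNorm_m_letter hmin none, fun u hu => mono_of_ne ?_,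
      fun j => ?_⟩
    · have := mono_mem_homog (K := K) (unitalDeg deg) 𝒜 [none]
      simpa [wordDeg, unitalDeg] using this
    · rintro rfl
      simp at hu
    · split_ifs with hj
      · subst hj; exact mono_self _
      · refine mono_of_ne fun h => hj ?_
        have := congrArg List.length h
        simpa using this
  | succ k ih =>
    obtain ⟨x, hx, hN, hl, hT⟩ := ih
    -- the periodicity operator divides the coefficient by this number
    set q : ℚ := -2 * (2 * k + 3) with hq
    refine ⟨algebraMap ℚ K q • S.periodicity hodd x, fun w => algebraMap_mul_mem _ _ ?_, ?_,
      fun u hu => ?_, fun j => ?_⟩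
    · have := S.periodicity_mem_homog hodd hx w
      rwa [show (2 * (k : ℤ) + 1 + 2) = 2 * ((k + 1 : ℕ) : ℤ) + 1 by push_cast; ring] at this
    · rw [map_smul, map_smul, S.cycNorm_m_periodicity hodd hN, smul_zero]
    · rw [Pi.smul_apply, S.periodicity_apply_eq_zero hodd hmin hl (by omega), smul_zero]
    · rw [Pi.smul_apply, smul_eq_mul]
      rcases j with _ | j
      · rw [S.periodicity_apply_eq_zero hodd hmin (n := 0) (by simp) (by simp), mul_zero,
          if_neg (by omega)]
      · rw [show 2 * (j + 1) + 1 = 2 * j + 3 by ring,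
          S.periodicity_apply_replicate_none hodd hunital hmin, hT]
        by_cases hj : j = k
        · subst hj
          have hq0 : q ≠ 0 := by
            have : (0 : ℚ) < 2 * j + 3 := by positivity
            rw [hq]
            exact mul_ne_zero (by norm_num) this.ne'
          rw [if_pos rfl, if_pos rfl, mul_one, ← map_mul, ← hq, mul_inv_cancel₀ hq0, map_one]
        · rw [if_neg hj, if_neg (by omega), mul_zero, mul_zero]

/-- In a `C∞`-algebra every cochain of the ground ring lifts to a cocycle modulo commutators. -/
theorem exists_lift_of_isCInf (hC : S.IsCInf) {n : ℤ} {g : NCSeries K Unit}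
    (hg : g ∈ homog 𝒜 (fun _ : Unit => 0) n) (hg0 : g [] = 0) :
    ∃ f ∈ homog 𝒜 (unitalDeg deg) n, f [] = 0 ∧ cycNorm (unitalDeg deg) (S.m f) = 0 ∧
      restrictUnit f - g ∈ commutators 𝒜 (fun _ : Unit => 0) := by
  choose x hx hN hl hT using S.exists_cocycle_lift hodd hunital hmin hC
  set F : ℕ → NCSeries K (Option I) := fun k => g (List.replicate (2 * k + 1) ()) • x k with hF
  have hFa : ∀ k w, F k w = g (List.replicate (2 * k + 1) ()) * x k w := fun _ _ => rfl
  have hF0 : ∀ k w, List.length w < k → F k w = 0 := by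
    intro k w hw
    rw [hFa, hl k w (by omega), mul_zero]
  refine ⟨locSum List.length F, locSum_mem_homog fun k w => ?_, ?_, ?_, ?_⟩
  · have := SetLike.mul_mem_graded (hg (List.replicate (2 * k + 1) ())) (hx k w)
    rw [wordDeg_unit, List.length_replicate] at this
    push_cast at this
    rwa [show n - (2 * (k : ℤ) + 1) + (2 * (k : ℤ) + 1 - wordDeg (unitalDeg deg) w) =
      n - wordDeg (unitalDeg deg) w by ring] at this
  · rw [locSum_apply hF0 (n := 1) (by simp), Finset.sum_range_one, hFa,
      hl 0 [] (by simp), mul_zero]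
  · ext w
    obtain ⟨N, h⟩ := ((isContinuous_cycNorm (unitalDeg deg)).comp S.continuous).map_locSum hF0 w
    refine (h N le_rfl).trans (Finset.sum_eq_zero fun k _ => ?_)
    rw [hF, map_smul, LinearMap.comp_apply, hN, smul_zero]
    rfl
  · set φ := restrictUnit (locSum List.length F) - g with hφ
    have hφodd : ∀ j, φ (List.replicate (2 * j + 1) ()) = 0 := by
      intro j
      rw [hφ, Pi.sub_apply, restrictUnit_apply, List.length_replicate,
        locSum_apply hF0 (n := 2 * j + 2) (by simp), Finset.sum_eq_single j, hFa, hT,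
        if_pos rfl, mul_one, sub_self]
      · intro k _ hk
        rw [hFa, hT, if_neg hk.symm, mul_zero]
      · intro hj
        exact absurd (Finset.mem_range.2 (by omega)) hj
    rw [mem_commutators_iff _ _ hodd]
    refine ⟨?_, ?_⟩
    · rw [hφ, Pi.sub_apply, hg0, sub_zero, restrictUnit_apply,
        locSum_apply hF0 (n := 1) (by simp), Finset.sum_range_one, hFa,
        hl 0 _ (by simp), mul_zero]
    · ext w
      rw [unit_eq_replicate w]
      generalize w.length = l
      rcases Nat.even_or_odd' l with ⟨j, rfl | rfl⟩
      · -- an even power of `τ` is a commutator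
        rcases j with _ | j
        · rfl
        have h := eq_of_rot_eq _ (rot_cycNorm (fun _ : Unit => 0) φ) [()]
          (List.replicate (2 * j + 1) ())
        rw [List.singleton_append, ← List.replicate_succ, ← List.replicate_succ', par, par,
          wordDeg_unit, wordDeg_unit, List.length_replicate, List.length_singleton] at h
        have hs : sg K (((1 : ℕ) : ℤ) * ((2 * j + 1 : ℕ) : ℤ) : ZMod 2) = -1 := by
          have := sg_natCast (K := K) (2 * j + 1)
          rw [if_neg (by simp)] at this
          rw [← this]
          simp
        rw [hs] at h
        rw [show 2 * (j + 1) = 2 * j + 1 + 1 by ring]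
        have h2 := rat_inv_mul_cast (K := K) (n := 2) (by norm_num)
        rw [Pi.zero_apply]
        push_cast at h2
        linear_combination (-cycNorm (fun _ : Unit => 0) φ (List.replicate (2 * j + 1 + 1) ())) * h2
          + algebraMap ℚ K (2 : ℚ)⁻¹ * h
      · rw [cycNorm_congr (g := 0), map_zero]
        intro u hu
        rw [List.perm_replicate.1 hu, hφodd]
        rfl

end AInfStructure

end Lifts

end HomotopyAlg

theorem mainTheorem11 {K : Type*} [CommRing K] [Algebra ℚ K] (𝒜 : ℤ → Submodule ℚ K)
    [GradedAlgebra 𝒜] (hodd : ∀ n, Odd n → 𝒜 n = ⊥)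
    {I : Type*} (deg : I → ℤ) (hdeg : ∀ i, 0 ≤ deg i)
    (S : AInfStructure 𝒜 (unitalDeg deg)) (hunital : S.IsUnital) (hmin : S.IsMinimal) :
    -- the `0`-forms on `V̄` are a submodule of those on `V`
    (∀ f : NCSeries K I, incl f ∈ commutators 𝒜 (unitalDeg deg) → f ∈ commutators 𝒜 deg) ∧
    -- the normalised cochains form a subcomplex
    (∀ n, normalisedCochains 𝒜 deg n ≤ cyclicCochains 𝒜 (unitalDeg deg) n) ∧
    (∀ n, ∀ x ∈ normalisedCochains 𝒜 deg n, S.lieOp x ∈ normalisedCochains 𝒜 deg (n + 1)) ∧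
    -- the long exact sequence
    ∃ (ι : ∀ n, HCNorm S n →ₗ[ℚ] HC S n)
      (π : ∀ n, HC S n →ₗ[ℚ] HC (groundStructure hodd) n)
      (δ : ∀ n, HC (groundStructure hodd) n →ₗ[ℚ] HCNorm S (n + 1)),
      (∀ n, IsInducedBy (ι n) LinearMap.id) ∧
      (∀ n, IsInducedBy (π n) (piMap 𝒜 deg)) ∧
      -- `δ` is the connecting map: `δ [π x] = [d x]` whenever `d x` is normalised
      (∀ n, ∀ x ∈ cyclicCochains 𝒜 (unitalDeg deg) n,
        S.lieOp x ∈ normalisedCochains 𝒜 deg (n + 1) →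
        ∃ (hx : piMap 𝒜 deg x ∈
            cocycles (groundStructure hodd).lieOp (cyclicCochains 𝒜 (fun _ => 0)) n)
          (hy : S.lieOp x ∈ cocycles S.lieOp (normalisedCochains 𝒜 deg) (n + 1)),
          δ n (Cohomology.mk _ hx) = Cohomology.mk _ hy) ∧
      (∀ n, Function.Exact (ι n) (π n)) ∧
      (∀ n, Function.Exact (π n) (δ n)) ∧
      (∀ n, Function.Exact (δ n) (ι (n + 1))) ∧
      -- if `V` is moreover `C∞`, the connecting map is zero
      (S.IsCInf → ∀ n, δ n = 0) := by
  have E := exactData hodd S hunital hmin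
  obtain ⟨ι, π, δ, h1, h2, h3, h4, h5, h6, h7⟩ := E.exists_longExact
  refine ⟨fun f => mem_commutators_of_incl hodd, E.le, E.d_mem_sub, ι, π, δ, h1, h2, h3, h4, h5, h6,
    fun hC => h7 fun n z hz => ?_⟩
  obtain ⟨g, hg, hg0, rfl⟩ := mem_cyclicCochains_iff.1 hz.1
  obtain ⟨f, hf, hf0, hN, hfg⟩ := S.exists_lift_of_isCInf hodd hunital hmin hC hg hg0
  refine ⟨cls 𝒜 (unitalDeg deg) f, mem_cyclicCochains_iff.2 ⟨f, hf, hf0, rfl⟩, ?_, ?_⟩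
  · rw [piMap_cls, cls_eq_cls_iff]
    exact hfg
  · rw [S.lieOp_cls, cls_eq_zero_iff, mem_commutators_iff _ _ hodd]
    exact ⟨S.m_apply_nil f, hN⟩
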